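/- **Tessarines.** Let $\mathbb T$ be the commutative real algebra of numbers $x=x_r+\eta x_\eta+\eta' x_{\eta'}+\eta'' x_{\eta''}$ with $\eta\eta'=\eta''$, $\eta'\eta''=\eta$, $\eta''\eta=-\eta'$, $\eta^2=\eta''^2=-1$, $\eta'^2=1$. Put $x^*=x_r-\eta x_\eta+\eta'x_{\eta'}-\eta''x_{\eta''}$, $x^{\eta}=x_r+\eta x_\eta-\eta'x_{\eta'}-\eta''x_{\eta''}$, $x^{\eta''}=x_r-\eta x_\eta-\eta'x_{\eta'}+\eta''x_{\eta''}$; for a matrix $A$, $A^{\mathtt H}$ is the transpose of $A^*$. For a vector $\mathbf x\in\mathbb T^n$ let $\bar{\mathbf x}=[\mathbf x^{\mathtt T},\mathbf x^{*\mathtt T},\mathbf x^{\eta\,\mathtt T},\mathbf x^{\eta''\,\mathtt T}]^{\mathtt T}$, $\mathbf x^r=[\mathbf x_r^{\mathtt T},\mathbf x_\eta^{\mathtt T},\mathbf x_{\eta'}^{\mathtt T},\mathbf x_{\eta''}^{\mathtt T}]^{\mathtt T}$, $\mathbf x_1=\mathbf x$ and $\mathbf x_2=[\mathbf x^{\mathtt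 T},\mathbf x^{*\mathtt T}]^{\mathtt T}$. The product $\star$ of two vectors is the entrywise product in each of the four real components. For random vectors $\boldsymbol\Gamma_{\mathbf x\mathbf y}(t,s)=E[\mathbf x(t)\mathbf y^{\mathtt H}(s)]$ and $\boldsymbol\Gamma_{\mathbf x}=\boldsymbol\Gamma_{\mathbf x\mathbf x}$; $\mathbf x$ and $\mathbf y$ are cross $\mathbb T_k$-proper if $\boldsymbol\Gamma_{\mathbf x\mathbf y^\nu}(t,s)=0$ for all $t,s$ and $\nu\in\{*,\eta,\eta''\}$ (if $k=1$), $\nu\in\{\eta,\eta''\}$ (if $k=2$), and $\mathbf x$ is $\mathbb T_k$-proper if this holds with $\mathbf y=\mathbf x$. The LLMS estimator of a random vector from given random vectors is its projection on them, i.e. the $\mathbb T$-linear function of them whose error is orthogonal to them ($E[\text{error}\cdot\text{datum}^{\mathtt H}]=0$), equivalently which minimizes the mean square of each error component. **Model.** For $t\ge 0$, with deterministic $\mathbf F_j(t)\in\mathbb T^{n\times n}$, $$\mathbf x(t+1)=\mathbf F_1(t)\mathbf x(t)+\mathbf F_2(t)\mathbf x^*(t)+\mathbf F_3(t)\mathbf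 x^{\eta}(t)+\mathbf F_4(t)\mathbf x^{\eta''}(t)+\mathbf u(t),$$ and for sensors $i=1,\dots,R$: $\mathbf z^{(i)}(t)=\mathbf x(t)+\mathbf v^{(i)}(t)$ for $t\ge1$, $\mathbf y^{(i)}(1)=\mathbf z^{(i)}(1)$ and $$\mathbf y^{(i)}(t)=\boldsymbol\gamma^{(i)}(t)\star\mathbf z^{(i)}(t)+(\mathbf 1-\boldsymbol\gamma^{(i)}(t))\star\mathbf y^{(i)}(t-1),\qquad t\ge2,$$ where $\mathbf 1$ has all real components equal to $1$. The vectors $\mathbf x(0),\mathbf u(t),\mathbf v^{(i)}(t)$ have zero mean and finite second moments; $\boldsymbol\Gamma_{\bar{\mathbf u}}(t,s)=0$ and $\boldsymbol\Gamma_{\bar{\mathbf v}^{(i)}}(t,s)=0$ and $\boldsymbol\Gamma_{\bar{\mathbf u}\bar{\mathbf v}^{(i)}}(t,s)=0$ for $t\ne s$; $\boldsymbol\Gamma_{\bar{\mathbf v}^{(i)}\bar{\mathbf v}^{(l)}}=0$ for $i\ne l$; and $\bar{\mathbf x}(0)$ is uncorrelated with all $\bar{\mathbf u}(t)$, $\bar{\mathbf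 v}^{(i)}(t)$. The components $\gamma^{(i)}_{j,\nu}(t)$ ($t\ge2$) are independent Bernoulli variables, independent of $\mathbf x(0)$ and of the noises, with $P(\gamma^{(i)}_{j,\nu}(t)=1)=p^{(i)}_{j,\nu}(t)$; put $p^{(i)}_{j,\nu}(1)=1$. Let $\vec{\mathbf y}(t)$ and $\mathbf y_k(t)$ be the stacks over $i$ of $\bar{\mathbf y}^{(i)}(t)$ and of $\mathbf y^{(i)}_k(t)$. Let $\bar{\mathbf Q}(t)=\boldsymbol\Gamma_{\bar{\mathbf u}}(t,t)$, $\bar{\mathbf P}_0=\boldsymbol\Gamma_{\bar{\mathbf x}}(0,0)$, $\vec{\mathbf R}(t)=\mathrm{diag}_i(\boldsymbol\Gamma_{\bar{\mathbf v}^{(i)}}(t,t))$, $\vec{\mathbf S}(t)=[\boldsymbol\Gamma_{\bar{\mathbf u}\bar{\mathbf v}^{(i)}}(t,t)]_{i=1}^R$; let $\mathbf Q_k,\mathbf P_{0_k},\mathbf R_k,\mathbf S_k$ be the same with $(\cdot)_k$ in place of the bar. Let $\bar{\boldsymbol\Phi}(t)$ be the matrix with $\bar{\mathbf x}(t+1)=\bar{\boldsymbol\Phi}(t)\bar{\mathbf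 x}(t)+\bar{\mathbf u}(t)$ whose block rows are $[\mathbf F_1,\mathbf F_2,\mathbf F_3,\mathbf F_4]$, $[\mathbf F_2^*,\mathbf F_1^*,\mathbf F_4^*,\mathbf F_3^*]$, $[\mathbf F_3^\eta,\mathbf F_4^\eta,\mathbf F_1^\eta,\mathbf F_2^\eta]$, $[\mathbf F_4^{\eta''},\mathbf F_3^{\eta''},\mathbf F_2^{\eta''},\mathbf F_1^{\eta''}]$, and $\boldsymbol\Phi_k(t)$ its leading $kn\times kn$ block. Let $\mathcal A$ be the $4\times4$ matrix with $\bar x=\mathcal A x^r$ for $x\in\mathbb T$, $\mathcal B_k$ its first $k$ rows, $\boldsymbol\Upsilon=\mathbf I_R\otimes(\tfrac12\mathcal A\otimes\mathbf I_n)$, $\boldsymbol\Upsilon_k=\mathbf I_R\otimes(\tfrac12\mathcal B_k\otimes\mathbf I_n)$, $\boldsymbol{\mathcal C}=\mathbf 1_R\otimes\mathbf I_{4n}$, $\boldsymbol{\mathcal C}_k=\mathbf 1_R\otimes\mathbf I_{kn}$, and let $\circ$ be the Hadamard product. Let $\vec{\boldsymbol\gamma}^r(t)$ be the stack over $i$ of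 $(\boldsymbol\gamma^{(i)}(t))^r$ and $\mathbf p(t)$ its mean; its second-order matrices $\mathrm{Cov}(\vec{\boldsymbol\gamma}^r)$, $\boldsymbol\Gamma_{\vec{\boldsymbol\gamma}^r}$, $\boldsymbol\Gamma_{\vec{\boldsymbol\gamma}^r(\mathbf 1-\vec{\boldsymbol\gamma}^r)}$, $\boldsymbol\Gamma_{\mathbf 1-\vec{\boldsymbol\gamma}^r}$ at $(t,t)$ have the entries, for indices $a,b$ of components: $p_a(1-p_a)$, $p_a$, $0$, $1-p_a$ if $a=b$, and $0$, $p_ap_b$, $p_a(1-p_b)$, $(1-p_a)(1-p_b)$ if $a\neq b$. Put $\bar{\boldsymbol\Pi}^{\vec{\boldsymbol\gamma}}(t)=\boldsymbol\Upsilon\,\mathrm{diag}(\mathbf p(t))\boldsymbol\Upsilon^{\mathtt H}$, $\bar{\boldsymbol\Pi}^{\mathbf 1-\vec{\boldsymbol\gamma}}(t)=\boldsymbol\Upsilon\,\mathrm{diag}(\mathbf 1-\mathbf p(t))\boldsymbol\Upsilon^{\mathtt H}$ and $\boldsymbol\Pi_k(t)=\mathrm{diag}_i(\boldsymbol\Pi_k^{(i)}(t))$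 with $$\boldsymbol\Pi_1^{(i)}=\mathrm{diag}_j(p^{(i)}_{j,r}),\qquad \boldsymbol\Pi_2^{(i)}=\tfrac12\begin{bmatrix}\boldsymbol\Pi_a^{(i)}&\boldsymbol\Pi_b^{(i)}\\ \boldsymbol\Pi_b^{(i)}&\boldsymbol\Pi_a^{(i)}\end{bmatrix},\quad \boldsymbol\Pi_a^{(i)}=\mathrm{diag}_j(p^{(i)}_{j,r}+p^{(i)}_{j,\eta}),\quad \boldsymbol\Pi_b^{(i)}=\mathrm{diag}_j(p^{(i)}_{j,r}-p^{(i)}_{j,\eta}).$$ **$\mathbb T_k$-properness conditions** ($k\in\{1,2\}$). $\mathbf x(0)$, $\mathbf u$ and every $\mathbf v^{(i)}$ are $\mathbb T_k$-proper; $\mathbf u$ and $\mathbf v^{(i)}$ are cross $\mathbb T_k$-proper; $\mathbf F_2=\mathbf F_3=\mathbf F_4=0$ if $k=1$ and $\mathbf F_3=\mathbf F_4=0$ if $k=2$; and, for all $i,j$ and $t\ge2$, $p^{(i)}_{j,r}=p^{(i)}_{j,\eta}=p^{(i)}_{j,\eta'}=p^{(i)}_{j,\eta''}$ if $k=1$,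 and $p^{(i)}_{j,r}=p^{(i)}_{j,\eta'}$, $p^{(i)}_{j,\eta}=p^{(i)}_{j,\eta''}$ if $k=2$. **Algorithm.** Define $\boldsymbol\Gamma_{\bar{\mathbf x}}(0,0)=\bar{\mathbf P}_0$, $\boldsymbol\Gamma_{\bar{\mathbf x}}(t,t)=\bar{\boldsymbol\Phi}(t-1)\boldsymbol\Gamma_{\bar{\mathbf x}}(t-1,t-1)\bar{\boldsymbol\Phi}^{\mathtt H}(t-1)+\bar{\mathbf Q}(t-1)$ for $t\ge1$; $\boldsymbol\Gamma_{\bar{\mathbf x}\vec{\mathbf y}}(1,1)=\boldsymbol\Gamma_{\bar{\mathbf x}}(1,1)\boldsymbol{\mathcal C}^{\mathtt T}$, $\boldsymbol\Gamma_{\vec{\mathbf y}}(1,1)=\boldsymbol{\mathcal C}\boldsymbol\Gamma_{\bar{\mathbf x}}(1,1)\boldsymbol{\mathcal C}^{\mathtt T}+\vec{\mathbf R}(1)$, and for $t\ge2$, with $\mathbf B(t)=\bar{\boldsymbol\Phi}(t-1)\boldsymbol\Gamma_{\bar{\mathbf x}\vec{\mathbf y}}(t-1,t-1)+\vec{\mathbf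 S}(t-1)\bar{\boldsymbol\Pi}^{\vec{\boldsymbol\gamma}}(t-1)$, $$\boldsymbol\Psi_1(t)=\boldsymbol\Upsilon^{\mathtt H}\boldsymbol{\mathcal C}\boldsymbol\Gamma_{\bar{\mathbf x}}(t,t)\boldsymbol{\mathcal C}^{\mathtt T}\boldsymbol\Upsilon,\quad \boldsymbol\Psi_2(t)=\boldsymbol\Upsilon^{\mathtt H}\boldsymbol{\mathcal C}\mathbf B(t)\boldsymbol\Upsilon,\quad \boldsymbol\Psi_3(t)=\boldsymbol\Upsilon^{\mathtt H}\boldsymbol\Gamma_{\vec{\mathbf y}}(t-1,t-1)\boldsymbol\Upsilon,$$ $$\boldsymbol\Gamma_{\bar{\mathbf x}\vec{\mathbf y}}(t,t)=\boldsymbol\Gamma_{\bar{\mathbf x}}(t,t)\boldsymbol{\mathcal C}^{\mathtt T}\bar{\boldsymbol\Pi}^{\vec{\boldsymbol\gamma}}(t)+\mathbf B(t)\bar{\boldsymbol\Pi}^{\mathbf 1-\vec{\boldsymbol\gamma}}(t),$$ $$\boldsymbol\Gamma_{\vec{\mathbf y}}(t,t)=\boldsymbol\Upsilon\{\boldsymbol\Gamma_{\vec{\boldsymbol\gamma}^r}\circ(\boldsymbol\Psi_1+\boldsymbol\Upsilon^{\mathtt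 H}\vec{\mathbf R}\boldsymbol\Upsilon)+\boldsymbol\Gamma_{\vec{\boldsymbol\gamma}^r(\mathbf 1-\vec{\boldsymbol\gamma}^r)}\circ\boldsymbol\Psi_2+\boldsymbol\Gamma_{\vec{\boldsymbol\gamma}^r(\mathbf 1-\vec{\boldsymbol\gamma}^r)}^{\mathtt T}\circ\boldsymbol\Psi_2^{\mathtt H}+\boldsymbol\Gamma_{\mathbf 1-\vec{\boldsymbol\gamma}^r}\circ\boldsymbol\Psi_3\}\boldsymbol\Upsilon^{\mathtt H}.$$ Let $\mathbf D_k(1)$ be the leading $kn\times kn$ block of $\boldsymbol\Gamma_{\bar{\mathbf x}}(1,1)$, $\mathbf P_k(0|0)=\mathbf P_{0_k}$, $\mathbf P_k(1|0)=\mathbf D_k(1)$, $\hat{\mathbf x}_k(0|0)=\hat{\mathbf x}_k(1|0)=0$, $\boldsymbol\epsilon_k(1)=\mathbf y_k(1)$, $\boldsymbol\Theta_k(1)=\mathbf 1_R^{\mathtt T}\otimes\mathbf D_k(1)$, $\boldsymbol\Omega_k(1)=\boldsymbol{\mathcal C}_k\mathbf D_k(1)\boldsymbol{\mathcal C}_k^{\mathtt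 T}+\mathbf R_k(1)$; for $t\ge2$ $$\boldsymbol\epsilon_k(t)=\mathbf y_k(t)-\boldsymbol\Pi_k(t)\boldsymbol{\mathcal C}_k\hat{\mathbf x}_k(t|t-1)-(\mathbf I-\boldsymbol\Pi_k(t))\mathbf y_k(t-1),\qquad \boldsymbol\Theta_k(t)=\mathbf P_k(t|t-1)\boldsymbol{\mathcal C}_k^{\mathtt T}\boldsymbol\Pi_k(t),$$ $$\boldsymbol\Omega_k(t)=\boldsymbol\Upsilon_k\{\mathrm{Cov}(\vec{\boldsymbol\gamma}^r(t))\circ(\boldsymbol\Psi_1-\boldsymbol\Psi_2-\boldsymbol\Psi_2^{\mathtt H}+\boldsymbol\Psi_3)(t)\}\boldsymbol\Upsilon_k^{\mathtt H}+\boldsymbol\Upsilon_k\{\boldsymbol\Gamma_{\vec{\boldsymbol\gamma}^r}(t,t)\circ(\boldsymbol\Upsilon^{\mathtt H}\vec{\mathbf R}(t)\boldsymbol\Upsilon)\}\boldsymbol\Upsilon_k^{\mathtt H}+\boldsymbol\Pi_k(t)\boldsymbol{\mathcal C}_k\mathbf P_k(t|t-1)\boldsymbol{\mathcal C}_k^{\mathtt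 T}\boldsymbol\Pi_k(t);$$ and for $t\ge1$, with $\mathbf L_k=\boldsymbol\Theta_k\boldsymbol\Omega_k^{-1}$ and $\mathbf H_k=\mathbf S_k\boldsymbol\Pi_k\boldsymbol\Omega_k^{-1}$, $$\hat{\mathbf x}_k(t|t)=\hat{\mathbf x}_k(t|t-1)+\mathbf L_k(t)\boldsymbol\epsilon_k(t),\qquad \hat{\mathbf x}_k(t+1|t)=\boldsymbol\Phi_k(t)\hat{\mathbf x}_k(t|t)+\mathbf H_k(t)\boldsymbol\epsilon_k(t),$$ $$\mathbf P_k(t|t)=\mathbf P_k(t|t-1)-\boldsymbol\Theta_k(t)\boldsymbol\Omega_k^{-1}(t)\boldsymbol\Theta_k^{\mathtt H}(t),$$ $$\mathbf P_k(t+1|t)=\boldsymbol\Phi_k\mathbf P_k(t|t)\boldsymbol\Phi_k^{\mathtt H}-\boldsymbol\Phi_k\boldsymbol\Theta_k\mathbf H_k^{\mathtt H}-\mathbf H_k\boldsymbol\Theta_k^{\mathtt H}\boldsymbol\Phi_k^{\mathtt H}-\mathbf H_k\boldsymbol\Omega_k\mathbf H_k^{\mathtt H}+\mathbf Q_k\quad(\text{at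 time } t).$$ **Theorem.** Let $k\in\{1,2\}$, let the model satisfy the $\mathbb T_k$-properness conditions, and let every $\boldsymbol\Omega_k(t)$, $t\ge1$, be invertible. Then for all $t$: 1. the first $n$ components of $\hat{\mathbf x}_k(t|t)$ form the LLMS centralized fusion filter of $\mathbf x(t)$ based on $\mathbf y_k(1),\dots,\mathbf y_k(t)$, which is also the LLMS estimator of $\mathbf x(t)$ based on the full augmented measurements $\vec{\mathbf y}(1),\dots,\vec{\mathbf y}(t)$; its error pseudo covariance matrix is the leading $n\times n$ block of $\mathbf P_k(t|t)$; 2. $\hat{\mathbf x}_k(t|t)$ and $\hat{\mathbf x}_k(t+1|t)$ are the LLMS estimators of $\mathbf x_k(t)$ and $\mathbf x_k(t+1)$ based on $\mathbf y_k(1),\dots,\mathbf y_k(t)$, with error pseudo covariance matrices $\mathbf P_k(t|t)$ and $\mathbf P_k(t+1|t)$; 3. for $t\ge1$, $\boldsymbol\epsilon_k(t)$ is the difference of $\mathbf y_k(t)$ and its LLMS estimator based on $\mathbf y_k(1),\dots,\mathbf y_k(t-1)$, $\boldsymbol\Theta_k(t)=E[\mathbf x_k(t)\boldsymbol\epsilon_k^{\mathtt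 H}(t)]$ and $\boldsymbol\Omega_k(t)=E[\boldsymbol\epsilon_k(t)\boldsymbol\epsilon_k^{\mathtt H}(t)]$; 4. the recursively defined $\boldsymbol\Gamma_{\bar{\mathbf x}}(t,t)$ ($t\ge0$), $\boldsymbol\Gamma_{\bar{\mathbf x}\vec{\mathbf y}}(t,t)$ and $\boldsymbol\Gamma_{\vec{\mathbf y}}(t,t)$ ($t\ge1$) are the pseudo correlations $E[\bar{\mathbf x}(t)\bar{\mathbf x}^{\mathtt H}(t)]$, $E[\bar{\mathbf x}(t)\vec{\mathbf y}^{\mathtt H}(t)]$ and $E[\vec{\mathbf y}(t)\vec{\mathbf y}^{\mathtt H}(t)]$. -/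

import Mathlib

open MeasureTheory ProbabilityTheory
open scoped Matrix Kronecker

noncomputable section

/-! ### Tessarines -/

/-- The tessarines `x_r + η x_η + η' x_η' + η'' x_η''`, with real components
`re`, `e1`, `e2`, `e3` along `1`, `η`, `η'`, `η''`. -/
@[ext]
structure Tessarine where
  re : ℝ
  e1 : ℝ
  e2 : ℝ
  e3 : ℝ

namespace Tessarine

instance : Zero Tessarine := ⟨⟨0, 0, 0, 0⟩⟩
instance : One Tessarine := ⟨⟨1, 0, 0, 0⟩⟩
instance : Add Tessarine := ⟨fun x y => ⟨x.re + y.re, x.e1 + y.e1, x.e2 + y.e2, x.e3 + y.e3⟩⟩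
instance : Neg Tessarine := ⟨fun x => ⟨-x.re, -x.e1, -x.e2, -x.e3⟩⟩
instance : Sub Tessarine := ⟨fun x y => ⟨x.re - y.re, x.e1 - y.e1, x.e2 - y.e2, x.e3 - y.e3⟩⟩

/-- The commutative product with `η η' = η''`, `η' η'' = η`, `η'' η = -η'`,
`η² = η''² = -1`, `η'² = 1`. -/
instance : Mul Tessarine := ⟨fun x y =>
  ⟨x.re * y.re - x.e1 * y.e1 + x.e2 * y.e2 - x.e3 * y.e3,
   x.re * y.e1 + x.e1 * y.re + x.e2 * y.e3 + x.e3 * y.e2,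
   x.re * y.e2 + x.e2 * y.re - x.e1 * y.e3 - x.e3 * y.e1,
   x.re * y.e3 + x.e3 * y.re + x.e1 * y.e2 + x.e2 * y.e1⟩⟩

@[simp] theorem re_zero : (0 : Tessarine).re = 0 := rfl
@[simp] theorem e1_zero : (0 : Tessarine).e1 = 0 := rfl
@[simp] theorem e2_zero : (0 : Tessarine).e2 = 0 := rfl
@[simp] theorem e3_zero : (0 : Tessarine).e3 = 0 := rfl
@[simp] theorem re_one : (1 : Tessarine).re = 1 := rfl
@[simp] theorem e1_one : (1 : Tessarine).e1 = 0 := rfl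
@[simp] theorem e2_one : (1 : Tessarine).e2 = 0 := rfl
@[simp] theorem e3_one : (1 : Tessarine).e3 = 0 := rfl
@[simp] theorem re_add (x y : Tessarine) : (x + y).re = x.re + y.re := rfl
@[simp] theorem e1_add (x y : Tessarine) : (x + y).e1 = x.e1 + y.e1 := rfl
@[simp] theorem e2_add (x y : Tessarine) : (x + y).e2 = x.e2 + y.e2 := rfl
@[simp] theorem e3_add (x y : Tessarine) : (x + y).e3 = x.e3 + y.e3 := rfl
@[simp] theorem re_neg (x : Tessarine) : (-x).re = -x.re := rfl
@[simp] theorem e1_neg (x : Tessarine) : (-x).e1 = -x.e1 := rfl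
@[simp] theorem e2_neg (x : Tessarine) : (-x).e2 = -x.e2 := rfl
@[simp] theorem e3_neg (x : Tessarine) : (-x).e3 = -x.e3 := rfl
@[simp] theorem re_sub (x y : Tessarine) : (x - y).re = x.re - y.re := rfl
@[simp] theorem e1_sub (x y : Tessarine) : (x - y).e1 = x.e1 - y.e1 := rfl
@[simp] theorem e2_sub (x y : Tessarine) : (x - y).e2 = x.e2 - y.e2 := rfl
@[simp] theorem e3_sub (x y : Tessarine) : (x - y).e3 = x.e3 - y.e3 := rfl
@[simp] theorem re_mul (x y : Tessarine) :
    (x * y).re = x.re * y.re - x.e1 * y.e1 + x.e2 * y.e2 - x.e3 * y.e3 := rfl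
@[simp] theorem e1_mul (x y : Tessarine) :
    (x * y).e1 = x.re * y.e1 + x.e1 * y.re + x.e2 * y.e3 + x.e3 * y.e2 := rfl
@[simp] theorem e2_mul (x y : Tessarine) :
    (x * y).e2 = x.re * y.e2 + x.e2 * y.re - x.e1 * y.e3 - x.e3 * y.e1 := rfl
@[simp] theorem e3_mul (x y : Tessarine) :
    (x * y).e3 = x.re * y.e3 + x.e3 * y.re + x.e1 * y.e2 + x.e2 * y.e1 := rfl

instance : CommRing Tessarine where
  add_assoc x y z := by ext <;> simp <;> ring
  zero_add x := by ext <;> simp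
  add_zero x := by ext <;> simp
  add_comm x y := by ext <;> simp <;> ring
  neg_add_cancel x := by ext <;> simp
  sub_eq_add_neg x y := by ext <;> simp <;> ring
  mul_assoc x y z := by ext <;> simp <;> ring
  one_mul x := by ext <;> simp
  mul_one x := by ext <;> simp
  left_distrib x y z := by ext <;> simp <;> ring
  right_distrib x y z := by ext <;> simp <;> ring
  mul_comm x y := by ext <;> simp <;> ring
  zero_mul x := by ext <;> simp
  mul_zero x := by ext <;> simp
  nsmul := nsmulRec
  zsmul := zsmulRec

/-- The four conjugations, in the order in which they occur in an augmented vector: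
`conj 0 x = x`, `conj 1 x = x^*`, `conj 2 x = x^η`, `conj 3 x = x^η''`. -/
def conj (a : Fin 4) (x : Tessarine) : Tessarine :=
  match a with
  | 0 => x
  | 1 => ⟨x.re, -x.e1, x.e2, -x.e3⟩
  | 2 => ⟨x.re, x.e1, -x.e2, -x.e3⟩
  | 3 => ⟨x.re, -x.e1, -x.e2, x.e3⟩

/-- `star` is the tessarine conjugate `x^*`, so that `ᴴ` is the Hermitian transpose. -/
instance : StarRing Tessarine where
  star := conj 1
  star_involutive x := by ext <;> simp [conj]
  star_mul x y := by ext <;> simp [conj] <;> ring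
  star_add x y := by ext <;> simp [conj] <;> ring

/-- A real number as a tessarine. -/
def ofReal (r : ℝ) : Tessarine := ⟨r, 0, 0, 0⟩

/-- The real components of a tessarine, in the order `r, η, η', η''`. -/
def comp (x : Tessarine) (ν : Fin 4) : ℝ :=
  match ν with
  | 0 => x.re
  | 1 => x.e1
  | 2 => x.e2
  | 3 => x.e3

/-- The units `1, η, η', η''`. -/
def unit (ν : Fin 4) : Tessarine :=
  match ν with
  | 0 => ⟨1, 0, 0, 0⟩
  | 1 => ⟨0, 1, 0, 0⟩
  | 2 => ⟨0, 0, 1, 0⟩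
  | 3 => ⟨0, 0, 0, 1⟩

/-- The squared modulus `x_r² + x_η² + x_η'² + x_η''²`. -/
def normSq (x : Tessarine) : ℝ := x.re ^ 2 + x.e1 ^ 2 + x.e2 ^ 2 + x.e3 ^ 2

/-- The componentwise product `⋆` of two tessarines. -/
def starProd (x y : Tessarine) : Tessarine :=
  ⟨x.re * y.re, x.e1 * y.e1, x.e2 * y.e2, x.e3 * y.e3⟩

/-- The neutral element of `⋆` (all four real components equal to one). -/
def ones : Tessarine := ⟨1, 1, 1, 1⟩

end Tessarine

open Tessarine

/-! ### Random tessarine vectors -/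

/-- Expectation of a tessarine random variable (component by component). -/
def tExp {Ω : Type*} [MeasurableSpace Ω] (μ : Measure Ω) (X : Ω → Tessarine) : Tessarine :=
  ⟨∫ ω, (X ω).re ∂μ, ∫ ω, (X ω).e1 ∂μ, ∫ ω, (X ω).e2 ∂μ, ∫ ω, (X ω).e3 ∂μ⟩

/-- The pseudo correlation matrix `E[X Yᴴ]` of two tessarine random vectors. -/
def pcorr {Ω : Type*} [MeasurableSpace Ω] (μ : Measure Ω) {ι κ : Type*}
    (X : Ω → ι → Tessarine) (Y : Ω → κ → Tessarine) : Matrix ι κ Tessarine :=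
  Matrix.of fun i j => tExp μ fun ω => X ω i * star (Y ω j)

/-- The vector conjugated entrywise by `conj a`. -/
def conjVec {Ω : Type*} {ι : Type*} (a : Fin 4) (X : Ω → ι → Tessarine) : Ω → ι → Tessarine :=
  fun ω i => conj a (X ω i)

/-- The augmented vector `[xᵀ, x^*ᵀ, x^ηᵀ, x^η''ᵀ]ᵀ`. -/
def aug {Ω : Type*} {ι : Type*} (X : Ω → ι → Tessarine) : Ω → Fin 4 × ι → Tessarine :=
  fun ω a => conj a.1 (X ω a.2)

/-- The inclusion of the first `k ≤ 4` blocks among the four blocks of an augmented vector. -/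
def blk {k : ℕ} (a : Fin k) : Fin 4 := Fin.ofNat 4 a.val

/-- The first `k` blocks of the augmented vector: `x` for `k = 1`, `[xᵀ, x^*ᵀ]ᵀ` for `k = 2`. -/
def red {Ω : Type*} {ι : Type*} (k : ℕ) (X : Ω → ι → Tessarine) : Ω → Fin k × ι → Tessarine :=
  fun ω a => conj (blk a.1) (X ω a.2)

/-- The stack of the vectors of the `R` sensors. -/
def stack {Ω : Type*} {ι : Type*} {R : ℕ} (X : Fin R → Ω → ι → Tessarine) :
    Ω → Fin R × ι → Tessarine :=
  fun ω a => X a.1 ω a.2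

/-- `X` and `Y` are cross `𝕋_k`-proper: `E[X(t) Y^ν(s)ᴴ] = 0` for all `t, s`, where
`ν ∈ {*, η, η''}` for `k = 1` and `ν ∈ {η, η''}` for `k = 2`. -/
def CrossProper {Ω : Type*} [MeasurableSpace Ω] (μ : Measure Ω) (k : ℕ) {ι κ : Type*}
    (X : ℕ → Ω → ι → Tessarine) (Y : ℕ → Ω → κ → Tessarine) : Prop :=
  ∀ t s : ℕ, ∀ a : Fin 4, k ≤ a.val → pcorr μ (X t) (conjVec a (Y s)) = 0

/-- `Xhat` is the linear least-mean-squares estimator of the random vector `X` based on the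
measurements `Y 1, …, Y t`: it is a (tessarine) linear function of them, the estimation error is
orthogonal to all of them (so that `Xhat` is the projection of `X` on them), and each of its
components has the least mean squared error among all linear functions of them. -/
structure IsLLMS {Ω : Type*} [MeasurableSpace Ω] (μ : Measure Ω) {ι κ : Type*} [Fintype κ]
    (X : Ω → ι → Tessarine) (Y : ℕ → Ω → κ → Tessarine) (t : ℕ)
    (Xhat : Ω → ι → Tessarine) : Prop where
  linear : ∃ A : ℕ → Matrix ι κ Tessarine, ∀ ω, Xhat ω = ∑ s ∈ Finset.Icc 1 t, A s *ᵥ Y s ω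
  orthogonal : ∀ s ∈ Finset.Icc 1 t, pcorr μ (X - Xhat) (Y s) = 0
  optimal : ∀ (B : ℕ → Matrix ι κ Tessarine) (i : ι),
    ∫ ω, normSq (X ω i - Xhat ω i) ∂μ ≤
      ∫ ω, normSq (X ω i - (∑ s ∈ Finset.Icc 1 t, B s *ᵥ Y s ω) i) ∂μ

/-! ### Constant matrices -/

/-- `1_R ⊗ I`. -/
def onesKron (R : ℕ) (ι : Type*) [DecidableEq ι] : Matrix (Fin R × ι) ι Tessarine :=
  Matrix.of fun a b => if a.2 = b then 1 else 0

/-- Block diagonal matrix with the `R` given blocks. -/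
def diagBlocks {R : ℕ} {ι κ : Type*} (B : Fin R → Matrix ι κ Tessarine) :
    Matrix (Fin R × ι) (Fin R × κ) Tessarine :=
  Matrix.of fun a b => if a.1 = b.1 then B a.1 a.2 b.2 else 0

/-- `[B⁽¹⁾, …, B⁽ᴿ⁾]`. -/
def rowBlocks {R : ℕ} {ι κ : Type*} (B : Fin R → Matrix ι κ Tessarine) :
    Matrix ι (Fin R × κ) Tessarine :=
  Matrix.of fun a b => B b.1 a b.2

/-- The matrix `𝒜`: row `a` holds `1, η, η', η''` conjugated by `conj a`. -/
def matA : Matrix (Fin 4) (Fin 4) Tessarine :=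
  Matrix.of fun a ν => conj a (unit ν)

/-- `𝒯 = ½ 𝒜 ⊗ I_n`. -/
def matT (n : ℕ) : Matrix (Fin 4 × Fin n) (Fin 4 × Fin n) Tessarine :=
  ofReal (1 / 2) • (matA ⊗ₖ (1 : Matrix (Fin n) (Fin n) Tessarine))

/-- `𝒯_k = ½ ℬ_k ⊗ I_n`, where `ℬ_k` consists of the first `k` rows of `𝒜`. -/
def matTk (k n : ℕ) : Matrix (Fin k × Fin n) (Fin 4 × Fin n) Tessarine :=
  ofReal (1 / 2) • (matA.submatrix (blk (k := k)) id ⊗ₖ (1 : Matrix (Fin n) (Fin n) Tessarine))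

/-- `Υ = I_R ⊗ 𝒯`. -/
def matU (R n : ℕ) : Matrix (Fin R × (Fin 4 × Fin n)) (Fin R × (Fin 4 × Fin n)) Tessarine :=
  (1 : Matrix (Fin R) (Fin R) Tessarine) ⊗ₖ matT n

/-- `Υ_k = I_R ⊗ 𝒯_k`. -/
def matUk (R k n : ℕ) : Matrix (Fin R × (Fin k × Fin n)) (Fin R × (Fin 4 × Fin n)) Tessarine :=
  (1 : Matrix (Fin R) (Fin R) Tessarine) ⊗ₖ matTk k n

/-- `[I_{kn}, 0_{kn × (4-k)n}]`. -/
def selK (k n : ℕ) : Matrix (Fin k × Fin n) (Fin 4 × Fin n) Tessarine :=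
  Matrix.of fun a b => if blk a.1 = b.1 ∧ a.2 = b.2 then 1 else 0

/-- The selection of the first `n` components of a `kn`-dimensional vector. -/
def selFirst (k n : ℕ) : Matrix (Fin n) (Fin k × Fin n) Tessarine :=
  Matrix.of fun j a => if a.1.val = 0 ∧ j = a.2 then 1 else 0

/-! ### The state-space model with multiple packet dropouts -/

/-- Data of the model: `F j` is the matrix sequence written `F_{j+1}`, `x₀` the initial state,
`u` the state noise, `v i` and `γ i` the measurement noise and the dropout variables of sensor
`i`. -/
structure DropoutModel (n R : ℕ) (Ω : Type*) where
  F : Fin 4 → ℕ → Matrix (Fin n) (Fin n) Tessarine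
  x₀ : Ω → Fin n → Tessarine
  u : ℕ → Ω → Fin n → Tessarine
  v : Fin R → ℕ → Ω → Fin n → Tessarine
  γ : Fin R → ℕ → Ω → Fin n → Tessarine

namespace DropoutModel

variable {n R : ℕ} {Ω : Type*} (M : DropoutModel n R Ω)

/-- The state process. -/
def x : ℕ → Ω → Fin n → Tessarine
  | 0 => M.x₀
  | t + 1 => fun ω =>
      M.F 0 t *ᵥ x t ω + M.F 1 t *ᵥ conjVec 1 (x t) ω + M.F 2 t *ᵥ conjVec 2 (x t) ω +
        M.F 3 t *ᵥ conjVec 3 (x t) ω + M.u t ω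

/-- The measured output of sensor `i` (used for `t ≥ 1`). -/
def z (i : Fin R) (t : ℕ) : Ω → Fin n → Tessarine := fun ω => M.x t ω + M.v i t ω

/-- The received measurement of sensor `i` (used for `t ≥ 1`): `y(1) = z(1)` and
`y(t) = γ(t) ⋆ z(t) + (1 - γ(t)) ⋆ y(t-1)` for `t ≥ 2`. -/
def y (i : Fin R) : ℕ → Ω → Fin n → Tessarine
  | 0 => 0
  | 1 => M.z i 1
  | t + 2 => fun ω j =>
      starProd (M.γ i (t + 2) ω j) (M.z i (t + 2) ω j) +
        starProd (ones - M.γ i (t + 2) ω j) (y i (t + 1) ω j)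

/-- The stacked augmented measurement `y⃗(t)`. -/
def yvec (t : ℕ) : Ω → Fin R × (Fin 4 × Fin n) → Tessarine := stack fun i => aug (M.y i t)

/-- The reduced state `x_k(t)`. -/
def xk (k t : ℕ) : Ω → Fin k × Fin n → Tessarine := red k (M.x t)

/-- The reduced stacked measurement `y_k(t)`. -/
def yk (k t : ℕ) : Ω → Fin R × (Fin k × Fin n) → Tessarine := stack fun i => red k (M.y i t)

/-- `Φ̄(t)`; in row `a` and column `b` it has the block `F_j(t)` conjugated by `conj a`, for the
`j` found at `(a, b)` in the table. -/
def Phibar (t : ℕ) : Matrix (Fin 4 × Fin n) (Fin 4 × Fin n) Tessarine :=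
  Matrix.of fun a b =>
    conj a.1 (M.F ((!![0, 1, 2, 3; 1, 0, 3, 2; 2, 3, 0, 1; 3, 2, 1, 0] :
      Matrix (Fin 4) (Fin 4) (Fin 4)) a.1 b.1) t a.2 b.2)

/-- `Φ_k(t)`: `F_1(t)` for `k = 1`, and `[F_1, F_2; F_2^*, F_1^*]` for `k = 2`, the leading block
of `Φ̄(t)`. -/
def Phik (k t : ℕ) : Matrix (Fin k × Fin n) (Fin k × Fin n) Tessarine :=
  (M.Phibar t).submatrix (fun a => (blk a.1, a.2)) (fun a => (blk a.1, a.2))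

variable [MeasurableSpace Ω] (μ : Measure Ω)

/-- The probability `p_{j,ν}^{(i)}(t)` that the component `(j, ν)` of the output of sensor `i` is
received; at time `1` everything is received, as `y(1) = z(1)`. -/
def prob (i : Fin R) (t : ℕ) (j : Fin n) (ν : Fin 4) : ℝ :=
  if t ≤ 1 then 1 else μ.real {ω | (M.γ i t ω j).comp ν = 1}

/-- The standing assumptions on the model. Uncorrelatedness is meant for all pairs of real
components, which is what vanishing pseudo correlations of the augmented vectors say. -/
structure Standing : Prop where
  meas_x₀ : ∀ j ν, Measurable fun ω => (M.x₀ ω j).comp ν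
  meas_u : ∀ t j ν, Measurable fun ω => (M.u t ω j).comp ν
  meas_v : ∀ i t j ν, 1 ≤ t → Measurable fun ω => (M.v i t ω j).comp ν
  meas_γ : ∀ i t j ν, 2 ≤ t → Measurable fun ω => (M.γ i t ω j).comp ν
  memLp_x₀ : ∀ j ν, MemLp (fun ω => (M.x₀ ω j).comp ν) 2 μ
  memLp_u : ∀ t j ν, MemLp (fun ω => (M.u t ω j).comp ν) 2 μ
  memLp_v : ∀ i t j ν, 1 ≤ t → MemLp (fun ω => (M.v i t ω j).comp ν) 2 μ
  mean_x₀ : ∀ j, tExp μ (fun ω => M.x₀ ω j) = 0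
  mean_u : ∀ t j, tExp μ (fun ω => M.u t ω j) = 0
  mean_v : ∀ i t j, 1 ≤ t → tExp μ (fun ω => M.v i t ω j) = 0
  /-- `u` is white -/
  white_u : ∀ t s, t ≠ s → pcorr μ (aug (M.u t)) (aug (M.u s)) = 0
  /-- each `v i` is white -/
  white_v : ∀ i t s, 1 ≤ t → 1 ≤ s → t ≠ s → pcorr μ (aug (M.v i t)) (aug (M.v i s)) = 0
  /-- the measurement noises of different sensors are uncorrelated -/
  uncorr_v : ∀ i l t s, i ≠ l → 1 ≤ t → 1 ≤ s → pcorr μ (aug (M.v i t)) (aug (M.v l s)) = 0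
  /-- state and measurement noises are correlated at equal times only -/
  uncorr_uv : ∀ i t s, 1 ≤ s → t ≠ s → pcorr μ (aug (M.u t)) (aug (M.v i s)) = 0
  uncorr_x₀u : ∀ t, pcorr μ (aug M.x₀) (aug (M.u t)) = 0
  uncorr_x₀v : ∀ i t, 1 ≤ t → pcorr μ (aug M.x₀) (aug (M.v i t)) = 0
  /-- the dropout variables take the values `0` and `1` -/
  bernoulli : ∀ i t j ν, 2 ≤ t →
    ∀ᵐ ω ∂μ, (M.γ i t ω j).comp ν = 0 ∨ (M.γ i t ω j).comp ν = 1
  /-- the dropout variables of all sensors, times and components are independent -/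
  indep_γ : iIndepFun (fun (a : Fin R × ℕ × Fin n × Fin 4) (ω : Ω) =>
    (M.γ a.1 (a.2.1 + 2) ω a.2.2.1).comp a.2.2.2) μ
  /-- they are independent of the initial state and the noises -/
  indep_γ_noise : IndepFun
    (fun (ω : Ω) (a : Fin R × ℕ × Fin n × Fin 4) =>
      (M.γ a.1 (a.2.1 + 2) ω a.2.2.1).comp a.2.2.2)
    (fun (ω : Ω) =>
      ((fun (a : Fin n × Fin 4) => (M.x₀ ω a.1).comp a.2,
        fun (a : ℕ × Fin n × Fin 4) => (M.u a.1 ω a.2.1).comp a.2.2,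
        fun (a : Fin R × ℕ × Fin n × Fin 4) =>
          (M.v a.1 (a.2.1 + 1) ω a.2.2.1).comp a.2.2.2) :
        (Fin n × Fin 4 → ℝ) × (ℕ × Fin n × Fin 4 → ℝ) × (Fin R × ℕ × Fin n × Fin 4 → ℝ))) μ

/-- The conditions of `𝕋_k`-properness on the model (`k = 1, 2`). -/
structure ProperConditions (k : ℕ) : Prop where
  /-- `Φ̄(t)` is block diagonal: `F_2 = F_3 = F_4 = 0` for `k = 1`, `F_3 = F_4 = 0` for `k = 2` -/
  blockDiag : ∀ (a : Fin 4) (t : ℕ), k ≤ a.val → M.F a t = 0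
  proper_x₀ : CrossProper μ k (fun _ => M.x₀) (fun _ => M.x₀)
  proper_u : CrossProper μ k M.u M.u
  proper_v : ∀ i, CrossProper μ k (fun t => M.v i (t + 1)) (fun t => M.v i (t + 1))
  cross_uv : ∀ i, CrossProper μ k M.u (fun t => M.v i (t + 1))
  /-- for `k = 1`, `p_r = p_η = p_η' = p_η''` -/
  prob_one : k = 1 → ∀ i t j ν, 2 ≤ t → M.prob μ i t j ν = M.prob μ i t j 0
  /-- for `k = 2`, `p_r = p_η'` and `p_η = p_η''` -/
  prob_two : k = 2 → ∀ i t j, 2 ≤ t →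
    M.prob μ i t j 0 = M.prob μ i t j 2 ∧ M.prob μ i t j 1 = M.prob μ i t j 3

/-! #### Second-order statistics of the model -/

/-- `Q̄(t)` -/
def Qbar (t : ℕ) : Matrix (Fin 4 × Fin n) (Fin 4 × Fin n) Tessarine :=
  pcorr μ (aug (M.u t)) (aug (M.u t))

/-- `P̄_0` -/
def Pbar0 : Matrix (Fin 4 × Fin n) (Fin 4 × Fin n) Tessarine := pcorr μ (aug M.x₀) (aug M.x₀)

/-- `R⃗(t)`, block diagonal -/
def Rvec (t : ℕ) : Matrix (Fin R × (Fin 4 × Fin n)) (Fin R × (Fin 4 × Fin n)) Tessarine :=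
  diagBlocks fun i => pcorr μ (aug (M.v i t)) (aug (M.v i t))

/-- `S⃗(t)` -/
def Svec (t : ℕ) : Matrix (Fin 4 × Fin n) (Fin R × (Fin 4 × Fin n)) Tessarine :=
  rowBlocks fun i => pcorr μ (aug (M.u t)) (aug (M.v i t))

/-- `Q_k(t)` -/
def Qk (k t : ℕ) : Matrix (Fin k × Fin n) (Fin k × Fin n) Tessarine :=
  pcorr μ (red k (M.u t)) (red k (M.u t))

/-- `P_{0_k}` -/
def P0k (k : ℕ) : Matrix (Fin k × Fin n) (Fin k × Fin n) Tessarine :=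
  pcorr μ (red k M.x₀) (red k M.x₀)

/-- `R_k(t)`, block diagonal -/
def Rk (k t : ℕ) : Matrix (Fin R × (Fin k × Fin n)) (Fin R × (Fin k × Fin n)) Tessarine :=
  diagBlocks fun i => pcorr μ (red k (M.v i t)) (red k (M.v i t))

/-- `S_k(t) = [S_k⁽¹⁾(t), …, S_k⁽ᴿ⁾(t)]` -/
def Sk (k t : ℕ) : Matrix (Fin k × Fin n) (Fin R × (Fin k × Fin n)) Tessarine :=
  rowBlocks fun i => pcorr μ (red k (M.u t)) (red k (M.v i t))

/-! #### Statistics of the dropout variables, as explicit functions of the probabilities -/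

/-- the entries of the mean of `γ⃗ʳ(t)` -/
def pvec (t : ℕ) (a : Fin R × (Fin 4 × Fin n)) : ℝ := M.prob μ a.1 t a.2.2 a.2.1

/-- `Cov(γ⃗ʳ(t))` -/
def covG (t : ℕ) : Matrix (Fin R × (Fin 4 × Fin n)) (Fin R × (Fin 4 × Fin n)) Tessarine :=
  Matrix.of fun a b => ofReal (if a = b then M.pvec μ t a * (1 - M.pvec μ t a) else 0)

/-- `E[γ⃗ʳ(t) γ⃗ʳ(t)ᵀ]` -/
def GamG (t : ℕ) : Matrix (Fin R × (Fin 4 × Fin n)) (Fin R × (Fin 4 × Fin n)) Tessarine :=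
  Matrix.of fun a b =>
    ofReal (if a = b then M.pvec μ t a else M.pvec μ t a * M.pvec μ t b)

/-- `E[γ⃗ʳ(t) (1 - γ⃗ʳ(t))ᵀ]` -/
def GamG1 (t : ℕ) : Matrix (Fin R × (Fin 4 × Fin n)) (Fin R × (Fin 4 × Fin n)) Tessarine :=
  Matrix.of fun a b =>
    ofReal (if a = b then 0 else M.pvec μ t a * (1 - M.pvec μ t b))

/-- `E[(1 - γ⃗ʳ(t)) (1 - γ⃗ʳ(t))ᵀ]` -/
def Gam1 (t : ℕ) : Matrix (Fin R × (Fin 4 × Fin n)) (Fin R × (Fin 4 × Fin n)) Tessarine :=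
  Matrix.of fun a b =>
    ofReal (if a = b then 1 - M.pvec μ t a else (1 - M.pvec μ t a) * (1 - M.pvec μ t b))

/-- `Π̄^γ(t) = Υ diag(E[γ⃗ʳ(t)]) Υᴴ` -/
def Pibar (t : ℕ) : Matrix (Fin R × (Fin 4 × Fin n)) (Fin R × (Fin 4 × Fin n)) Tessarine :=
  matU R n * Matrix.diagonal (fun a => ofReal (M.pvec μ t a)) * (matU R n)ᴴ

/-- `Π̄^{1-γ}(t) = Υ diag(1 - E[γ⃗ʳ(t)]) Υᴴ` -/
def Pibar1 (t : ℕ) : Matrix (Fin R × (Fin 4 × Fin n)) (Fin R × (Fin 4 × Fin n)) Tessarine :=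
  matU R n * Matrix.diagonal (fun a => ofReal (1 - M.pvec μ t a)) * (matU R n)ᴴ

/-- `Π_k^{(i)}(t)`: for `k = 1` it is `diag(p_{1,r}, …, p_{n,r})`; for `k = 2` it is
`½ [Π_a, Π_b; Π_b, Π_a]` with the diagonal matrices `Π_a = diag(p_{j,r} + p_{j,η})` and
`Π_b = diag(p_{j,r} - p_{j,η})`. -/
def Piki (k : ℕ) (i : Fin R) (t : ℕ) : Matrix (Fin k × Fin n) (Fin k × Fin n) Tessarine :=
  Matrix.of fun a b => ofReal <|
    if a.2 = b.2 then
      if k = 1 then M.prob μ i t a.2 0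
      else if a.1 = b.1 then (M.prob μ i t a.2 0 + M.prob μ i t a.2 1) / 2
      else (M.prob μ i t a.2 0 - M.prob μ i t a.2 1) / 2
    else 0

/-- `Π_k(t) = diag(Π_k⁽¹⁾(t), …, Π_k⁽ᴿ⁾(t))` -/
def Pik (k t : ℕ) : Matrix (Fin R × (Fin k × Fin n)) (Fin R × (Fin k × Fin n)) Tessarine :=
  diagBlocks fun i => M.Piki μ k i t

/-! #### The recursions for the second-order moments -/

/-- the recursion for `Γ_x̄(t,t)` -/
def Gx : ℕ → Matrix (Fin 4 × Fin n) (Fin 4 × Fin n) Tessarine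
  | 0 => M.Pbar0 μ
  | t + 1 => M.Phibar t * Gx t * (M.Phibar t)ᴴ + M.Qbar μ t

/-- the recursion for `Γ_x̄y⃗(t,t)`, `t ≥ 1` -/
def Gxy : ℕ → Matrix (Fin 4 × Fin n) (Fin R × (Fin 4 × Fin n)) Tessarine
  | 0 => 0
  | 1 => M.Gx μ 1 * (onesKron R (Fin 4 × Fin n))ᵀ
  | t + 2 => M.Gx μ (t + 2) * (onesKron R (Fin 4 × Fin n))ᵀ * M.Pibar μ (t + 2) +
      (M.Phibar (t + 1) * Gxy (t + 1) + M.Svec μ (t + 1) * M.Pibar μ (t + 1)) *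
        M.Pibar1 μ (t + 2)

/-- `Ψ_1(t)` -/
def Psi1 (t : ℕ) : Matrix (Fin R × (Fin 4 × Fin n)) (Fin R × (Fin 4 × Fin n)) Tessarine :=
  (matU R n)ᴴ * onesKron R (Fin 4 × Fin n) * M.Gx μ t * (onesKron R (Fin 4 × Fin n))ᵀ * matU R n

/-- `Ψ_2(t)`, `t ≥ 2` -/
def Psi2 : ℕ → Matrix (Fin R × (Fin 4 × Fin n)) (Fin R × (Fin 4 × Fin n)) Tessarine
  | 0 => 0
  | t + 1 => (matU R n)ᴴ * onesKron R (Fin 4 × Fin n) *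
      (M.Phibar t * M.Gxy μ t + M.Svec μ t * M.Pibar μ t) * matU R n

/-- the recursion for `Γ_y⃗(t,t)`, `t ≥ 1` -/
def Gy : ℕ → Matrix (Fin R × (Fin 4 × Fin n)) (Fin R × (Fin 4 × Fin n)) Tessarine
  | 0 => 0
  | 1 => onesKron R (Fin 4 × Fin n) * M.Gx μ 1 * (onesKron R (Fin 4 × Fin n))ᵀ + M.Rvec μ 1
  | t + 2 => matU R n *
      (M.GamG μ (t + 2) ⊙ (M.Psi1 μ (t + 2) + (matU R n)ᴴ * M.Rvec μ (t + 2) * matU R n) +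
        M.GamG1 μ (t + 2) ⊙ M.Psi2 μ (t + 2) +
        (M.GamG1 μ (t + 2))ᵀ ⊙ (M.Psi2 μ (t + 2))ᴴ +
        M.Gam1 μ (t + 2) ⊙ ((matU R n)ᴴ * Gy (t + 1) * matU R n)) * (matU R n)ᴴ

/-- `Ψ_3(t)`, `t ≥ 2` -/
def Psi3 : ℕ → Matrix (Fin R × (Fin 4 × Fin n)) (Fin R × (Fin 4 × Fin n)) Tessarine
  | 0 => 0
  | t + 1 => (matU R n)ᴴ * M.Gy μ t * matU R n

/-! #### The filtering algorithm

The matrices at time `t` are first given as functions of the value `P` of `P_k(t|t-1)`. -/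

/-- `D_k(1)` -/
def D1 (k : ℕ) : Matrix (Fin k × Fin n) (Fin k × Fin n) Tessarine :=
  selK k n * M.Gx μ 1 * (selK k n)ᵀ

/-- `Θ_k(t)` from `P = P_k(t|t-1)` -/
def ThetaOf (k : ℕ) (P : Matrix (Fin k × Fin n) (Fin k × Fin n) Tessarine) :
    ℕ → Matrix (Fin k × Fin n) (Fin R × (Fin k × Fin n)) Tessarine
  | 0 => 0
  | 1 => rowBlocks fun _ => M.D1 μ k
  | t + 2 => P * (onesKron R (Fin k × Fin n))ᵀ * M.Pik μ k (t + 2)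

/-- `Ω_k(t)` from `P = P_k(t|t-1)` -/
def OmegaOf (k : ℕ) (P : Matrix (Fin k × Fin n) (Fin k × Fin n) Tessarine) :
    ℕ → Matrix (Fin R × (Fin k × Fin n)) (Fin R × (Fin k × Fin n)) Tessarine
  | 0 => 0
  | 1 => onesKron R (Fin k × Fin n) * M.D1 μ k * (onesKron R (Fin k × Fin n))ᵀ + M.Rk μ k 1
  | t + 2 =>
      matUk R k n * (M.covG μ (t + 2) ⊙ (M.Psi1 μ (t + 2) - M.Psi2 μ (t + 2) -
        (M.Psi2 μ (t + 2))ᴴ + M.Psi3 μ (t + 2))) * (matUk R k n)ᴴ +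
      matUk R k n * (M.GamG μ (t + 2) ⊙ ((matU R n)ᴴ * M.Rvec μ (t + 2) * matU R n)) *
        (matUk R k n)ᴴ +
      M.Pik μ k (t + 2) * onesKron R (Fin k × Fin n) * P * (onesKron R (Fin k × Fin n))ᵀ *
        M.Pik μ k (t + 2)

/-- `H_k(t) = S_k(t) Π_k(t) Ω_k(t)⁻¹` from `P = P_k(t|t-1)` -/
def HOf (k : ℕ) (P : Matrix (Fin k × Fin n) (Fin k × Fin n) Tessarine) (t : ℕ) :
    Matrix (Fin k × Fin n) (Fin R × (Fin k × Fin n)) Tessarine :=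
  M.Sk μ k t * M.Pik μ k t * (M.OmegaOf μ k P t)⁻¹

/-- `P_k(t|t)` from `P = P_k(t|t-1)` -/
def PfiltOf (k : ℕ) (P : Matrix (Fin k × Fin n) (Fin k × Fin n) Tessarine) (t : ℕ) :
    Matrix (Fin k × Fin n) (Fin k × Fin n) Tessarine :=
  P - M.ThetaOf μ k P t * (M.OmegaOf μ k P t)⁻¹ * (M.ThetaOf μ k P t)ᴴ

/-- `P_k(t+1|t)` from `P = P_k(t|t-1)` -/
def PpredStep (k : ℕ) (P : Matrix (Fin k × Fin n) (Fin k × Fin n) Tessarine) (t : ℕ) :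
    Matrix (Fin k × Fin n) (Fin k × Fin n) Tessarine :=
  M.Phik k t * M.PfiltOf μ k P t * (M.Phik k t)ᴴ
    - M.Phik k t * M.ThetaOf μ k P t * (M.HOf μ k P t)ᴴ
    - M.HOf μ k P t * (M.ThetaOf μ k P t)ᴴ * (M.Phik k t)ᴴ
    - M.HOf μ k P t * M.OmegaOf μ k P t * (M.HOf μ k P t)ᴴ + M.Qk μ k t

/-- `Ppred k t` is `P_k(t|t-1)`, `t ≥ 1`. -/
def Ppred (k : ℕ) : ℕ → Matrix (Fin k × Fin n) (Fin k × Fin n) Tessarine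
  | 0 => 0
  | 1 => M.D1 μ k
  | t + 2 => M.PpredStep μ k (Ppred k (t + 1)) (t + 1)

/-- `Θ_k(t)`, `t ≥ 1` -/
def Theta (k t : ℕ) : Matrix (Fin k × Fin n) (Fin R × (Fin k × Fin n)) Tessarine :=
  M.ThetaOf μ k (M.Ppred μ k t) t

/-- `Ω_k(t)`, `t ≥ 1` -/
def Omega (k t : ℕ) : Matrix (Fin R × (Fin k × Fin n)) (Fin R × (Fin k × Fin n)) Tessarine :=
  M.OmegaOf μ k (M.Ppred μ k t) t

/-- `L_k(t) = Θ_k(t) Ω_k(t)⁻¹`, `t ≥ 1` -/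
def L (k t : ℕ) : Matrix (Fin k × Fin n) (Fin R × (Fin k × Fin n)) Tessarine :=
  M.Theta μ k t * (M.Omega μ k t)⁻¹

/-- `H_k(t)`, `t ≥ 1` -/
def H (k t : ℕ) : Matrix (Fin k × Fin n) (Fin R × (Fin k × Fin n)) Tessarine :=
  M.HOf μ k (M.Ppred μ k t) t

/-- `P_k(t|t)` -/
def Pfilt (k : ℕ) : ℕ → Matrix (Fin k × Fin n) (Fin k × Fin n) Tessarine
  | 0 => M.P0k μ k
  | t + 1 => M.PfiltOf μ k (M.Ppred μ k (t + 1)) (t + 1)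

/-- The innovation `ε_k(t)`, from the value `xp` of `x̂_k(t|t-1)` -/
def innovOf (k : ℕ) (xp : Fin k × Fin n → Tessarine) (ω : Ω) :
    ℕ → Fin R × (Fin k × Fin n) → Tessarine
  | 0 => 0
  | 1 => M.yk k 1 ω
  | t + 2 => M.yk k (t + 2) ω
      - (M.Pik μ k (t + 2) * onesKron R (Fin k × Fin n)) *ᵥ xp
      - (1 - M.Pik μ k (t + 2)) *ᵥ M.yk k (t + 1) ω

/-- `xpred k t` is `x̂_k(t|t-1)`, `t ≥ 1`: it vanishes for `t = 1`, and
`x̂_k(t+1|t) = Φ_k(t) (x̂_k(t|t-1) + L_k(t) ε_k(t)) + H_k(t) ε_k(t)`. -/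
def xpred (k : ℕ) : ℕ → Ω → Fin k × Fin n → Tessarine
  | 0 => 0
  | 1 => 0
  | t + 2 => fun ω =>
      M.Phik k (t + 1) *ᵥ (xpred k (t + 1) ω +
          M.L μ k (t + 1) *ᵥ M.innovOf μ k (xpred k (t + 1) ω) ω (t + 1)) +
        M.H μ k (t + 1) *ᵥ M.innovOf μ k (xpred k (t + 1) ω) ω (t + 1)

/-- The innovation `ε_k(t)`, `t ≥ 1` -/
def innov (k t : ℕ) : Ω → Fin R × (Fin k × Fin n) → Tessarine :=
  fun ω => M.innovOf μ k (M.xpred μ k t ω) ω t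

/-- `xfilt k t` is `x̂_k(t|t)`: it vanishes for `t = 0`, and
`x̂_k(t|t) = x̂_k(t|t-1) + L_k(t) ε_k(t)` for `t ≥ 1`. -/
def xfilt (k : ℕ) : ℕ → Ω → Fin k × Fin n → Tessarine
  | 0 => 0
  | t + 1 => fun ω => M.xpred μ k (t + 1) ω + M.L μ k (t + 1) *ᵥ M.innov μ k (t + 1) ω

/-- The `𝕋_k`-proper filter: the first `n` components of `x̂_k(t|t)`. -/
def xT (k t : ℕ) : Ω → Fin n → Tessarine := fun ω => selFirst k n *ᵥ M.xfilt μ k t ω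

/-- The error pseudo covariance of the `𝕋_k`-proper filter: the leading `n × n` block of
`P_k(t|t)`. -/
def PT (k t : ℕ) : Matrix (Fin n) (Fin n) Tessarine :=
  selFirst k n * M.Pfilt μ k t * (selFirst k n)ᵀ

end DropoutModel

end

/-!
The proof reduces the tessarine problem to a Kalman filter for a linear model with white residuals.

*Dropouts act linearly on augmented vectors.* `Uᴴ`, with `U` the unitary matrix `Υ`, turns a stack
of augmented vectors into the real component vectors (up to a factor), so the componentwise product
with the dropout variables is `U diag(γ) Uᴴ` on the augmented side (`stack_aug_starProd`). The
dropout variables of one time are independent of the σ-algebra generated by all noises and the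
earlier dropout variables (`Standing.indepFun_gam_past`), which makes their moments factor out of
every pseudo correlation with a vector measurable for it (`Standing.pcorr_weights`). This gives the
moment recursions `Standing.Gx_eq`, `Standing.Gxy_eq` and `Standing.Gy_eq`. It also gives the
decomposition `y⃗(t+1) = Π̄^γ C x̄(t+1) + Π̄^{1-γ} y⃗(t) + residual`, in which the residual is
orthogonal to the states up to `t + 1` and the measurements up to `t`, with a covariance that is
computed in `Standing.pcorr_residual_self_succ`. With `y⃗(0) = 0` and `p(1) = 1` it holds for all
`t ≥ 0`, so that the first measurement needs no separate treatment.

*Properness is block diagonality.* The four conjugations form a group, in which the conjugations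
with index below `k` are a subgroup (for `k = 1, 2`). Joint `𝕋_k`-properness of augmented vectors
says that their pseudo correlation vanishes at pairs of conjugations from different cosets
(`IsCosetDiag`). Such matrices are closed under products, and under `𝕋_k`-proper conditions all the
system matrices have this form: for `U diag(p) Uᴴ` this is the symmetry of the probabilities in
`IsProperWeight`. Hence all states and measurements are jointly proper (`ProperConditions.yvec_x`,
`ProperConditions.yvec_yvec`), and the first `k` blocks satisfy a state-space model of their own
(`ProperConditions.xk_succ`, `ProperConditions.yk_succ`).

*Kalman recursion.* For the reduced model, with residual noise correlated with the state noise at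
equal times, `IsOptimalPred.succ` carries optimality of the predictor and the formula for its error
covariance from one time to the next; a linear function of the data whose error is orthogonal to
the data is the least squares estimator by Pythagoras (`isLLMS_of_orthogonal`).

*The full measurements add nothing.* By joint properness, the conjugate blocks left out of `y_k`
are orthogonal to the state and to the blocks that are kept, so the error of the reduced filter is
orthogonal to them as well (`ProperConditions.pcorr_yvec_eq_zero`).
-/

/-! ### Algebra of the tessarine conjugations -/

namespace Tessarine

/-- The group law of the four conjugations: `conj a ∘ conj b = conj (conjMul a b)`. -/
def conjMul (a b : Fin 4) : Fin 4 :=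
  (!![0, 1, 2, 3; 1, 0, 3, 2; 2, 3, 0, 1; 3, 2, 1, 0] : Matrix (Fin 4) (Fin 4) (Fin 4)) a b

/-- Each conjugation is a ring homomorphism. -/
def conjHom (a : Fin 4) : Tessarine →+* Tessarine where
  toFun := conj a
  map_zero' := by fin_cases a <;> ext <;> simp [conj]
  map_one' := by fin_cases a <;> ext <;> simp [conj]
  map_add' x y := by fin_cases a <;> ext <;> simp [conj] <;> ring
  map_mul' x y := by fin_cases a <;> ext <;> simp [conj] <;> ring

theorem conj_zero (a : Fin 4) : conj a 0 = 0 := map_zero (conjHom a)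

theorem conj_add (a : Fin 4) (x y : Tessarine) : conj a (x + y) = conj a x + conj a y :=
  map_add (conjHom a) x y

theorem conj_mul (a : Fin 4) (x y : Tessarine) : conj a (x * y) = conj a x * conj a y :=
  map_mul (conjHom a) x y

theorem conj_sum {ι : Type*} (s : Finset ι) (a : Fin 4) (f : ι → Tessarine) :
    conj a (∑ i ∈ s, f i) = ∑ i ∈ s, conj a (f i) :=
  map_sum (conjHom a) f s

theorem conj_conj (a b : Fin 4) (x : Tessarine) : conj a (conj b x) = conj (conjMul a b) x := by
  fin_cases a <;> fin_cases b <;> ext <;> simp [conj, conjMul]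

theorem star_eq_conj (x : Tessarine) : star x = conj 1 x := rfl

theorem conjMul_self_left (a b : Fin 4) : conjMul a (conjMul a b) = b := by
  revert a b; decide

theorem conjMul_comm (a b : Fin 4) : conjMul a b = conjMul b a := by
  revert a b; decide

theorem conjMul_zero_left (b : Fin 4) : conjMul 0 b = b := by
  revert b; decide

/-- The conjugations with index below `k` form a subgroup (here `k = 1, 2`), so that lying in the
same coset is a transitive relation. -/
theorem conjMul_lt_trans {k : ℕ} (hk : k = 1 ∨ k = 2) {a b c : Fin 4}
    (hab : (conjMul a b).val < k) (hbc : (conjMul b c).val < k) : (conjMul a c).val < k := by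
  rcases hk with rfl | rfl <;> revert a b c <;> decide

theorem ext_comp {x y : Tessarine} (h : ∀ ν, x.comp ν = y.comp ν) : x = y := by
  ext
  exacts [h 0, h 1, h 2, h 3]

theorem comp_zero (ν : Fin 4) : (0 : Tessarine).comp ν = 0 := by fin_cases ν <;> rfl

theorem comp_add (x y : Tessarine) (ν : Fin 4) : (x + y).comp ν = x.comp ν + y.comp ν := by
  fin_cases ν <;> rfl

theorem comp_sub (x y : Tessarine) (ν : Fin 4) : (x - y).comp ν = x.comp ν - y.comp ν := by
  fin_cases ν <;> rfl

theorem comp_starProd (x y : Tessarine) (ν : Fin 4) :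
    (starProd x y).comp ν = x.comp ν * y.comp ν := by
  fin_cases ν <;> rfl

theorem comp_ones (ν : Fin 4) : ones.comp ν = 1 := by fin_cases ν <;> rfl

theorem comp_ofReal_mul (r : ℝ) (x : Tessarine) (ν : Fin 4) :
    (ofReal r * x).comp ν = r * x.comp ν := by
  fin_cases ν <;> simp [comp, ofReal]

theorem ofReal_zero : ofReal 0 = 0 := rfl

theorem ofReal_one : ofReal 1 = 1 := rfl

theorem ofReal_sub (r s : ℝ) : ofReal (r - s) = ofReal r - ofReal s := by
  ext <;> simp [ofReal]

theorem ofReal_mul (r s : ℝ) : ofReal (r * s) = ofReal r * ofReal s := by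
  ext <;> simp [ofReal]

theorem star_ofReal (r : ℝ) : star (ofReal r) = ofReal r := by
  ext <;> simp [ofReal, star, conj]

/-- The real part of `x y^*` is the Euclidean inner product; hence orthogonality of tessarine
random variables implies that of the underlying real vectors. -/
theorem re_mul_star (x y : Tessarine) :
    (x * star y).re = x.re * y.re + x.e1 * y.e1 + x.e2 * y.e2 + x.e3 * y.e3 := by
  simp [star, conj]

/-- The components of a product, as bilinear forms in the components of the factors. -/
theorem exists_comp_mul (ν : Fin 4) : ∃ c : Fin 4 → Fin 4 → ℝ, ∀ x y : Tessarine,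
    (x * y).comp ν = ∑ i, ∑ j, c i j * (x.comp i * y.comp j) := by
  fin_cases ν
  · refine ⟨!![1, 0, 0, 0; 0, -1, 0, 0; 0, 0, 1, 0; 0, 0, 0, -1], fun x y => ?_⟩
    simp [Fin.sum_univ_four, comp]; ring
  · refine ⟨!![0, 1, 0, 0; 1, 0, 0, 0; 0, 0, 0, 1; 0, 0, 1, 0], fun x y => ?_⟩
    simp [Fin.sum_univ_four, comp]
  · refine ⟨!![0, 0, 1, 0; 0, 0, 0, -1; 1, 0, 0, 0; 0, -1, 0, 0], fun x y => ?_⟩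
    simp [Fin.sum_univ_four, comp]; ring
  · refine ⟨!![0, 0, 0, 1; 0, 0, 1, 0; 0, 1, 0, 0; 1, 0, 0, 0], fun x y => ?_⟩
    simp [Fin.sum_univ_four, comp]; ring

/-- Conjugations change components by a sign only. -/
theorem exists_comp_conj (a ν : Fin 4) : ∃ c : ℝ, ∀ x : Tessarine,
    (conj a x).comp ν = c * x.comp ν := by
  fin_cases a <;> fin_cases ν <;>
    first
    | exact ⟨1, fun x => (one_mul _).symm⟩
    | exact ⟨-1, fun x => (neg_one_mul _).symm⟩

end Tessarine

/-! ### Second-order calculus of random tessarine vectors -/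

section SecondOrder

open Tessarine

section Measurability

variable {Ω ι κ : Type*} {m : MeasurableSpace Ω}

/-- A tessarine random vector all of whose components are measurable for the σ-algebra `m`. -/
def TMeasurable {Ω ι : Type*} (m : MeasurableSpace Ω) (X : Ω → ι → Tessarine) : Prop :=
  ∀ i ν, Measurable[m] fun ω => (X ω i).comp ν

theorem TMeasurable.conj {X : Ω → ι → Tessarine} (hX : TMeasurable m X)
    (a : Fin 4) : TMeasurable m (conjVec a X) := fun i ν => by
  obtain ⟨c, hc⟩ := exists_comp_conj a ν
  simp only [conjVec, hc]
  exact (hX i ν).const_mul c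

theorem TMeasurable.aug {X : Ω → ι → Tessarine} (hX : TMeasurable m X) :
    TMeasurable m (aug X) :=
  fun i ν => hX.conj i.1 i.2 ν

theorem TMeasurable.stack {R : ℕ} {X : Fin R → Ω → ι → Tessarine}
    (hX : ∀ i, TMeasurable m (X i)) : TMeasurable m (stack X) :=
  fun i ν => hX i.1 i.2 ν

theorem TMeasurable.add {X Y : Ω → ι → Tessarine}
    (hX : TMeasurable m X) (hY : TMeasurable m Y) : TMeasurable m (X + Y) := fun i ν => by
  simp only [Pi.add_apply, comp_add]
  exact (hX i ν).add (hY i ν)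

theorem TMeasurable.sub {X Y : Ω → ι → Tessarine}
    (hX : TMeasurable m X) (hY : TMeasurable m Y) : TMeasurable m (X - Y) := fun i ν => by
  simp only [Pi.sub_apply, comp_sub]
  exact (hX i ν).sub (hY i ν)

theorem TMeasurable.mulVec [Fintype κ] {X : Ω → κ → Tessarine}
    (hX : TMeasurable m X) (A : Matrix ι κ Tessarine) : TMeasurable m fun ω => A *ᵥ X ω :=
  fun i ν => by
  obtain ⟨d, hd⟩ := exists_comp_mul ν
  simp only [Matrix.mulVec, dotProduct]
  have h : ∀ s : Finset κ, Measurable[m] fun ω => (∑ j ∈ s, A i j * X ω j).comp ν := by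
    classical
    intro s
    induction s using Finset.induction_on with
    | empty => simp [comp_zero]
    | insert j s hj ih =>
      simp only [Finset.sum_insert hj, comp_add, hd]
      refine Measurable.add ?_ ih
      exact Finset.measurable_fun_sum _ fun p _ => Finset.measurable_fun_sum _ fun q _ =>
        ((hX j q).const_mul _).const_mul _
  exact h _

end Measurability

variable {Ω : Type*} [MeasurableSpace Ω] {μ : Measure Ω}
variable {ι κ ι' κ' : Type*}

/-- A tessarine random variable all of whose components are integrable. -/
def TIntegrable (μ : Measure Ω) (X : Ω → Tessarine) : Prop :=
  ∀ ν, Integrable (fun ω => (X ω).comp ν) μ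

/-- A tessarine random vector whose components all have finite second moments. -/
def TMemLp (μ : Measure Ω) (X : Ω → ι → Tessarine) : Prop :=
  ∀ i ν, MemLp (fun ω => (X ω i).comp ν) 2 μ

theorem tExp_comp (X : Ω → Tessarine) (ν : Fin 4) :
    (tExp μ X).comp ν = ∫ ω, (X ω).comp ν ∂μ := by
  fin_cases ν <;> rfl

theorem TIntegrable.add {X Y : Ω → Tessarine} (hX : TIntegrable μ X) (hY : TIntegrable μ Y) :
    TIntegrable μ fun ω => X ω + Y ω := fun ν => by
  simp only [comp_add]
  exact (hX ν).add (hY ν)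

theorem TIntegrable.const_mul {X : Ω → Tessarine} (hX : TIntegrable μ X) (c : Tessarine) :
    TIntegrable μ fun ω => c * X ω := fun ν => by
  obtain ⟨d, hd⟩ := exists_comp_mul ν
  simp only [hd]
  refine integrable_finsetSum _ fun i _ => integrable_finsetSum _ fun j _ => ?_
  exact ((hX j).const_mul _).const_mul _

theorem tExp_add {X Y : Ω → Tessarine} (hX : TIntegrable μ X) (hY : TIntegrable μ Y) :
    tExp μ (fun ω => X ω + Y ω) = tExp μ X + tExp μ Y := by
  refine ext_comp fun ν => ?_
  simp only [comp_add, tExp_comp]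
  exact integral_add (hX ν) (hY ν)

theorem tExp_sub {X Y : Ω → Tessarine} (hX : TIntegrable μ X) (hY : TIntegrable μ Y) :
    tExp μ (fun ω => X ω - Y ω) = tExp μ X - tExp μ Y := by
  refine ext_comp fun ν => ?_
  simp only [comp_sub, tExp_comp]
  exact integral_sub (hX ν) (hY ν)

theorem tExp_const_mul {X : Ω → Tessarine} (hX : TIntegrable μ X) (c : Tessarine) :
    tExp μ (fun ω => c * X ω) = c * tExp μ X := by
  refine ext_comp fun ν => ?_
  obtain ⟨d, hd⟩ := exists_comp_mul ν
  simp only [hd, tExp_comp]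
  rw [integral_finsetSum _ fun i _ => integrable_finsetSum _ fun j _ =>
    ((hX j).const_mul _).const_mul _]
  refine Finset.sum_congr rfl fun i _ => ?_
  rw [integral_finsetSum _ fun j _ => ((hX j).const_mul _).const_mul _]
  exact Finset.sum_congr rfl fun j _ => by rw [integral_const_mul, integral_const_mul]

theorem tExp_zero : tExp μ (fun _ => 0) = 0 :=
  ext_comp fun ν => by simp [tExp_comp, comp_zero]

theorem TIntegrable.sum {X : ι → Ω → Tessarine} {s : Finset ι}
    (hX : ∀ i ∈ s, TIntegrable μ (X i)) : TIntegrable μ fun ω => ∑ i ∈ s, X i ω := by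
  classical
  induction s using Finset.induction_on with
  | empty => intro ν; simp [comp_zero]
  | insert i s hi ih =>
    simp only [Finset.sum_insert hi]
    exact (hX i (Finset.mem_insert_self _ _)).add
      (ih fun j hj => hX j (Finset.mem_insert_of_mem hj))

theorem tExp_sum {X : ι → Ω → Tessarine} {s : Finset ι}
    (hX : ∀ i ∈ s, TIntegrable μ (X i)) :
    tExp μ (fun ω => ∑ i ∈ s, X i ω) = ∑ i ∈ s, tExp μ (X i) := by
  classical
  induction s using Finset.induction_on with
  | empty => simp [tExp_zero]
  | insert i s hi ih =>
    have h2 := fun j hj => hX j (Finset.mem_insert_of_mem hj)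
    simp only [Finset.sum_insert hi]
    rw [tExp_add (hX i (Finset.mem_insert_self _ _)) (TIntegrable.sum h2), ih h2]

theorem tExp_conj (a : Fin 4) (X : Ω → Tessarine) :
    tExp μ (fun ω => conj a (X ω)) = conj a (tExp μ X) := by
  refine ext_comp fun ν => ?_
  obtain ⟨c, hc⟩ := exists_comp_conj a ν
  simp only [hc, tExp_comp]
  exact integral_const_mul _ _

theorem TMemLp.add {X Y : Ω → ι → Tessarine} (hX : TMemLp μ X) (hY : TMemLp μ Y) :
    TMemLp μ (X + Y) := fun i ν => by
  simp only [Pi.add_apply, comp_add]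
  exact (hX i ν).add (hY i ν)

theorem TMemLp.sub {X Y : Ω → ι → Tessarine} (hX : TMemLp μ X) (hY : TMemLp μ Y) :
    TMemLp μ (X - Y) := fun i ν => by
  simp only [Pi.sub_apply, comp_sub]
  exact (hX i ν).sub (hY i ν)

theorem TMemLp.zero : TMemLp μ (0 : Ω → ι → Tessarine) := fun i ν => by
  simp [comp_zero]

theorem TMemLp.sum {X : ι' → Ω → ι → Tessarine} {s : Finset ι'}
    (hX : ∀ i ∈ s, TMemLp μ (X i)) : TMemLp μ (∑ i ∈ s, X i) := by
  classical
  induction s using Finset.induction_on with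
  | empty => simpa using TMemLp.zero
  | insert i s hi ih =>
    rw [Finset.sum_insert hi]
    exact (hX i (Finset.mem_insert_self _ _)).add
      (ih fun j hj => hX j (Finset.mem_insert_of_mem hj))

theorem TMemLp.conj {X : Ω → ι → Tessarine} (hX : TMemLp μ X) (a : Fin 4) :
    TMemLp μ (conjVec a X) := fun i ν => by
  obtain ⟨c, hc⟩ := exists_comp_conj a ν
  simpa only [conjVec, hc] using (hX i ν).const_mul c

theorem TMemLp.aug {X : Ω → ι → Tessarine} (hX : TMemLp μ X) : TMemLp μ (aug X) :=
  fun i ν => hX.conj i.1 i.2 ν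

theorem TMemLp.stack {R : ℕ} {X : Fin R → Ω → ι → Tessarine} (hX : ∀ i, TMemLp μ (X i)) :
    TMemLp μ (stack X) :=
  fun i ν => hX i.1 i.2 ν

theorem TMemLp.mulVec [Fintype κ] {X : Ω → κ → Tessarine} (hX : TMemLp μ X)
    (A : Matrix ι κ Tessarine) : TMemLp μ fun ω => A *ᵥ X ω := fun i ν => by
  obtain ⟨d, hd⟩ := exists_comp_mul ν
  have h : ∀ ω, ((A *ᵥ X ω) i).comp ν =
      ∑ j, ∑ p, ∑ q, d p q * ((A i j).comp p * (X ω j).comp q) := fun ω => by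
    rw [Matrix.mulVec, dotProduct]
    have : ∀ s : Finset κ, (∑ j ∈ s, A i j * X ω j).comp ν = ∑ j ∈ s, (A i j * X ω j).comp ν := by
      classical
      intro s
      induction s using Finset.induction_on with
      | empty => simp [comp_zero]
      | insert j s hj ih => rw [Finset.sum_insert hj, Finset.sum_insert hj, comp_add, ih]
    rw [this]
    exact Finset.sum_congr rfl fun j _ => hd _ _
  simp only [h]
  exact memLp_finsetSum _ fun j _ => memLp_finsetSum _ fun p _ => memLp_finsetSum _ fun q _ =>
    ((hX j q).const_mul _).const_mul _

theorem TMemLp.tIntegrable_mul_star {X : Ω → ι → Tessarine} {Y : Ω → κ → Tessarine}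
    (hX : TMemLp μ X) (hY : TMemLp μ Y) (i : ι) (j : κ) :
    TIntegrable μ fun ω => X ω i * star (Y ω j) := fun ν => by
  obtain ⟨d, hd⟩ := exists_comp_mul ν
  simp only [hd]
  refine integrable_finsetSum _ fun p _ => integrable_finsetSum _ fun q _ => ?_
  exact ((hX i p).integrable_mul (hY.conj 1 j q)).const_mul _

theorem pcorr_conjTranspose (X : Ω → ι → Tessarine) (Y : Ω → κ → Tessarine) :
    (pcorr μ X Y)ᴴ = pcorr μ Y X := by
  ext1 i j
  simp only [Matrix.conjTranspose_apply, pcorr, Matrix.of_apply]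
  rw [star_eq_conj, ← tExp_conj]
  congr 1; ext1 ω
  rw [← star_eq_conj, star_mul, star_star]

theorem pcorr_add_left {X X' : Ω → ι → Tessarine} {Y : Ω → κ → Tessarine}
    (hX : TMemLp μ X) (hX' : TMemLp μ X') (hY : TMemLp μ Y) :
    pcorr μ (X + X') Y = pcorr μ X Y + pcorr μ X' Y := by
  ext1 i j
  simp only [pcorr, Matrix.of_apply, Matrix.add_apply, Pi.add_apply, add_mul]
  exact tExp_add (hX.tIntegrable_mul_star hY i j) (hX'.tIntegrable_mul_star hY i j)

theorem pcorr_sub_left {X X' : Ω → ι → Tessarine} {Y : Ω → κ → Tessarine}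
    (hX : TMemLp μ X) (hX' : TMemLp μ X') (hY : TMemLp μ Y) :
    pcorr μ (X - X') Y = pcorr μ X Y - pcorr μ X' Y := by
  ext1 i j
  simp only [pcorr, Matrix.of_apply, Matrix.sub_apply, Pi.sub_apply, sub_mul]
  exact tExp_sub (hX.tIntegrable_mul_star hY i j) (hX'.tIntegrable_mul_star hY i j)

theorem pcorr_mulVec_left [Fintype ι] {X : Ω → ι → Tessarine} {Y : Ω → κ → Tessarine}
    (hX : TMemLp μ X) (hY : TMemLp μ Y) (A : Matrix ι' ι Tessarine) :
    pcorr μ (fun ω => A *ᵥ X ω) Y = A * pcorr μ X Y := by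
  ext1 i j
  simp only [pcorr, Matrix.of_apply, Matrix.mul_apply, Matrix.mulVec, dotProduct, Finset.sum_mul,
    mul_assoc]
  rw [tExp_sum fun l _ => (hX.tIntegrable_mul_star hY l j).const_mul _]
  exact Finset.sum_congr rfl fun l _ => tExp_const_mul (hX.tIntegrable_mul_star hY l j) _

theorem pcorr_add_right {X : Ω → ι → Tessarine} {Y Y' : Ω → κ → Tessarine}
    (hX : TMemLp μ X) (hY : TMemLp μ Y) (hY' : TMemLp μ Y') :
    pcorr μ X (Y + Y') = pcorr μ X Y + pcorr μ X Y' := by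
  rw [← pcorr_conjTranspose, pcorr_add_left hY hY' hX, Matrix.conjTranspose_add,
    pcorr_conjTranspose, pcorr_conjTranspose]

theorem pcorr_sub_right {X : Ω → ι → Tessarine} {Y Y' : Ω → κ → Tessarine}
    (hX : TMemLp μ X) (hY : TMemLp μ Y) (hY' : TMemLp μ Y') :
    pcorr μ X (Y - Y') = pcorr μ X Y - pcorr μ X Y' := by
  rw [← pcorr_conjTranspose, pcorr_sub_left hY hY' hX, Matrix.conjTranspose_sub,
    pcorr_conjTranspose, pcorr_conjTranspose]

theorem pcorr_mulVec_right [Fintype κ] {X : Ω → ι → Tessarine} {Y : Ω → κ → Tessarine}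
    (hX : TMemLp μ X) (hY : TMemLp μ Y) (A : Matrix κ' κ Tessarine) :
    pcorr μ X (fun ω => A *ᵥ Y ω) = pcorr μ X Y * Aᴴ := by
  rw [← pcorr_conjTranspose, pcorr_mulVec_left hY hX, Matrix.conjTranspose_mul,
    pcorr_conjTranspose]

theorem pcorr_zero_left (Y : Ω → κ → Tessarine) :
    pcorr μ (0 : Ω → ι → Tessarine) Y = 0 := by
  ext1 i j
  simp [pcorr, tExp_zero]

theorem pcorr_zero_right (X : Ω → ι → Tessarine) :
    pcorr μ X (0 : Ω → κ → Tessarine) = 0 := by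
  rw [← pcorr_conjTranspose, pcorr_zero_left, Matrix.conjTranspose_zero]

theorem pcorr_swap_eq_zero {X : Ω → ι → Tessarine} {Y : Ω → κ → Tessarine}
    (h : pcorr μ X Y = 0) : pcorr μ Y X = 0 := by
  rw [← pcorr_conjTranspose, h, Matrix.conjTranspose_zero]

/-- The entries of the pseudo correlation of augmented vectors are, up to a conjugation, the
pseudo correlations with the conjugates of the second vector. -/
theorem pcorr_aug_apply (X : Ω → ι → Tessarine) (Y : Ω → κ → Tessarine) (a : Fin 4 × ι)
    (b : Fin 4 × κ) : pcorr μ (aug X) (aug Y) a b =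
      conj a.1 (pcorr μ X (conjVec (conjMul a.1 b.1) Y) a.2 b.2) := by
  simp only [pcorr, Matrix.of_apply, aug, conjVec]
  rw [← tExp_conj]
  congr 1; ext1 ω
  rw [conj_mul, star_eq_conj, star_eq_conj, conj_conj, conj_conj, conj_conj]
  congr 2
  generalize a.1 = p; generalize b.1 = q
  revert p q; decide

/-- Multiplying square integrable vectors by random real weights independent of them multiplies
the pseudo correlations by the second moments of the weights. -/
theorem pcorr_weights {g : Ω → ι → ℝ} {h : Ω → κ → ℝ} {X : Ω → ι → Tessarine}
    {Y : Ω → κ → Tessarine} (hX : TMemLp μ X) (hY : TMemLp μ Y)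
    (i : ι) (j : κ) (hm : AEStronglyMeasurable (fun ω => g ω i * h ω j) μ)
    (hind : ∀ ν, IndepFun (fun ω => g ω i * h ω j) (fun ω => (X ω i * star (Y ω j)).comp ν) μ) :
    pcorr μ (fun ω i => ofReal (g ω i) * X ω i) (fun ω j => ofReal (h ω j) * Y ω j) i j =
      ofReal (∫ ω, g ω i * h ω j ∂μ) * pcorr μ X Y i j := by
  refine ext_comp fun ν => ?_
  simp only [pcorr, Matrix.of_apply, comp_ofReal_mul, tExp_comp]
  have h1 : ∀ ω, (ofReal (g ω i) * X ω i * star (ofReal (h ω j) * Y ω j)).comp ν =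
      (g ω i * h ω j) * (X ω i * star (Y ω j)).comp ν := fun ω => by
    rw [star_mul, star_ofReal, ← comp_ofReal_mul, ofReal_mul]
    congr 1; ring
  simp only [h1]
  exact (hind ν).integral_fun_mul_eq_mul_integral hm
    (hX.tIntegrable_mul_star hY i j ν).aestronglyMeasurable

/-! ### Linear functions of data and least mean squares -/

section Linear

variable {Ω ι ι' κ : Type*} [Fintype κ]

/-- `Z` is a linear function of `Y 1, …, Y t`. -/
def IsLinearIn (Y : ℕ → Ω → κ → Tessarine) (t : ℕ) (Z : Ω → ι → Tessarine) : Prop :=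
  ∃ A : ℕ → Matrix ι κ Tessarine, ∀ ω, Z ω = ∑ s ∈ Finset.Icc 1 t, A s *ᵥ Y s ω

namespace IsLinearIn

variable {Y : ℕ → Ω → κ → Tessarine} {t : ℕ} {Z Z' : Ω → ι → Tessarine}

theorem zero : IsLinearIn Y t (0 : Ω → ι → Tessarine) :=
  ⟨fun _ => 0, fun ω => by simp⟩

theorem add (h : IsLinearIn Y t Z) (h' : IsLinearIn Y t Z') : IsLinearIn Y t (Z + Z') := by
  obtain ⟨A, hA⟩ := h
  obtain ⟨B, hB⟩ := h'
  refine ⟨fun s => A s + B s, fun ω => ?_⟩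
  simp only [Pi.add_apply, hA, hB, Matrix.add_mulVec, Finset.sum_add_distrib]

theorem sub (h : IsLinearIn Y t Z) (h' : IsLinearIn Y t Z') : IsLinearIn Y t (Z - Z') := by
  obtain ⟨A, hA⟩ := h
  obtain ⟨B, hB⟩ := h'
  refine ⟨fun s => A s - B s, fun ω => ?_⟩
  simp only [Pi.sub_apply, hA, hB, Matrix.sub_mulVec, Finset.sum_sub_distrib]

theorem mulVec [Fintype ι] (h : IsLinearIn Y t Z) (B : Matrix ι' ι Tessarine) :
    IsLinearIn Y t fun ω => B *ᵥ Z ω := by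
  obtain ⟨A, hA⟩ := h
  refine ⟨fun s => B * A s, fun ω => ?_⟩
  simp only [hA, Matrix.mulVec_sum, Matrix.mulVec_mulVec]

theorem of_le {t' : ℕ} (h : IsLinearIn Y t Z) (htt' : t ≤ t') : IsLinearIn Y t' Z := by
  obtain ⟨A, hA⟩ := h
  refine ⟨fun s => if s ≤ t then A s else 0, fun ω => ?_⟩
  rw [hA]
  refine Finset.sum_subset_zero_on_sdiff (Finset.Icc_subset_Icc_right htt') (fun s hs => ?_)
    fun s hs => ?_
  · simp only [Finset.mem_sdiff, Finset.mem_Icc, not_and] at hs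
    simp only [if_neg (hs.2 hs.1.1), Matrix.zero_mulVec]
  · simp only [if_pos (Finset.mem_Icc.1 hs).2]

theorem datum {s : ℕ} (hs : s ∈ Finset.Icc 1 t) : IsLinearIn Y t (Y s) := by
  classical
  refine ⟨fun r => if r = s then 1 else 0, fun ω => ?_⟩
  rw [Finset.sum_eq_single s (fun r _ hr => by simp [hr]) fun h => absurd hs h]
  simp

end IsLinearIn
end Linear

theorem IsLinearIn.tMemLp [Fintype κ] {Y : ℕ → Ω → κ → Tessarine} {t : ℕ} {Z : Ω → ι → Tessarine}
    (h : IsLinearIn Y t Z) (hY : ∀ s, TMemLp μ (Y s)) : TMemLp μ Z := by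
  obtain ⟨A, hA⟩ := h
  have hZ : Z = ∑ s ∈ Finset.Icc 1 t, fun ω => A s *ᵥ Y s ω := by
    ext1 ω; rw [hA, Finset.sum_apply]
  rw [hZ]
  exact TMemLp.sum fun s _ => (hY s).mulVec _

/-- A linear function of the data is uncorrelated with each single component that the data are
uncorrelated with; the entrywise form is needed for the components left out by properness. -/
theorem IsLinearIn.pcorr_apply_eq_zero [Fintype κ] {Y : ℕ → Ω → κ → Tessarine} {t : ℕ}
    {Z : Ω → ι → Tessarine} (h : IsLinearIn Y t Z) (hY : ∀ s, TMemLp μ (Y s))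
    {E : Ω → ι' → Tessarine} (hE : TMemLp μ E) (e : ι')
    (h0 : ∀ s ∈ Finset.Icc 1 t, ∀ j, pcorr μ (Y s) E j e = 0) (i : ι) :
    pcorr μ Z E i e = 0 := by
  obtain ⟨A, hA⟩ := h
  have hZ : Z = ∑ s ∈ Finset.Icc 1 t, fun ω => A s *ᵥ Y s ω := by
    ext1 ω; rw [hA, Finset.sum_apply]
  rw [hZ]
  clear hA hZ
  revert h0
  induction Finset.Icc 1 t using Finset.induction_on with
  | empty => intro _; rw [Finset.sum_empty, pcorr_zero_left]; rfl
  | insert s S hs ih =>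
    intro h0
    rw [Finset.sum_insert hs, pcorr_add_left ((hY s).mulVec _)
      (TMemLp.sum fun s _ => (hY s).mulVec _) hE, Matrix.add_apply,
      ih fun r hr => h0 r (Finset.mem_insert_of_mem hr), pcorr_mulVec_left (hY s) hE,
      Matrix.mul_apply, add_zero]
    exact Finset.sum_eq_zero fun j _ => by rw [h0 s (Finset.mem_insert_self _ _), mul_zero]

theorem IsLinearIn.pcorr_eq_zero [Fintype κ] {Y : ℕ → Ω → κ → Tessarine} {t : ℕ}
    {Z : Ω → ι → Tessarine} (h : IsLinearIn Y t Z) (hY : ∀ s, TMemLp μ (Y s))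
    {E : Ω → ι' → Tessarine} (hE : TMemLp μ E)
    (h0 : ∀ s ∈ Finset.Icc 1 t, pcorr μ E (Y s) = 0) : pcorr μ E Z = 0 := by
  refine pcorr_swap_eq_zero ?_
  ext1 i e
  exact h.pcorr_apply_eq_zero hY hE e (fun s hs j => by rw [pcorr_swap_eq_zero (h0 s hs)]; rfl) i

/-- A linear function of the data with error orthogonal to the data is the least mean squares
estimator, by Pythagoras. -/
theorem isLLMS_of_orthogonal [Fintype κ] {X : Ω → ι → Tessarine} {Y : ℕ → Ω → κ → Tessarine}
    {t : ℕ} {Z : Ω → ι → Tessarine} (hX : TMemLp μ X) (hY : ∀ s, TMemLp μ (Y s))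
    (hZ : IsLinearIn Y t Z) (h0 : ∀ s ∈ Finset.Icc 1 t, pcorr μ (X - Z) (Y s) = 0) :
    IsLLMS μ X Y t Z := by
  refine ⟨hZ, h0, fun B i => ?_⟩
  set W : Ω → ι → Tessarine := fun ω => ∑ s ∈ Finset.Icc 1 t, B s *ᵥ Y s ω with hW
  have hWl : IsLinearIn Y t W := ⟨B, fun _ => rfl⟩
  have hZL := hZ.tMemLp hY
  have hE := hX.sub hZL
  have hD := hZL.sub (hWl.tMemLp hY)
  have horth := (hZ.sub hWl).pcorr_eq_zero hY hE h0
  have hre : ∫ ω, ((X - Z) ω i * star ((Z - W) ω i)).comp 0 ∂μ = 0 := by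
    rw [← tExp_comp]
    exact (congrArg (fun M => (M i i).comp 0) horth).trans (comp_zero 0)
  have hsq : ∀ {V : Ω → ι → Tessarine}, TMemLp μ V → Integrable (fun ω => normSq (V ω i)) μ := by
    intro V hV
    have := hV.tIntegrable_mul_star hV i i 0
    refine this.congr (Filter.Eventually.of_forall fun ω => ?_)
    change (V ω i * star (V ω i)).re = _
    rw [re_mul_star]; simp only [normSq]; ring
  -- the error of a competitor `W` is that of `Z` plus a linear function of the data
  have hexp : ∀ ω, normSq (X ω i - W ω i) = normSq ((X - Z) ω i) +
      2 * ((X - Z) ω i * star ((Z - W) ω i)).comp 0 + normSq ((Z - W) ω i) := fun ω => by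
    change _ = _ + 2 * ((X - Z) ω i * star ((Z - W) ω i)).re + _
    rw [re_mul_star]
    simp only [normSq, Pi.sub_apply, re_sub, e1_sub, e2_sub, e3_sub]
    ring
  change ∫ ω, normSq ((X - Z) ω i) ∂μ ≤ ∫ ω, normSq (X ω i - W ω i) ∂μ
  have hc := (hE.tIntegrable_mul_star hD i i 0).const_mul 2
  simp only [hexp]
  have h1 : ∫ ω, (normSq ((X - Z) ω i) + 2 * ((X - Z) ω i * star ((Z - W) ω i)).comp 0 +
      normSq ((Z - W) ω i)) ∂μ = ∫ ω, normSq ((X - Z) ω i) ∂μ +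
        2 * ∫ ω, ((X - Z) ω i * star ((Z - W) ω i)).comp 0 ∂μ +
          ∫ ω, normSq ((Z - W) ω i) ∂μ := by
    rw [← integral_const_mul, ← integral_add (hsq hE) hc]
    exact integral_add ((hsq hE).add hc) (hsq hD)
  rw [h1, hre]
  have : 0 ≤ ∫ ω, normSq ((Z - W) ω i) ∂μ :=
    integral_nonneg fun ω => by simp only [normSq]; positivity
  linarith

end SecondOrder

/-! ### The unitary matrix relating augmented and real vectors -/

section ConstantMatrices

open Tessarine

namespace Tessarine

/-- The sign which the conjugation `a` gives to the unit `ν`. -/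
def conjSign (a ν : Fin 4) : ℝ :=
  (!![1, 1, 1, 1; 1, -1, 1, -1; 1, 1, -1, -1; 1, -1, -1, 1] : Matrix (Fin 4) (Fin 4) ℝ) a ν

theorem conj_unit (a ν : Fin 4) : conj a (unit ν) = ofReal (conjSign a ν) * unit ν := by
  fin_cases a <;> fin_cases ν <;> ext <;> simp [conj, unit, conjSign, ofReal]

theorem conjSign_mul (a b ν : Fin 4) :
    conjSign a ν * conjSign b ν = conjSign (conjMul a b) ν := by
  fin_cases a <;> fin_cases b <;> fin_cases ν <;> simp [conjSign, conjMul]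

theorem unit_mul_star (ν : Fin 4) : unit ν * star (unit ν) = 1 := by
  fin_cases ν <;> ext <;> simp [unit, star, conj]

theorem conj_unit_mul_star (a b ν : Fin 4) :
    conj a (unit ν) * star (conj b (unit ν)) = ofReal (conjSign (conjMul a b) ν) := by
  rw [conj_unit, conj_unit, star_mul, star_ofReal, ← conjSign_mul, ofReal_mul]
  calc _ = ofReal (conjSign a ν) * ofReal (conjSign b ν) * (unit ν * star (unit ν)) := by ring
    _ = _ := by rw [unit_mul_star, mul_one]

theorem ofReal_half_mul_half : ofReal (1 / 2) * ofReal (1 / 2) = ofReal (1 / 4) := by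
  rw [← ofReal_mul]; norm_num

end Tessarine

theorem matT_apply (n : ℕ) (a b : Fin 4 × Fin n) :
    matT n a b = if a.2 = b.2 then ofReal (1 / 2) * conj a.1 (unit b.1) else 0 := by
  simp [matT, matA, Matrix.kroneckerMap_apply, Matrix.one_apply]

theorem matU_apply (R n : ℕ) (a b : Fin R × (Fin 4 × Fin n)) :
    matU R n a b = if a.1 = b.1 then
      if a.2.2 = b.2.2 then ofReal (1 / 2) * conj a.2.1 (unit b.2.1) else 0 else 0 := by
  simp only [matU, matT_apply, Matrix.kroneckerMap_apply, Matrix.one_apply, ite_mul, one_mul,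
    zero_mul]

/-- A diagonal weighting of the real components, seen on the augmented vectors: the blocks are the
signed means of the weights over the four components. -/
theorem matU_mul_diagonal_mul_apply (R n : ℕ) (d : Fin R × (Fin 4 × Fin n) → Tessarine)
    (a b : Fin R × (Fin 4 × Fin n)) :
    (matU R n * Matrix.diagonal d * (matU R n)ᴴ) a b =
      if a.1 = b.1 ∧ a.2.2 = b.2.2 then ofReal (1 / 4) *
        ∑ ν, ofReal (conjSign (conjMul a.2.1 b.2.1) ν) * d (a.1, (ν, a.2.2)) else 0 := by
  rw [Matrix.mul_apply]
  simp only [Matrix.mul_diagonal, Matrix.conjTranspose_apply, matU_apply]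
  rw [Fintype.sum_prod_type, Finset.sum_eq_single a.1
    (fun i _ hi => Finset.sum_eq_zero fun x _ => by simp [Ne.symm hi]) (by simp),
    Fintype.sum_prod_type]
  split_ifs with h
  · rw [Finset.mul_sum]
    refine Finset.sum_congr rfl fun ν _ => ?_
    rw [Finset.sum_eq_single a.2.2 (fun j _ hj => by simp [Ne.symm hj]) (by simp)]
    simp only [if_true, h.1, h.2, star_mul, star_ofReal]
    rw [← conj_unit_mul_star, ← ofReal_half_mul_half]
    ring
  · refine Finset.sum_eq_zero fun ν _ => Finset.sum_eq_zero fun j _ => ?_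
    by_cases h1 : b.1 = a.1
    · by_cases h2 : a.2.2 = j
      · subst h2
        have h3 : b.2.2 ≠ a.2.2 := fun h3 => h ⟨h1.symm, h3.symm⟩
        simp [h3]
      · simp [h2]
    · simp [h1]

theorem matU_mul_conjTranspose (R n : ℕ) : matU R n * (matU R n)ᴴ = 1 := by
  have h : matU R n * (matU R n)ᴴ =
      matU R n * Matrix.diagonal (fun _ => 1) * (matU R n)ᴴ := by simp
  rw [h]
  ext1 a b
  rw [matU_mul_diagonal_mul_apply]
  obtain ⟨i, a, j⟩ := a
  obtain ⟨i', b, j'⟩ := b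
  have hs : ∀ c, ofReal (1 / 4) * ∑ ν, ofReal (conjSign c ν) * 1 = if c = 0 then 1 else 0 := by
    intro c
    fin_cases c <;> ext <;> simp [Fin.sum_univ_four, conjSign, ofReal]
    norm_num
  have hc : ∀ a b : Fin 4, conjMul a b = 0 ↔ a = b := by decide
  simp only [hs, hc, Matrix.one_apply, Prod.mk.injEq]
  split_ifs
  all_goals first | rfl | (exfalso; tauto)

/-- `U = Υ`. `Uᴴ` maps a stack of augmented vectors to twice the stack of the real component
vectors. -/
theorem conjTranspose_matU_mulVec_stack_aug {Ω : Type*} {R n : ℕ}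
    (X : Fin R → Ω → Fin n → Tessarine) (ω : Ω) (a : Fin R × (Fin 4 × Fin n)) :
    ((matU R n)ᴴ *ᵥ stack (fun i => aug (X i)) ω) a =
      ofReal (2 * (X a.1 ω a.2.2).comp a.2.1) := by
  obtain ⟨i, ν, j⟩ := a
  simp only [Matrix.mulVec, dotProduct, Matrix.conjTranspose_apply, matU_apply, stack, aug]
  rw [Fintype.sum_prod_type, Finset.sum_eq_single i
    (fun i' _ hi => Finset.sum_eq_zero fun x _ => by simp [hi]) (by simp), Fintype.sum_prod_type]
  have h : ∀ a : Fin 4, ∑ j' : Fin n, star (if i = i then if j' = j then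
      ofReal (1 / 2) * conj a (unit ν) else 0 else 0) * conj a (X i ω j') =
        ofReal (1 / 2) * (star (conj a (unit ν)) * conj a (X i ω j)) := fun a => by
    rw [Finset.sum_eq_single j (fun j' _ hj => by simp [hj]) (by simp)]
    simp only [if_true, star_mul, star_ofReal]; ring
  rw [Finset.sum_congr rfl fun a _ => h a]
  clear h
  generalize X i ω j = x
  fin_cases ν <;> ext <;> simp [Fin.sum_univ_four, conj, unit, star, ofReal, comp] <;> ring

/-- Componentwise products act on augmented vectors through the real component vectors. -/
theorem stack_aug_starProd {Ω : Type*} {R n : ℕ} (g X : Fin R → Ω → Fin n → Tessarine) (ω : Ω) :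
    stack (fun i => aug fun ω j => starProd (g i ω j) (X i ω j)) ω =
      matU R n *ᵥ fun a => ofReal ((g a.1 ω a.2.2).comp a.2.1) *
        ((matU R n)ᴴ *ᵥ stack (fun i => aug (X i)) ω) a := by
  have h : (fun a : Fin R × (Fin 4 × Fin n) => ofReal ((g a.1 ω a.2.2).comp a.2.1) *
        ((matU R n)ᴴ *ᵥ stack (fun i => aug (X i)) ω) a) =
      (matU R n)ᴴ *ᵥ stack (fun i => aug fun ω j => starProd (g i ω j) (X i ω j)) ω := by
    ext1 a
    rw [conjTranspose_matU_mulVec_stack_aug, conjTranspose_matU_mulVec_stack_aug, ← ofReal_mul,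
      comp_starProd]
    congr 1; ring
  rw [h, Matrix.mulVec_mulVec, matU_mul_conjTranspose, Matrix.one_mulVec]

/-! ### Matrices that are block diagonal with respect to the conjugations below `k` -/

/-- The matrix `M`, whose rows and columns carry conjugation indices `f` and `g`, has zero entries
wherever the two indices lie in different cosets of the group of conjugations below `k`. For pseudo
correlations of augmented vectors this is (cross) `𝕋_k`-properness. -/
def IsCosetDiag {ι κ : Type*} (k : ℕ) (f : ι → Fin 4) (g : κ → Fin 4)
    (M : Matrix ι κ Tessarine) : Prop :=
  ∀ i j, k ≤ (conjMul (f i) (g j)).val → M i j = 0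

namespace IsCosetDiag

variable {ι κ κ' : Type*} {k : ℕ} {f : ι → Fin 4} {g : κ → Fin 4} {h : κ' → Fin 4}
  {M N : Matrix ι κ Tessarine}

theorem zero : IsCosetDiag k f g 0 := fun _ _ _ => rfl

theorem add (hM : IsCosetDiag k f g M) (hN : IsCosetDiag k f g N) :
    IsCosetDiag k f g (M + N) := fun i j hij => by
  rw [Matrix.add_apply, hM i j hij, hN i j hij, add_zero]

theorem sub (hM : IsCosetDiag k f g M) (hN : IsCosetDiag k f g N) :
    IsCosetDiag k f g (M - N) := fun i j hij => by
  rw [Matrix.sub_apply, hM i j hij, hN i j hij, sub_zero]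

theorem conjTranspose (hM : IsCosetDiag k f g M) : IsCosetDiag k g f Mᴴ := fun i j hij => by
  rw [Matrix.conjTranspose_apply, hM j i (by rwa [conjMul_comm]), star_zero]

theorem mul [Fintype κ] {P : Matrix κ κ' Tessarine} (hk : k = 1 ∨ k = 2)
    (hM : IsCosetDiag k f g M) (hP : IsCosetDiag k g h P) : IsCosetDiag k f h (M * P) := by
  intro i j hij
  rw [Matrix.mul_apply]
  refine Finset.sum_eq_zero fun l _ => ?_
  by_cases hil : k ≤ (conjMul (f i) (g l)).val
  · rw [hM i l hil, zero_mul]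
  · rw [hP l j, mul_zero]
    by_contra hlj
    exact absurd (conjMul_lt_trans hk (not_le.1 hil) (not_le.1 hlj)) (not_lt.2 hij)

theorem one [DecidableEq ι] (hk : k = 1 ∨ k = 2) :
    IsCosetDiag k f f (1 : Matrix ι ι Tessarine) := by
  intro i j hij
  refine Matrix.one_apply_ne fun h => ?_
  have : ∀ c, conjMul c c = 0 := by decide
  subst h
  rw [this] at hij
  rcases hk with rfl | rfl <;> simp at hij

end IsCosetDiag

/-- The conjugation index of a component of a stacked augmented vector. -/
def stackIdx {R n : ℕ} (a : Fin R × (Fin 4 × Fin n)) : Fin 4 := a.2.1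

theorem isCosetDiag_onesKron {R n k : ℕ} (hk : k = 1 ∨ k = 2) :
    IsCosetDiag k stackIdx Prod.fst (onesKron R (Fin 4 × Fin n)) := fun i j hij =>
  (IsCosetDiag.one (f := Prod.fst) hk) i.2 j hij

theorem isCosetDiag_onesKron_transpose {R n k : ℕ} (hk : k = 1 ∨ k = 2) :
    IsCosetDiag k Prod.fst stackIdx (onesKron R (Fin 4 × Fin n))ᵀ := fun i j hij =>
  isCosetDiag_onesKron hk j i (by rwa [conjMul_comm])

theorem onesKron_conjTranspose (R : ℕ) (ι : Type*) [DecidableEq ι] :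
    (onesKron R ι)ᴴ = (onesKron R ι)ᵀ := by
  ext1 a b
  simp only [Matrix.conjTranspose_apply, Matrix.transpose_apply, onesKron, Matrix.of_apply]
  split_ifs <;> simp

/-- Weights on the four real components having the symmetry of `𝕋_k`-properness. -/
def IsProperWeight {R n : ℕ} (k : ℕ) (d : Fin R × (Fin 4 × Fin n) → Tessarine) : Prop :=
  (k = 1 → ∀ i ν j, d (i, (ν, j)) = d (i, (0, j))) ∧
    (k = 2 → ∀ i j, d (i, (0, j)) = d (i, (2, j)) ∧ d (i, (1, j)) = d (i, (3, j)))

theorem IsProperWeight.mul {R n k : ℕ} {d e : Fin R × (Fin 4 × Fin n) → Tessarine}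
    (hd : IsProperWeight k d) (he : IsProperWeight k e) :
    IsProperWeight k fun a => d a * e a :=
  ⟨fun hk i ν j => by simp only [hd.1 hk i ν j, he.1 hk i ν j],
    fun hk i j => by
      simp only [(hd.2 hk i j).1, (hd.2 hk i j).2, (he.2 hk i j).1, (he.2 hk i j).2, and_self]⟩

theorem IsProperWeight.isCosetDiag {R n k : ℕ} (hk : k = 1 ∨ k = 2)
    {d : Fin R × (Fin 4 × Fin n) → Tessarine} (hd : IsProperWeight k d) :
    IsCosetDiag k stackIdx stackIdx (matU R n * Matrix.diagonal d * (matU R n)ᴴ) := by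
  intro a b hab
  rw [matU_mul_diagonal_mul_apply]
  split_ifs
  · change k ≤ (conjMul a.2.1 b.2.1).val at hab
    generalize conjMul a.2.1 b.2.1 = c at hab
    suffices h : ∑ ν, ofReal (conjSign c ν) * d (a.1, (ν, a.2.2)) = 0 by rw [h, mul_zero]
    rcases hk with rfl | rfl
    · simp only [hd.1 rfl _ _ a.2.2]
      fin_cases c <;> simp at hab <;> ext <;> simp [Fin.sum_univ_four, conjSign, ofReal]
    · simp only [Fin.sum_univ_four, (hd.2 rfl a.1 a.2.2).1, (hd.2 rfl a.1 a.2.2).2]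
      fin_cases c <;> simp at hab <;> ext <;> simp [conjSign, ofReal]
  · rfl

/-- The second moments of the real components of a `𝕋_k`-proper vector are proper weights. -/
theorem IsCosetDiag.isProperWeight {R n k : ℕ}
    {M : Matrix (Fin R × (Fin 4 × Fin n)) (Fin R × (Fin 4 × Fin n)) Tessarine}
    (hM : IsCosetDiag k stackIdx stackIdx M) :
    IsProperWeight k fun a => ((matU R n)ᴴ * M * matU R n) a a := by
  have key : ∀ i ν j, ((matU R n)ᴴ * M * matU R n) (i, (ν, j)) (i, (ν, j)) =
      ∑ b, ∑ a, ofReal (1 / 4) * ofReal (conjSign (conjMul a b) ν) *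
        M (i, (a, j)) (i, (b, j)) := by
    intro i ν j
    simp only [Matrix.mul_apply, Matrix.conjTranspose_apply, matU_apply]
    rw [Fintype.sum_prod_type, Finset.sum_eq_single i
      (fun i' _ hi => Finset.sum_eq_zero fun x _ => by simp [hi]) (by simp),
      Fintype.sum_prod_type]
    refine Finset.sum_congr rfl fun b _ => ?_
    rw [Finset.sum_eq_single j (fun j' _ hj => by simp [hj]) (by simp)]
    rw [Fintype.sum_prod_type, Finset.sum_eq_single i
      (fun i' _ hi => Finset.sum_eq_zero fun x _ => by simp [hi]) (by simp),
      Fintype.sum_prod_type, Finset.sum_mul]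
    refine Finset.sum_congr rfl fun a _ => ?_
    rw [Finset.sum_eq_single j (fun j' _ hj => by simp [hj]) (by simp)]
    simp only [if_true, star_mul, star_ofReal]
    rw [conjMul_comm, ← conj_unit_mul_star, ← ofReal_half_mul_half]
    ring
  have hz : ∀ i j a b, k ≤ (conjMul a b).val → M (i, (a, j)) (i, (b, j)) = 0 :=
    fun i j a b h => hM _ _ h
  refine ⟨fun hk i ν j => ?_, fun hk i j => ?_⟩ <;> subst hk <;> simp only [key]
  · refine Finset.sum_congr rfl fun b _ => Finset.sum_congr rfl fun a _ => ?_
    by_cases h : 1 ≤ (conjMul a b).val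
    · rw [hz i j a b h, mul_zero, mul_zero]
    · generalize conjMul a b = c at h
      fin_cases c <;> simp at h
      fin_cases ν <;> simp [conjSign]
  · constructor <;>
    · refine Finset.sum_congr rfl fun b _ => Finset.sum_congr rfl fun a _ => ?_
      by_cases h : 2 ≤ (conjMul a b).val
      · rw [hz i j a b h, mul_zero, mul_zero]
      · generalize conjMul a b = c at h
        fin_cases c <;> simp at h <;> simp [conjSign]

/-! ### Selection of the first `k` blocks -/

/-- Position of the component `a` of `x_k` in the augmented vector. -/
def embK (k n : ℕ) (a : Fin k × Fin n) : Fin 4 × Fin n := (blk a.1, a.2)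

/-- Position of the component `a` of `y_k` in the stack of augmented vectors. -/
def embR (R k n : ℕ) (a : Fin R × (Fin k × Fin n)) : Fin R × (Fin 4 × Fin n) :=
  (a.1, embK k n a.2)

/-- The matrix `I_R ⊗ [I, 0]` selecting `y_k` from the full augmented measurements. -/
def selR (R k n : ℕ) : Matrix (Fin R × (Fin k × Fin n)) (Fin R × (Fin 4 × Fin n)) Tessarine :=
  (1 : Matrix (Fin R × (Fin 4 × Fin n)) (Fin R × (Fin 4 × Fin n)) Tessarine).submatrix
    (embR R k n) id

theorem blk_injective {k : ℕ} (hk : k = 1 ∨ k = 2) : Function.Injective (blk (k := k)) := by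
  rcases hk with rfl | rfl <;> decide

theorem blk_val {k : ℕ} (hk : k = 1 ∨ k = 2) (a : Fin k) : (blk a).val = a.val := by
  rcases hk with rfl | rfl <;> revert a <;> decide

theorem exists_blk {k : ℕ} (hk : k = 1 ∨ k = 2) (b : Fin 4) (hb : b.val < k) :
    ∃ a : Fin k, blk a = b :=
  ⟨⟨b.val, hb⟩, Fin.ext (blk_val hk _)⟩

theorem embK_injective {k : ℕ} (hk : k = 1 ∨ k = 2) (n : ℕ) :
    Function.Injective (embK k n) := by
  rintro ⟨a, i⟩ ⟨b, j⟩ h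
  simp only [embK, Prod.mk.injEq] at h
  rw [blk_injective hk h.1, h.2]

theorem embR_injective {k : ℕ} (hk : k = 1 ∨ k = 2) (R n : ℕ) :
    Function.Injective (embR R k n) := by
  rintro ⟨a, i⟩ ⟨b, j⟩ h
  simp only [embR, Prod.mk.injEq] at h
  rw [embK_injective hk n h.2, h.1]

theorem selK_eq (k n : ℕ) : selK k n =
    (1 : Matrix (Fin 4 × Fin n) (Fin 4 × Fin n) Tessarine).submatrix (embK k n) id := by
  ext1 a b
  simp [selK, embK, Matrix.one_apply, Prod.ext_iff]

theorem submatrix_one_mul {α ι κ : Type*} [Fintype ι] [DecidableEq ι] (e : α → ι)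
    (M : Matrix ι κ Tessarine) :
    (1 : Matrix ι ι Tessarine).submatrix e id * M = M.submatrix e id := by
  ext1 a b
  simp [Matrix.mul_apply, Matrix.one_apply]

theorem mul_submatrix_one_transpose {α ι κ : Type*} [Fintype ι] [DecidableEq ι] (e : α → ι)
    (M : Matrix κ ι Tessarine) :
    M * ((1 : Matrix ι ι Tessarine).submatrix e id)ᵀ = M.submatrix id e := by
  ext1 a b
  simp [Matrix.mul_apply, Matrix.one_apply]

theorem submatrix_one_conjTranspose {α ι : Type*} [DecidableEq ι] (e : α → ι) :
    ((1 : Matrix ι ι Tessarine).submatrix e id)ᴴ =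
      ((1 : Matrix ι ι Tessarine).submatrix e id)ᵀ := by
  ext1 a b
  simp only [Matrix.conjTranspose_apply, Matrix.transpose_apply, Matrix.submatrix_apply,
    Matrix.one_apply]
  split_ifs <;> simp

/-- The first `k` block rows of a coset diagonal matrix vanish outside the first `k` block columns.
-/
theorem IsCosetDiag.submatrix_eq {α β ι κ : Type*} [Fintype β] [DecidableEq κ] {k : ℕ}
    (hk : k = 1 ∨ k = 2) {f : ι → Fin 4} {g : κ → Fin 4} {M : Matrix ι κ Tessarine}
    (hM : IsCosetDiag k f g M) {e : α → ι} {e' : β → κ} (he' : Function.Injective e')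
    (hf : ∀ a, (f (e a)).val < k) (hg : ∀ x, (g x).val < k → ∃ b, e' b = x) :
    M.submatrix e id =
      M.submatrix e e' * (1 : Matrix κ κ Tessarine).submatrix e' id := by
  ext1 a y
  simp only [Matrix.mul_apply, Matrix.submatrix_apply, id, Matrix.one_apply, mul_ite, mul_one,
    mul_zero]
  by_cases hy : (g y).val < k
  · obtain ⟨b, rfl⟩ := hg y hy
    rw [Finset.sum_eq_single b (fun c _ hc => if_neg fun h => hc (he' h)) (by simp), if_pos rfl]
  · have hy' : k ≤ (conjMul (f (e a)) (g y)).val := not_lt.1 fun h => hy (by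
      have h0 : (conjMul 0 (f (e a))).val < k := by rw [conjMul_zero_left]; exact hf a
      simpa only [conjMul_zero_left] using conjMul_lt_trans hk h0 h)
    rw [hM (e a) y hy', Finset.sum_eq_zero fun b _ => ?_]
    split_ifs with hb
    · subst hb
      exact hM _ _ hy'
    · rfl

end ConstantMatrices

/-! ### Dynamics of the augmented vectors -/

namespace DropoutModel

open Tessarine

section Dynamics

variable {n R : ℕ} {Ω : Type*} (M : DropoutModel n R Ω)

/-- The real components of the dropout variables of all sensors at time `t`. -/
def gam (t : ℕ) (ω : Ω) (a : Fin R × (Fin 4 × Fin n)) : ℝ := (M.γ a.1 t ω a.2.2).comp a.2.1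

/-- The stacked augmented measurement noise. -/
def vvec (t : ℕ) : Ω → Fin R × (Fin 4 × Fin n) → Tessarine := stack fun i => aug (M.v i t)

/-- The stacked augmented vector of the outputs `z`. -/
def zvec (t : ℕ) : Ω → Fin R × (Fin 4 × Fin n) → Tessarine := stack fun i => aug (M.z i t)

theorem onesKron_mulVec {R : ℕ} {ι : Type*} [Fintype ι] [DecidableEq ι] (w : ι → Tessarine)
    (a : Fin R × ι) : (onesKron R ι *ᵥ w) a = w a.2 := by
  simp [Matrix.mulVec, dotProduct, onesKron]

theorem zvec_eq (t : ℕ) : M.zvec t =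
    (fun ω => onesKron R (Fin 4 × Fin n) *ᵥ aug (M.x t) ω) + M.vvec t := by
  ext1 ω; ext1 a
  simp only [Pi.add_apply, onesKron_mulVec, zvec, vvec, stack, aug, z, conj_add]

theorem aug_x_succ (t : ℕ) : aug (M.x (t + 1)) =
    (fun ω => M.Phibar t *ᵥ aug (M.x t) ω) + aug (M.u t) := by
  ext1 ω; ext1 a
  obtain ⟨a, j⟩ := a
  simp only [aug, x, Pi.add_apply, conj_add]
  congr 1
  have h : (M.Phibar t *ᵥ aug (M.x t) ω) (a, j) =
      ∑ b, ∑ l, conj a (M.F (conjMul a b) t j l) * conj b (M.x t ω l) := by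
    rw [Matrix.mulVec, dotProduct, Fintype.sum_prod_type]; rfl
  have h2 : ∀ c, conj a ((M.F c t *ᵥ fun l => conj c (M.x t ω l)) j) =
      ∑ l, conj a (M.F c t j l) * conj (conjMul a c) (M.x t ω l) := fun c => by
    simp only [Matrix.mulVec, dotProduct, conj_sum, conj_mul, conj_conj]
  -- the block row `a` of `Φ̄` is a permutation of the coefficients, by the group law
  have h3 : ∑ b, ∑ l, conj a (M.F (conjMul a b) t j l) * conj b (M.x t ω l) =
      ∑ c, ∑ l, conj a (M.F c t j l) * conj (conjMul a c) (M.x t ω l) :=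
    Finset.sum_bij' (fun b _ => conjMul a b) (fun c _ => conjMul a c) (by simp) (by simp)
      (by simp [conjMul_self_left]) (by simp [conjMul_self_left])
      (by simp [conjMul_self_left])
  rw [h, h3, Fin.sum_univ_four, ← h2, ← h2, ← h2, ← h2]
  rfl

theorem yvec_zero : M.yvec 0 = 0 := by
  ext1 ω; ext1 a
  exact conj_zero _

theorem yvec_one : M.yvec 1 = M.zvec 1 := rfl

/-- The augmented vector obtained from `X` by weighting its real components with the functions `φ`
of the dropout variables. -/
noncomputable def weighted (t : ℕ) (φ : Fin R × (Fin 4 × Fin n) → ℝ → ℝ)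
    (X : Ω → Fin R × (Fin 4 × Fin n) → Tessarine) :
    Ω → Fin R × (Fin 4 × Fin n) → Tessarine :=
  fun ω => matU R n *ᵥ fun a => ofReal (φ a (M.gam t ω a)) * ((matU R n)ᴴ *ᵥ X ω) a

theorem yvec_add_two (t : ℕ) : M.yvec (t + 2) =
    M.weighted (t + 2) (fun _ r => r) (M.zvec (t + 2)) +
      M.weighted (t + 2) (fun _ r => 1 - r) (M.yvec (t + 1)) := by
  ext1 ω
  have h1 := stack_aug_starProd (M.γ · (t + 2)) (M.z · (t + 2)) ω
  have h2 := stack_aug_starProd (fun i ω j => ones - M.γ i (t + 2) ω j) (M.y · (t + 1)) ω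
  simp only [comp_sub, comp_ones] at h2
  rw [Pi.add_apply]
  refine Eq.trans ?_ (congrArg₂ (· + ·) h1 h2)
  ext1 a
  exact conj_add _ _ _

end Dynamics

section Measurability

variable {n R : ℕ} {Ω : Type*} (M : DropoutModel n R Ω) {m : MeasurableSpace Ω}

theorem tMeasurable_x (h0 : TMeasurable m M.x₀) (hu : ∀ t, TMeasurable m (M.u t)) (t : ℕ) :
    TMeasurable m (M.x t) := by
  induction t with
  | zero => exact h0
  | succ t ih =>
    exact ((((ih.mulVec _).add ((ih.conj 1).mulVec _)).add ((ih.conj 2).mulVec _)).add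
      ((ih.conj 3).mulVec _)).add (hu t)

theorem tMeasurable_y (h0 : TMeasurable m M.x₀) (hu : ∀ t, TMeasurable m (M.u t))
    (hv : ∀ i t, 1 ≤ t → TMeasurable m (M.v i t)) (T : ℕ)
    (hγ : ∀ i t, 2 ≤ t → t < T → TMeasurable m (M.γ i t)) (i : Fin R) (t : ℕ) (ht : t < T) :
    TMeasurable m (M.y i t) := by
  have hz : ∀ t, 1 ≤ t → TMeasurable m (M.z i t) := fun t ht =>
    (M.tMeasurable_x h0 hu t).add (hv i t ht)
  induction t using Nat.twoStepInduction with
  | zero => intro j ν; simp only [y, Pi.zero_apply, comp_zero]; exact measurable_const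
  | one => exact hz 1 le_rfl
  | more t _ ih =>
    intro j ν
    have hg := hγ i (t + 2) (by omega) ht j ν
    simp only [y, comp_add, comp_starProd, comp_sub, comp_ones]
    exact (hg.mul (hz _ (by omega) j ν)).add
      ((measurable_const.sub hg).mul (ih (by omega) j ν))

end Measurability

/-! ### Independence of the dropout variables from the past -/

section Past

variable {n R : ℕ} {Ω : Type*} (M : DropoutModel n R Ω)

/-- The initial state and the noises, as one random element. -/
def noise (ω : Ω) :
    (Fin n × Fin 4 → ℝ) × (ℕ × Fin n × Fin 4 → ℝ) × (Fin R × ℕ × Fin n × Fin 4 → ℝ) :=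
  (fun a => (M.x₀ ω a.1).comp a.2, fun a => (M.u a.1 ω a.2.1).comp a.2.2,
    fun a => (M.v a.1 (a.2.1 + 1) ω a.2.2.1).comp a.2.2.2)

/-- The component `a` of the dropout process, with time counted from `2`. -/
def gamIdx (a : Fin R × ℕ × Fin n × Fin 4) (ω : Ω) : ℝ :=
  (M.γ a.1 (a.2.1 + 2) ω a.2.2.1).comp a.2.2.2

/-- The indices of the dropout variables at the times in `S`, counted from `2`. -/
def idxAt (n R : ℕ) (S : Finset ℕ) : Finset (Fin R × ℕ × Fin n × Fin 4) :=
  Finset.univ ×ˢ (S ×ˢ (Finset.univ ×ˢ Finset.univ))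

/-- The dropout variables before time `t` together with all noises. -/
def past (t : ℕ) (ω : Ω) : (idxAt n R (Finset.range (t - 2)) → ℝ) ×
    ((Fin n × Fin 4 → ℝ) × (ℕ × Fin n × Fin 4 → ℝ) × (Fin R × ℕ × Fin n × Fin 4 → ℝ)) :=
  (fun a => M.gamIdx a ω, M.noise ω)

/-- The σ-algebra of the dropout variables before time `t` and all noises. -/
abbrev pastAlg (t : ℕ) : MeasurableSpace Ω := MeasurableSpace.comap (M.past t) inferInstance

theorem measurable_past (t : ℕ) : Measurable[M.pastAlg t] (M.past t) :=
  comap_measurable _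

theorem tMeasurable_pastAlg_x₀ (t : ℕ) : TMeasurable (M.pastAlg t) M.x₀ := fun j ν =>
  (measurable_pi_apply (j, ν)).comp
    (measurable_fst.comp (measurable_snd.comp (M.measurable_past t)))

theorem tMeasurable_pastAlg_u (t s : ℕ) : TMeasurable (M.pastAlg t) (M.u s) := fun j ν =>
  (measurable_pi_apply (s, j, ν)).comp
    (measurable_fst.comp (measurable_snd.comp (measurable_snd.comp (M.measurable_past t))))

theorem tMeasurable_pastAlg_v (t : ℕ) (i : Fin R) (s : ℕ) (hs : 1 ≤ s) :
    TMeasurable (M.pastAlg t) (M.v i s) := fun j ν => by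
  obtain ⟨s, rfl⟩ := Nat.exists_eq_add_of_le' hs
  exact (measurable_pi_apply (i, s, j, ν)).comp
    (measurable_snd.comp (measurable_snd.comp (measurable_snd.comp (M.measurable_past t))))

theorem tMeasurable_pastAlg_γ (t : ℕ) (i : Fin R) (s : ℕ) (hs : 2 ≤ s) (hst : s < t) :
    TMeasurable (M.pastAlg t) (M.γ i s) := fun j ν => by
  obtain ⟨s, rfl⟩ := Nat.exists_eq_add_of_le' hs
  have hmem : (i, s, j, ν) ∈ idxAt n R (Finset.range (t - 2)) := by
    simp [idxAt]; omega
  exact (measurable_pi_apply (⟨(i, s, j, ν), hmem⟩ : idxAt n R (Finset.range (t - 2)))).comp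
    (measurable_fst.comp (M.measurable_past t))

theorem tMeasurable_pastAlg_x (t s : ℕ) : TMeasurable (M.pastAlg t) (M.x s) :=
  M.tMeasurable_x (M.tMeasurable_pastAlg_x₀ t) (M.tMeasurable_pastAlg_u t) s

theorem tMeasurable_pastAlg_y (t s : ℕ) (hs : s < t) (i : Fin R) :
    TMeasurable (M.pastAlg t) (M.y i s) :=
  M.tMeasurable_y (M.tMeasurable_pastAlg_x₀ t) (M.tMeasurable_pastAlg_u t)
    (M.tMeasurable_pastAlg_v t) t (M.tMeasurable_pastAlg_γ t) i s hs

end Past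

/-- If `A` and `B` are independent and `(A, B)` is independent of `N`, then `A` is independent of
`(B, N)`. -/
theorem indepFun_prodMk_right {Ω α β γ : Type*} [MeasurableSpace Ω] [MeasurableSpace α]
    [MeasurableSpace β] [MeasurableSpace γ] {μ : Measure Ω} [IsProbabilityMeasure μ]
    {A : Ω → α} {B : Ω → β} {N : Ω → γ} (hA : Measurable A) (hB : Measurable B)
    (hN : Measurable N) (h1 : IndepFun A B μ) (h2 : IndepFun (fun ω => (A ω, B ω)) N μ) :
    IndepFun A (fun ω => (B ω, N ω)) μ := by
  have h3 : IndepFun B N μ := h2.comp measurable_snd measurable_id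
  have := Measure.isProbabilityMeasure_map (μ := μ) hA.aemeasurable
  have := Measure.isProbabilityMeasure_map (μ := μ) hB.aemeasurable
  have := Measure.isProbabilityMeasure_map (μ := μ) hN.aemeasurable
  rw [indepFun_iff_map_prod_eq_prod_map_map hA.aemeasurable hB.aemeasurable] at h1
  rw [indepFun_iff_map_prod_eq_prod_map_map (hA.prodMk hB).aemeasurable hN.aemeasurable, h1] at h2
  rw [indepFun_iff_map_prod_eq_prod_map_map hB.aemeasurable hN.aemeasurable] at h3
  rw [indepFun_iff_map_prod_eq_prod_map_map hA.aemeasurable (hB.prodMk hN).aemeasurable, h3,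
    ← Measure.prodAssoc_prod, ← h2,
    Measure.map_map MeasurableEquiv.prodAssoc.measurable ((hA.prodMk hB).prodMk hN)]
  rfl

section Standing

variable {n R : ℕ} {Ω : Type*} [MeasurableSpace Ω] {μ : Measure Ω} {M : DropoutModel n R Ω}

theorem Standing.measurable_gamIdx (hM : M.Standing μ) (a : Fin R × ℕ × Fin n × Fin 4) :
    Measurable (M.gamIdx a) :=
  hM.meas_γ _ _ _ _ (by omega)

theorem Standing.measurable_noise (hM : M.Standing μ) : Measurable M.noise :=
  (measurable_pi_lambda _ fun a => hM.meas_x₀ _ _).prodMk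
    ((measurable_pi_lambda _ fun a => hM.meas_u _ _ _).prodMk
      (measurable_pi_lambda _ fun a => hM.meas_v _ _ _ _ (by omega)))

theorem Standing.measurable_gam (hM : M.Standing μ) (t : ℕ) : Measurable (M.gam (t + 2)) :=
  measurable_pi_lambda _ fun a => hM.meas_γ _ _ _ _ (by omega)

/-- The dropout variables at time `t + 2` are independent of the earlier ones and the noises
jointly. -/
theorem Standing.indepFun_gam_past [IsProbabilityMeasure μ] (hM : M.Standing μ) (t : ℕ) :
    IndepFun (M.gam (t + 2)) (M.past (t + 2)) μ := by
  have hd : Disjoint (idxAt n R {t}) (idxAt n R (Finset.range (t + 2 - 2))) := by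
    rw [Finset.disjoint_left]
    simp only [idxAt, Finset.mem_product, Finset.mem_univ, Finset.mem_singleton,
      Finset.mem_range, true_and, and_true]
    omega
  have h1 := hM.indep_γ.indepFun_finset _ _ hd hM.measurable_gamIdx
  have hA : Measurable fun ω (a : idxAt n R {t}) => M.gamIdx a ω :=
    measurable_pi_lambda _ fun a => hM.measurable_gamIdx _
  have hB : Measurable fun ω (a : idxAt n R (Finset.range (t + 2 - 2))) => M.gamIdx a ω :=
    measurable_pi_lambda _ fun a => hM.measurable_gamIdx _
  have h2 := hM.indep_γ_noise.comp
    (φ := fun f => ((fun a : idxAt n R {t} => f a,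
      fun a : idxAt n R (Finset.range (t + 2 - 2)) => f a) :
        (idxAt n R {t} → ℝ) × (idxAt n R (Finset.range (t + 2 - 2)) → ℝ))) (ψ := id)
    (by fun_prop) measurable_id
  have h3 := indepFun_prodMk_right hA hB hM.measurable_noise h1 h2
  refine h3.comp (φ := fun f (a : Fin R × (Fin 4 × Fin n)) =>
    f ⟨(a.1, t, a.2.2, a.2.1), by simp [idxAt]⟩) (ψ := id) ?_ measurable_id
  exact measurable_pi_lambda _ fun a => measurable_pi_apply _

/-- A square integrable vector that depends only on the noises and on the dropout variables before
time `t`. -/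
structure IsPast (M : DropoutModel n R Ω) (μ : Measure Ω) (t : ℕ) {ι : Type*}
    (W : Ω → ι → Tessarine) : Prop where
  meas : TMeasurable (M.pastAlg t) W
  memLp : TMemLp μ W

theorem IsPast.add {t : ℕ} {ι : Type*} {W W' : Ω → ι → Tessarine} (h : M.IsPast μ t W)
    (h' : M.IsPast μ t W') : M.IsPast μ t (W + W') :=
  ⟨h.meas.add h'.meas, h.memLp.add h'.memLp⟩

theorem IsPast.sub {t : ℕ} {ι : Type*} {W W' : Ω → ι → Tessarine} (h : M.IsPast μ t W)
    (h' : M.IsPast μ t W') : M.IsPast μ t (W - W') :=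
  ⟨h.meas.sub h'.meas, h.memLp.sub h'.memLp⟩

theorem IsPast.mulVec {t : ℕ} {ι κ : Type*} [Fintype κ] {W : Ω → κ → Tessarine}
    (h : M.IsPast μ t W) (A : Matrix ι κ Tessarine) : M.IsPast μ t fun ω => A *ᵥ W ω :=
  ⟨h.meas.mulVec A, h.memLp.mulVec A⟩

/-- Random weights that are functions of the dropout variables at time `t + 2` factor out of pseudo
correlations of vectors that depend on the past only. -/
theorem Standing.pcorr_weights [IsProbabilityMeasure μ] (hM : M.Standing μ) {t : ℕ} {ι κ : Type*}
    {X : Ω → ι → Tessarine} {Y : Ω → κ → Tessarine} (hX : M.IsPast μ (t + 2) X)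
    (hY : M.IsPast μ (t + 2) Y) {φ : ι → (Fin R × (Fin 4 × Fin n) → ℝ) → ℝ}
    {ψ : κ → (Fin R × (Fin 4 × Fin n) → ℝ) → ℝ} (hφ : ∀ i, Measurable (φ i))
    (hψ : ∀ j, Measurable (ψ j)) (i : ι) (j : κ) :
    pcorr μ (fun ω i => ofReal (φ i (M.gam (t + 2) ω)) * X ω i)
      (fun ω j => ofReal (ψ j (M.gam (t + 2) ω)) * Y ω j) i j =
      ofReal (∫ ω, φ i (M.gam (t + 2) ω) * ψ j (M.gam (t + 2) ω) ∂μ) * pcorr μ X Y i j := by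
  refine _root_.pcorr_weights hX.memLp hY.memLp i j ?_ fun ν => ?_
  · exact (((hφ i).mul (hψ j)).comp (hM.measurable_gam t)).aestronglyMeasurable
  · have h := (hM.indepFun_gam_past t).comp ((hφ i).mul (hψ j)) measurable_id
    rw [IndepFun_iff_Indep] at h ⊢
    refine indep_of_indep_of_le_right h (Measurable.comap_le (m₁ := M.pastAlg (t + 2)) ?_)
    obtain ⟨c, hc⟩ := exists_comp_mul ν
    simp only [hc]
    exact Finset.measurable_fun_sum _ fun p _ => Finset.measurable_fun_sum _ fun q _ =>
      ((hX.meas i p).mul (hY.meas.conj 1 j q)).const_mul _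

end Standing

end DropoutModel

/-! ### Square integrability of the processes -/

namespace DropoutModel

open Tessarine

section Integrability

variable {n R : ℕ} {Ω : Type*} [MeasurableSpace Ω] {μ : Measure Ω} {M : DropoutModel n R Ω}

theorem Standing.tMemLp_x₀ (hM : M.Standing μ) : TMemLp μ M.x₀ := hM.memLp_x₀

theorem Standing.tMemLp_u (hM : M.Standing μ) (t : ℕ) : TMemLp μ (M.u t) := hM.memLp_u t

theorem Standing.tMemLp_v (hM : M.Standing μ) (i : Fin R) {t : ℕ} (ht : 1 ≤ t) :
    TMemLp μ (M.v i t) := fun j ν => hM.memLp_v i t j ν ht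

theorem Standing.tMemLp_x (hM : M.Standing μ) (t : ℕ) : TMemLp μ (M.x t) := by
  induction t with
  | zero => exact hM.tMemLp_x₀
  | succ t ih =>
    exact ((((ih.mulVec _).add ((ih.conj 1).mulVec _)).add ((ih.conj 2).mulVec _)).add
      ((ih.conj 3).mulVec _)).add (hM.tMemLp_u t)

theorem memLp_mul_of_abs_le_one {f g : Ω → ℝ} (hf : AEStronglyMeasurable f μ)
    (hg : MemLp g 2 μ) (h : ∀ᵐ ω ∂μ, |f ω| ≤ 1) : MemLp (fun ω => f ω * g ω) 2 μ := by
  refine hg.mono (hf.mul hg.aestronglyMeasurable) (h.mono fun ω hω => ?_)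
  rw [Real.norm_eq_abs, Real.norm_eq_abs, abs_mul]
  exact mul_le_of_le_one_left (abs_nonneg _) hω

theorem Standing.tMemLp_y (hM : M.Standing μ) (i : Fin R) (t : ℕ) : TMemLp μ (M.y i t) := by
  have hz : ∀ t, 1 ≤ t → TMemLp μ (M.z i t) := fun t ht =>
    (hM.tMemLp_x t).add (hM.tMemLp_v i ht)
  induction t using Nat.twoStepInduction with
  | zero => exact TMemLp.zero
  | one => exact hz 1 le_rfl
  | more t _ ih =>
    intro j ν
    have hg := hM.meas_γ i (t + 2) j ν (by omega)
    have hb := hM.bernoulli i (t + 2) j ν (by omega)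
    simp only [y, comp_add, comp_starProd, comp_sub, comp_ones]
    refine (memLp_mul_of_abs_le_one hg.aestronglyMeasurable (hz _ (by omega) j ν) ?_).add
      (memLp_mul_of_abs_le_one (measurable_const.sub hg).aestronglyMeasurable (ih j ν) ?_)
    · filter_upwards [hb] with ω hω
      rcases hω with h | h <;> simp [h]
    · filter_upwards [hb] with ω hω
      rcases hω with h | h <;> simp [h]

theorem Standing.tMemLp_yvec (hM : M.Standing μ) (t : ℕ) : TMemLp μ (M.yvec t) :=
  TMemLp.stack fun i => (hM.tMemLp_y i t).aug

theorem Standing.tMemLp_vvec (hM : M.Standing μ) {t : ℕ} (ht : 1 ≤ t) : TMemLp μ (M.vvec t) :=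
  TMemLp.stack fun i => (hM.tMemLp_v i ht).aug

theorem Standing.isPast_x (hM : M.Standing μ) (t s : ℕ) : M.IsPast μ t (aug (M.x s)) :=
  ⟨(M.tMeasurable_pastAlg_x t s).aug, (hM.tMemLp_x s).aug⟩

theorem Standing.isPast_u (hM : M.Standing μ) (t s : ℕ) : M.IsPast μ t (aug (M.u s)) :=
  ⟨(M.tMeasurable_pastAlg_u t s).aug, (hM.tMemLp_u s).aug⟩

theorem Standing.isPast_vvec (hM : M.Standing μ) (t : ℕ) {s : ℕ} (hs : 1 ≤ s) :
    M.IsPast μ t (M.vvec s) :=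
  ⟨TMeasurable.stack fun i => (M.tMeasurable_pastAlg_v t i s hs).aug, hM.tMemLp_vvec hs⟩

theorem Standing.isPast_yvec (hM : M.Standing μ) {t s : ℕ} (hs : s < t) :
    M.IsPast μ t (M.yvec s) :=
  ⟨TMeasurable.stack fun i => (M.tMeasurable_pastAlg_y t s hs i).aug, hM.tMemLp_yvec s⟩

theorem Standing.isPast_zvec (hM : M.Standing μ) (t : ℕ) {s : ℕ} (hs : 1 ≤ s) :
    M.IsPast μ t (M.zvec s) := by
  rw [M.zvec_eq]
  exact ((hM.isPast_x t s).mulVec _).add (hM.isPast_vvec t hs)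

end Integrability

/-! ### Moments of the dropout variables -/

section Moments

variable {n R : ℕ} {Ω : Type*} [MeasurableSpace Ω] {μ : Measure Ω} {M : DropoutModel n R Ω}

theorem Standing.integral_gam (hM : M.Standing μ) (t : ℕ) (a : Fin R × (Fin 4 × Fin n)) :
    ∫ ω, M.gam (t + 2) ω a ∂μ = M.pvec μ (t + 2) a := by
  have hg := hM.meas_γ a.1 (t + 2) a.2.2 a.2.1 (by omega)
  have hset : MeasurableSet {ω | (M.γ a.1 (t + 2) ω a.2.2).comp a.2.1 = 1} :=
    hg (measurableSet_singleton 1)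
  have hp : M.pvec μ (t + 2) a = μ.real {ω | (M.γ a.1 (t + 2) ω a.2.2).comp a.2.1 = 1} := by
    simp [pvec, prob]
  rw [hp, ← integral_indicator_one hset]
  refine integral_congr_ae ?_
  filter_upwards [hM.bernoulli a.1 (t + 2) a.2.2 a.2.1 (by omega)] with ω hω
  rcases hω with h | h <;> simp [gam, Set.indicator, h]

theorem Standing.integrable_gam [IsProbabilityMeasure μ]
    (hM : M.Standing μ) (t : ℕ) (a : Fin R × (Fin 4 × Fin n)) :
    Integrable (fun ω => M.gam (t + 2) ω a) μ := by
  refine Integrable.of_bound (hM.meas_γ _ _ _ _ (by omega)).aestronglyMeasurable 1 ?_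
  filter_upwards [hM.bernoulli a.1 (t + 2) a.2.2 a.2.1 (by omega)] with ω hω
  rcases hω with h | h <;> simp [gam, h]

theorem Standing.integrable_gam_mul [IsProbabilityMeasure μ]
    (hM : M.Standing μ) (t : ℕ)
    (a b : Fin R × (Fin 4 × Fin n)) :
    Integrable (fun ω => M.gam (t + 2) ω a * M.gam (t + 2) ω b) μ := by
  refine (hM.integrable_gam t b).bdd_mul (c := 1)
    (hM.integrable_gam t a).aestronglyMeasurable ?_
  filter_upwards [hM.bernoulli a.1 (t + 2) a.2.2 a.2.1 (by omega)] with ω hω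
  rcases hω with h | h <;> simp [gam, h]

theorem Standing.integral_gam_mul [IsProbabilityMeasure μ]
    (hM : M.Standing μ) (t : ℕ) (a b : Fin R × (Fin 4 × Fin n)) :
    ∫ ω, M.gam (t + 2) ω a * M.gam (t + 2) ω b ∂μ =
      if a = b then M.pvec μ (t + 2) a else M.pvec μ (t + 2) a * M.pvec μ (t + 2) b := by
  split_ifs with h
  · subst h
    rw [← hM.integral_gam]
    refine integral_congr_ae ?_
    filter_upwards [hM.bernoulli a.1 (t + 2) a.2.2 a.2.1 (by omega)] with ω hω
    rcases hω with h | h <;> simp [gam, h]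
  · have hne : ((a.1, t, a.2.2, a.2.1) : Fin R × ℕ × Fin n × Fin 4) ≠
        (b.1, t, b.2.2, b.2.1) := fun h' => h (by
      simp only [Prod.mk.injEq, true_and] at h'
      exact Prod.ext h'.1 (Prod.ext h'.2.2 h'.2.1))
    rw [← hM.integral_gam, ← hM.integral_gam]
    exact (hM.indep_γ.indepFun hne).integral_fun_mul_eq_mul_integral
      (hM.integrable_gam t a).aestronglyMeasurable (hM.integrable_gam t b).aestronglyMeasurable

theorem Standing.integral_gam_mul_one_sub [IsProbabilityMeasure μ]
    (hM : M.Standing μ) (t : ℕ)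
    (a b : Fin R × (Fin 4 × Fin n)) :
    ∫ ω, M.gam (t + 2) ω a * (1 - M.gam (t + 2) ω b) ∂μ =
      if a = b then 0 else M.pvec μ (t + 2) a * (1 - M.pvec μ (t + 2) b) := by
  simp only [mul_sub, mul_one]
  rw [integral_sub (hM.integrable_gam t a) (hM.integrable_gam_mul t a b), hM.integral_gam,
    hM.integral_gam_mul]
  split_ifs <;> ring

theorem Standing.integral_one_sub_gam [IsProbabilityMeasure μ]
    (hM : M.Standing μ) (t : ℕ)
    (a : Fin R × (Fin 4 × Fin n)) :
    ∫ ω, (1 - M.gam (t + 2) ω a) ∂μ = 1 - M.pvec μ (t + 2) a := by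
  rw [integral_sub (integrable_const _) (hM.integrable_gam t a), hM.integral_gam]
  simp

theorem Standing.integral_one_sub_gam_mul [IsProbabilityMeasure μ]
    (hM : M.Standing μ) (t : ℕ)
    (a b : Fin R × (Fin 4 × Fin n)) :
    ∫ ω, (1 - M.gam (t + 2) ω a) * (1 - M.gam (t + 2) ω b) ∂μ =
      if a = b then 1 - M.pvec μ (t + 2) a else
        (1 - M.pvec μ (t + 2) a) * (1 - M.pvec μ (t + 2) b) := by
  have h : ∀ ω, (1 - M.gam (t + 2) ω a) * (1 - M.gam (t + 2) ω b) =
      (1 - M.gam (t + 2) ω b) - M.gam (t + 2) ω a * (1 - M.gam (t + 2) ω b) := fun ω => by ring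
  have hi : Integrable (fun ω => M.gam (t + 2) ω a * (1 - M.gam (t + 2) ω b)) μ := by
    simp only [mul_sub, mul_one]
    exact (hM.integrable_gam t a).sub (hM.integrable_gam_mul t a b)
  have hb : Integrable (fun ω => 1 - M.gam (t + 2) ω b) μ :=
    (integrable_const _).sub (hM.integrable_gam t b)
  simp only [h]
  rw [integral_sub hb hi,
    hM.integral_gam_mul_one_sub, hM.integral_one_sub_gam]
  split_ifs with hab
  · rw [hab]; ring
  · ring

theorem Standing.integral_gam_sub [IsProbabilityMeasure μ]
    (hM : M.Standing μ) (t : ℕ) (a : Fin R × (Fin 4 × Fin n)) :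
    ∫ ω, (M.gam (t + 2) ω a - M.pvec μ (t + 2) a) ∂μ = 0 := by
  rw [integral_sub (hM.integrable_gam t a) (integrable_const _), hM.integral_gam]
  simp

theorem Standing.integral_gam_sub_mul [IsProbabilityMeasure μ]
    (hM : M.Standing μ) (t : ℕ)
    (a b : Fin R × (Fin 4 × Fin n)) :
    ∫ ω, (M.gam (t + 2) ω a - M.pvec μ (t + 2) a) *
      (M.gam (t + 2) ω b - M.pvec μ (t + 2) b) ∂μ =
      if a = b then M.pvec μ (t + 2) a * (1 - M.pvec μ (t + 2) a) else 0 := by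
  have h : ∀ ω, (M.gam (t + 2) ω a - M.pvec μ (t + 2) a) *
      (M.gam (t + 2) ω b - M.pvec μ (t + 2) b) = M.gam (t + 2) ω a * M.gam (t + 2) ω b -
        M.pvec μ (t + 2) b * M.gam (t + 2) ω a -
        M.pvec μ (t + 2) a * (M.gam (t + 2) ω b - M.pvec μ (t + 2) b) := fun ω => by ring
  have h1 := hM.integrable_gam_mul t a b
  have h2 := (hM.integrable_gam t a).const_mul (M.pvec μ (t + 2) b)
  have h12 : Integrable (fun ω => M.gam (t + 2) ω a * M.gam (t + 2) ω b -
      M.pvec μ (t + 2) b * M.gam (t + 2) ω a) μ := h1.sub h2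
  have h3 : Integrable (fun ω => M.pvec μ (t + 2) a *
      (M.gam (t + 2) ω b - M.pvec μ (t + 2) b)) μ :=
    ((hM.integrable_gam t b).sub (integrable_const _)).const_mul _
  simp only [h]
  rw [integral_sub h12 h3, integral_sub h1 h2, integral_const_mul, integral_const_mul,
    hM.integral_gam_sub, hM.integral_gam, hM.integral_gam_mul]
  split_ifs with hab
  · rw [hab]; ring
  · ring

/-! ### Random weighting of the real components -/

/-- Real weights, functions of the dropout variables, that are bounded by one
where these are `0` or `1`. -/
structure IsWeight {ι : Type*} (φ : ι → ℝ → ℝ) : Prop where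
  meas : ∀ a, Measurable (φ a)
  bound : ∀ a r, r = 0 ∨ r = 1 → |φ a r| ≤ 1

variable {φ ψ : Fin R × (Fin 4 × Fin n) → ℝ → ℝ}

theorem isWeight_gam {ι : Type*} : IsWeight fun (_ : ι) r => r :=
  ⟨fun _ => measurable_id, fun _ r hr => by rcases hr with rfl | rfl <;> simp⟩

theorem isWeight_one_sub {ι : Type*} : IsWeight fun (_ : ι) r => 1 - r :=
  ⟨fun _ => measurable_const.sub measurable_id,
    fun _ r hr => by rcases hr with rfl | rfl <;> simp⟩

theorem isWeight_sub_pvec [IsProbabilityMeasure μ] (t : ℕ) :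
    IsWeight fun (a : Fin R × (Fin 4 × Fin n)) r => r - M.pvec μ t a := by
  refine ⟨fun _ => measurable_id.sub measurable_const, fun a r hr => ?_⟩
  have h : 0 ≤ M.pvec μ t a ∧ M.pvec μ t a ≤ 1 := by
    simp only [pvec, prob]
    split_ifs
    · norm_num
    · exact ⟨measureReal_nonneg, measureReal_le_one⟩
  rw [abs_le]
  rcases hr with rfl | rfl <;> constructor <;> linarith [h.1, h.2]

theorem Standing.tMemLp_weights (hM : M.Standing μ) {t : ℕ} (hφ : IsWeight φ)
    {X : Ω → Fin R × (Fin 4 × Fin n) → Tessarine} (hX : TMemLp μ X) :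
    TMemLp μ fun ω a => ofReal (φ a (M.gam (t + 2) ω a)) * X ω a := by
  intro a ν
  simp only [comp_ofReal_mul]
  refine memLp_mul_of_abs_le_one ?_ (hX a ν) ?_
  · exact ((hφ.meas a).comp (hM.meas_γ _ _ _ _ (by omega))).aestronglyMeasurable
  · filter_upwards [hM.bernoulli a.1 (t + 2) a.2.2 a.2.1 (by omega)] with ω hω
    exact hφ.bound a _ hω

theorem Standing.tMemLp_weighted (hM : M.Standing μ) {t : ℕ} (hφ : IsWeight φ)
    {X : Ω → Fin R × (Fin 4 × Fin n) → Tessarine} (hX : TMemLp μ X) :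
    TMemLp μ (M.weighted (t + 2) φ X) :=
  (hM.tMemLp_weights hφ (hX.mulVec _)).mulVec _

/-- Weighting one vector only acts through the mean weights. -/
theorem Standing.pcorr_weighted_left [IsProbabilityMeasure μ]
    (hM : M.Standing μ) {t : ℕ} (hφ : IsWeight φ)
    {X : Ω → Fin R × (Fin 4 × Fin n) → Tessarine} (hX : M.IsPast μ (t + 2) X) {κ : Type*}
    {W : Ω → κ → Tessarine} (hW : M.IsPast μ (t + 2) W) :
    pcorr μ (M.weighted (t + 2) φ X) W =
      matU R n * Matrix.diagonal (fun a => ofReal (∫ ω, φ a (M.gam (t + 2) ω a) ∂μ)) *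
        (matU R n)ᴴ * pcorr μ X W := by
  rw [Matrix.mul_assoc, Matrix.mul_assoc, ← pcorr_mulVec_left hX.memLp hW.memLp]
  have h1 := hM.tMemLp_weights (t := t) hφ (hX.memLp.mulVec (matU R n)ᴴ)
  refine (pcorr_mulVec_left h1 hW.memLp _).trans ?_
  congr 1
  ext1 a j
  have h2 := hM.pcorr_weights (hX.mulVec (matU R n)ᴴ) hW
    (φ := fun a g => φ a (g a)) (ψ := fun _ _ => 1)
    (fun a => (hφ.meas a).comp (measurable_pi_apply a)) (fun _ => measurable_const) a j
  simp only [ofReal_one, one_mul, mul_one] at h2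
  rw [Matrix.diagonal_mul]
  exact h2

/-- Weighting both vectors multiplies the correlations of the real components entrywise by the
second moments of the weights. -/
theorem Standing.pcorr_weighted [IsProbabilityMeasure μ]
    (hM : M.Standing μ) {t : ℕ} (hφ : IsWeight φ) (hψ : IsWeight ψ)
    {X Y : Ω → Fin R × (Fin 4 × Fin n) → Tessarine} (hX : M.IsPast μ (t + 2) X)
    (hY : M.IsPast μ (t + 2) Y) :
    pcorr μ (M.weighted (t + 2) φ X) (M.weighted (t + 2) ψ Y) =
      matU R n * (Matrix.of (fun a b =>
          ofReal (∫ ω, φ a (M.gam (t + 2) ω a) * ψ b (M.gam (t + 2) ω b) ∂μ)) ⊙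
        ((matU R n)ᴴ * pcorr μ X Y * matU R n)) * (matU R n)ᴴ := by
  have h1 := hM.tMemLp_weights (t := t) hφ (hX.memLp.mulVec (matU R n)ᴴ)
  have h2 := hM.tMemLp_weights (t := t) hψ (hY.memLp.mulVec (matU R n)ᴴ)
  refine (pcorr_mulVec_left h1 (h2.mulVec _) _).trans ?_
  rw [pcorr_mulVec_right h1 h2, ← Matrix.mul_assoc]
  congr 2
  ext1 a b
  have h3 := hM.pcorr_weights (hX.mulVec (matU R n)ᴴ) (hY.mulVec (matU R n)ᴴ)
    (φ := fun a g => φ a (g a)) (ψ := fun a g => ψ a (g a))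
    (fun a => (hφ.meas a).comp (measurable_pi_apply a))
    (fun a => (hψ.meas a).comp (measurable_pi_apply a)) a b
  rw [pcorr_mulVec_left hX.memLp (hY.memLp.mulVec _), pcorr_mulVec_right hX.memLp hY.memLp,
    Matrix.conjTranspose_conjTranspose, ← Matrix.mul_assoc] at h3
  exact h3

end Moments

end DropoutModel

/-! ### Second-order moments of states and measurements -/

namespace DropoutModel

open Tessarine

section Correlations

variable {n R : ℕ} {Ω : Type*} [MeasurableSpace Ω] {μ : Measure Ω} {M : DropoutModel n R Ω}

theorem Pibar_one : M.Pibar μ 1 = 1 := by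
  have h : (fun a => ofReal (M.pvec μ 1 a)) = fun _ => 1 := by
    ext1 a; simp [pvec, prob, ofReal_one]
  rw [Pibar, h, Matrix.diagonal_one, Matrix.mul_one, matU_mul_conjTranspose]

theorem Pibar1_eq (t : ℕ) : M.Pibar1 μ t = 1 - M.Pibar μ t := by
  have h : Matrix.diagonal (fun a => ofReal (1 - M.pvec μ t a)) =
      1 - Matrix.diagonal (fun a => ofReal (M.pvec μ t a)) := by
    rw [← Matrix.diagonal_one, Matrix.diagonal_sub]
    simp only [ofReal_sub, ofReal_one]
  rw [Pibar1, Pibar, h, Matrix.mul_sub, Matrix.sub_mul, Matrix.mul_one, matU_mul_conjTranspose]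

theorem Pibar_conjTranspose (t : ℕ) : (M.Pibar μ t)ᴴ = M.Pibar μ t := by
  have h : (Matrix.diagonal fun a => ofReal (M.pvec μ t a))ᴴ =
      Matrix.diagonal fun a => ofReal (M.pvec μ t a) := by
    rw [Matrix.diagonal_conjTranspose]
    congr 1; ext1 a; exact star_ofReal _
  rw [Pibar, Matrix.conjTranspose_mul, Matrix.conjTranspose_mul, h,
    Matrix.conjTranspose_conjTranspose, Matrix.mul_assoc]

theorem Pibar1_conjTranspose (t : ℕ) : (M.Pibar1 μ t)ᴴ = M.Pibar1 μ t := by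
  rw [Pibar1_eq, Matrix.conjTranspose_sub, Matrix.conjTranspose_one, Pibar_conjTranspose]

theorem pcorr_vvec_right_eq_zero {ι : Type*} {X : Ω → ι → Tessarine} {s : ℕ}
    (h : ∀ i, pcorr μ X (aug (M.v i s)) = 0) : pcorr μ X (M.vvec s) = 0 := by
  ext1 a b
  exact congrFun (congrFun (h b.1) a) b.2

theorem pcorr_u_vvec (t : ℕ) : pcorr μ (aug (M.u t)) (M.vvec t) = M.Svec μ t := rfl

namespace Standing

theorem pcorr_u_vvec_of_ne (hM : M.Standing μ) {t s : ℕ} (hs : 1 ≤ s) (hts : t ≠ s) :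
    pcorr μ (aug (M.u t)) (M.vvec s) = 0 :=
  pcorr_vvec_right_eq_zero fun i => hM.uncorr_uv i t s hs hts

theorem pcorr_vvec_of_ne (hM : M.Standing μ) {t s : ℕ} (ht : 1 ≤ t) (hs : 1 ≤ s) (hts : t ≠ s) :
    pcorr μ (M.vvec t) (M.vvec s) = 0 := by
  refine pcorr_vvec_right_eq_zero fun i => ?_
  refine pcorr_swap_eq_zero (pcorr_vvec_right_eq_zero fun l => ?_)
  by_cases hil : i = l
  · subst hil
    exact hM.white_v i s t hs ht hts.symm
  · exact hM.uncorr_v i l s t hil hs ht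

theorem pcorr_vvec_self (hM : M.Standing μ) {t : ℕ} (ht : 1 ≤ t) :
    pcorr μ (M.vvec t) (M.vvec t) = M.Rvec μ t := by
  ext1 a b
  simp only [Rvec, diagBlocks, Matrix.of_apply]
  split_ifs with h
  · change pcorr μ (aug (M.v a.1 t)) (aug (M.v b.1 t)) a.2 b.2 = _
    rw [← h]
  · exact congrFun (congrFun (hM.uncorr_v a.1 b.1 t t h ht ht) a.2) b.2

/-- The state equation, for pseudo correlations with an arbitrary vector. -/
theorem pcorr_x_succ (hM : M.Standing μ) {κ : Type*} {W : Ω → κ → Tessarine} (hW : TMemLp μ W)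
    (t : ℕ) : pcorr μ (aug (M.x (t + 1))) W =
      M.Phibar t * pcorr μ (aug (M.x t)) W + pcorr μ (aug (M.u t)) W := by
  rw [M.aug_x_succ, pcorr_add_left ((hM.tMemLp_x t).aug.mulVec _) (hM.tMemLp_u t).aug hW,
    pcorr_mulVec_left (hM.tMemLp_x t).aug hW]

theorem pcorr_x_u (hM : M.Standing μ) {t s : ℕ} (hts : t ≤ s) :
    pcorr μ (aug (M.x t)) (aug (M.u s)) = 0 := by
  induction t with
  | zero => exact hM.uncorr_x₀u s
  | succ t ih =>
    rw [hM.pcorr_x_succ (hM.tMemLp_u s).aug, ih (by omega), hM.white_u t s (by omega),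
      Matrix.mul_zero, add_zero]

theorem pcorr_x_vvec (hM : M.Standing μ) {t s : ℕ} (hs : 1 ≤ s) (hts : t ≤ s) :
    pcorr μ (aug (M.x t)) (M.vvec s) = 0 := by
  induction t with
  | zero => exact pcorr_vvec_right_eq_zero fun i => hM.uncorr_x₀v i s hs
  | succ t ih =>
    rw [hM.pcorr_x_succ (hM.tMemLp_vvec hs), ih (by omega),
      hM.pcorr_u_vvec_of_ne hs (by omega), Matrix.mul_zero, add_zero]

theorem pcorr_zvec_left (hM : M.Standing μ) {κ : Type*} {W : Ω → κ → Tessarine}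
    (hW : TMemLp μ W) {t : ℕ} (ht : 1 ≤ t) : pcorr μ (M.zvec t) W =
      onesKron R (Fin 4 × Fin n) * pcorr μ (aug (M.x t)) W + pcorr μ (M.vvec t) W := by
  rw [M.zvec_eq, pcorr_add_left ((hM.tMemLp_x t).aug.mulVec _) (hM.tMemLp_vvec ht) hW,
    pcorr_mulVec_left (hM.tMemLp_x t).aug hW]

theorem pcorr_x_zvec (hM : M.Standing μ) (t : ℕ) :
    pcorr μ (aug (M.x (t + 1))) (M.zvec (t + 1)) =
      pcorr μ (aug (M.x (t + 1))) (aug (M.x (t + 1))) * (onesKron R (Fin 4 × Fin n))ᵀ := by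
  rw [← pcorr_conjTranspose, hM.pcorr_zvec_left (hM.tMemLp_x _).aug (by omega),
    pcorr_swap_eq_zero (hM.pcorr_x_vvec (by omega) le_rfl), add_zero,
    Matrix.conjTranspose_mul, pcorr_conjTranspose, onesKron_conjTranspose]

theorem Gx_eq (hM : M.Standing μ) (t : ℕ) :
    M.Gx μ t = pcorr μ (aug (M.x t)) (aug (M.x t)) := by
  induction t with
  | zero => rfl
  | succ t ih =>
    have hx := (hM.tMemLp_x t).aug
    have hx1 := (hM.tMemLp_x (t + 1)).aug
    have hu := (hM.tMemLp_u t).aug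
    have h1 : pcorr μ (aug (M.x t)) (aug (M.x (t + 1))) = M.Gx μ t * (M.Phibar t)ᴴ := by
      rw [← pcorr_conjTranspose, hM.pcorr_x_succ hx, pcorr_swap_eq_zero (hM.pcorr_x_u le_rfl),
        add_zero, Matrix.conjTranspose_mul, pcorr_conjTranspose, ih]
    have h2 : pcorr μ (aug (M.u t)) (aug (M.x (t + 1))) = M.Qbar μ t := by
      rw [← pcorr_conjTranspose, hM.pcorr_x_succ hu, hM.pcorr_x_u le_rfl, Matrix.mul_zero,
        zero_add, pcorr_conjTranspose]
      rfl
    rw [hM.pcorr_x_succ hx1, h1, h2, Gx, Matrix.mul_assoc]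

theorem pcorr_zvec_self (hM : M.Standing μ) (t : ℕ) :
    pcorr μ (M.zvec (t + 1)) (M.zvec (t + 1)) =
      onesKron R (Fin 4 × Fin n) * M.Gx μ (t + 1) * (onesKron R (Fin 4 × Fin n))ᵀ +
        M.Rvec μ (t + 1) := by
  have hz : TMemLp μ (M.zvec (t + 1)) := (hM.isPast_zvec 0 (by omega)).memLp
  rw [hM.pcorr_zvec_left hz (by omega), hM.pcorr_x_zvec, ← hM.Gx_eq, ← Matrix.mul_assoc,
    ← pcorr_conjTranspose (M.zvec (t + 1)), hM.pcorr_zvec_left (hM.tMemLp_vvec (by omega))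
      (by omega), hM.pcorr_x_vvec (by omega) le_rfl, Matrix.mul_zero, zero_add,
    pcorr_conjTranspose, hM.pcorr_vvec_self (by omega)]

variable [IsProbabilityMeasure μ]

/-- Given the past, the measurement acts in the mean through `Π̄^γ` and `Π̄^{1-γ}`. -/
theorem pcorr_yvec_succ (hM : M.Standing μ) {κ : Type*} {W : Ω → κ → Tessarine} {t : ℕ}
    (hW : M.IsPast μ (t + 1) W) : pcorr μ (M.yvec (t + 1)) W =
      M.Pibar μ (t + 1) * (onesKron R (Fin 4 × Fin n) * pcorr μ (aug (M.x (t + 1))) W +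
        pcorr μ (M.vvec (t + 1)) W) + M.Pibar1 μ (t + 1) * pcorr μ (M.yvec t) W := by
  rw [← hM.pcorr_zvec_left hW.memLp (by omega)]
  cases t with
  | zero =>
    rw [Pibar_one, Pibar1_eq, Pibar_one, sub_self, Matrix.zero_mul, Matrix.one_mul, add_zero]
    rfl
  | succ t =>
    have hz := hM.isPast_zvec (t + 2) (s := t + 2) (by omega)
    have hy := hM.isPast_yvec (t := t + 2) (s := t + 1) (by omega)
    rw [M.yvec_add_two, pcorr_add_left (hM.tMemLp_weighted isWeight_gam hz.memLp)
      (hM.tMemLp_weighted isWeight_one_sub hy.memLp) hW.memLp,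
      hM.pcorr_weighted_left isWeight_gam hz hW, hM.pcorr_weighted_left isWeight_one_sub hy hW]
    simp only [hM.integral_gam, hM.integral_one_sub_gam]
    rfl

theorem pcorr_yvec_u (hM : M.Standing μ) {t s : ℕ} (hts : t < s) :
    pcorr μ (M.yvec t) (aug (M.u s)) = 0 := by
  induction t with
  | zero => rw [yvec_zero, pcorr_zero_left]
  | succ t ih =>
    rw [hM.pcorr_yvec_succ (hM.isPast_u _ s), hM.pcorr_x_u (by omega), ih (by omega),
      pcorr_swap_eq_zero (hM.pcorr_u_vvec_of_ne (by omega) (by omega)), Matrix.mul_zero,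
      add_zero, Matrix.mul_zero, Matrix.mul_zero, add_zero]

theorem pcorr_yvec_vvec (hM : M.Standing μ) {t s : ℕ} (hts : t < s) :
    pcorr μ (M.yvec t) (M.vvec s) = 0 := by
  induction t with
  | zero => rw [yvec_zero, pcorr_zero_left]
  | succ t ih =>
    rw [hM.pcorr_yvec_succ (hM.isPast_vvec _ (by omega)), hM.pcorr_x_vvec (by omega) (by omega),
      ih (by omega), hM.pcorr_vvec_of_ne (by omega) (by omega) (by omega), Matrix.mul_zero,
      add_zero, Matrix.mul_zero, Matrix.mul_zero, add_zero]

theorem pcorr_u_yvec (hM : M.Standing μ) (t : ℕ) :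
    pcorr μ (aug (M.u (t + 1))) (M.yvec (t + 1)) = M.Svec μ (t + 1) * M.Pibar μ (t + 1) := by
  rw [← pcorr_conjTranspose, hM.pcorr_yvec_succ (hM.isPast_u _ (t + 1)),
    hM.pcorr_x_u le_rfl, hM.pcorr_yvec_u (Nat.lt_succ_self t), Matrix.mul_zero, zero_add,
    Matrix.mul_zero, add_zero, Matrix.conjTranspose_mul, pcorr_conjTranspose, pcorr_u_vvec,
    Pibar_conjTranspose]

/-! ### The moment recursions of the algorithm -/

theorem pcorr_x_yvec_succ (hM : M.Standing μ) (t : ℕ) :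
    pcorr μ (aug (M.x (t + 1))) (M.yvec (t + 1)) =
      M.Gx μ (t + 1) * (onesKron R (Fin 4 × Fin n))ᵀ * M.Pibar μ (t + 1) +
        pcorr μ (aug (M.x (t + 1))) (M.yvec t) * M.Pibar1 μ (t + 1) := by
  rw [← pcorr_conjTranspose, hM.pcorr_yvec_succ (hM.isPast_x _ (t + 1)),
    pcorr_swap_eq_zero (hM.pcorr_x_vvec (by omega) le_rfl), add_zero, Matrix.conjTranspose_add,
    Matrix.conjTranspose_mul, Matrix.conjTranspose_mul, Matrix.conjTranspose_mul,
    pcorr_conjTranspose, pcorr_conjTranspose, Pibar_conjTranspose, Pibar1_conjTranspose,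
    onesKron_conjTranspose, hM.Gx_eq]

theorem Gxy_eq (hM : M.Standing μ) (t : ℕ) :
    M.Gxy μ (t + 1) = pcorr μ (aug (M.x (t + 1))) (M.yvec (t + 1)) := by
  induction t with
  | zero =>
    rw [hM.pcorr_x_yvec_succ, yvec_zero, pcorr_zero_right, Matrix.zero_mul, add_zero, Pibar_one,
      Matrix.mul_one]
    rfl
  | succ t ih =>
    rw [hM.pcorr_x_yvec_succ, hM.pcorr_x_succ (hM.tMemLp_yvec _), ← ih, hM.pcorr_u_yvec]
    rfl

/-- The matrix `B(t + 2)` of the algorithm is `E[x̄(t+2) y⃗(t+1)ᴴ]`. -/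
theorem pcorr_x_yvec_pred (hM : M.Standing μ) (t : ℕ) :
    pcorr μ (aug (M.x (t + 2))) (M.yvec (t + 1)) =
      M.Phibar (t + 1) * M.Gxy μ (t + 1) + M.Svec μ (t + 1) * M.Pibar μ (t + 1) := by
  rw [hM.pcorr_x_succ (hM.tMemLp_yvec _), ← hM.Gxy_eq, hM.pcorr_u_yvec]

theorem pcorr_zvec_yvec (hM : M.Standing μ) (t : ℕ) :
    pcorr μ (M.zvec (t + 2)) (M.yvec (t + 1)) = onesKron R (Fin 4 × Fin n) *
      (M.Phibar (t + 1) * M.Gxy μ (t + 1) + M.Svec μ (t + 1) * M.Pibar μ (t + 1)) := by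
  rw [hM.pcorr_zvec_left (hM.tMemLp_yvec _) (by omega), hM.pcorr_x_yvec_pred,
    pcorr_swap_eq_zero (hM.pcorr_yvec_vvec (by omega)), add_zero]

theorem Gy_eq (hM : M.Standing μ) (t : ℕ) :
    M.Gy μ (t + 1) = pcorr μ (M.yvec (t + 1)) (M.yvec (t + 1)) := by
  induction t with
  | zero => rw [zero_add, yvec_one, hM.pcorr_zvec_self 0]; rfl
  | succ t ih =>
    have hz := hM.isPast_zvec (t + 2) (s := t + 2) (by omega)
    have hy := hM.isPast_yvec (t := t + 2) (s := t + 1) (by omega)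
    have hA := hM.tMemLp_weighted (t := t) isWeight_gam hz.memLp
    have hB := hM.tMemLp_weighted (t := t) isWeight_one_sub hy.memLp
    have h12 : pcorr μ (M.weighted (t + 2) (fun _ r => 1 - r) (M.yvec (t + 1)))
        (M.weighted (t + 2) (fun _ r => r) (M.zvec (t + 2))) =
        matU R n * ((M.GamG1 μ (t + 2))ᵀ ⊙ (M.Psi2 μ (t + 2))ᴴ) * (matU R n)ᴴ := by
      rw [← pcorr_conjTranspose, hM.pcorr_weighted isWeight_gam isWeight_one_sub hz hy,
        Matrix.conjTranspose_mul, Matrix.conjTranspose_mul, Matrix.conjTranspose_conjTranspose,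
        ← Matrix.mul_assoc]
      congr 2
      ext1 a b
      simp only [Matrix.conjTranspose_apply, Matrix.hadamard_apply, Matrix.of_apply, star_mul',
        hM.integral_gam_mul_one_sub, star_ofReal, hM.pcorr_zvec_yvec, Matrix.transpose_apply,
        GamG1, Psi2, Matrix.mul_assoc]
    rw [M.yvec_add_two, pcorr_add_left hA hB (hA.add hB), pcorr_add_right hA hA hB,
      pcorr_add_right hB hA hB, h12, hM.pcorr_weighted isWeight_gam isWeight_gam hz hz,
      hM.pcorr_weighted isWeight_gam isWeight_one_sub hz hy,
      hM.pcorr_weighted isWeight_one_sub isWeight_one_sub hy hy]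
    simp only [hM.integral_gam_mul, hM.integral_gam_mul_one_sub, hM.integral_one_sub_gam_mul]
    rw [← ih, hM.pcorr_zvec_self, hM.pcorr_zvec_yvec]
    simp only [Gy, Psi1, Psi2, Matrix.mul_add, Matrix.add_mul, Matrix.mul_assoc, add_assoc]
    rfl

end Standing

/-! ### The part of a measurement not explained by the past -/

variable (M μ) in
/-- The residual of `y⃗(t + 1)` with respect to its mean dependence on `x̄(t + 1)` and `y⃗(t)`. -/
noncomputable def residual (t : ℕ) : Ω → Fin R × (Fin 4 × Fin n) → Tessarine :=
  M.yvec (t + 1) - (fun ω => (M.Pibar μ (t + 1) * onesKron R (Fin 4 × Fin n)) *ᵥ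
    aug (M.x (t + 1)) ω) - fun ω => M.Pibar1 μ (t + 1) *ᵥ M.yvec t ω

variable (M) in
/-- The difference between the present states and the measurements that replace them when they are
dropped, at time `t + 2`. -/
noncomputable def mismatch (t : ℕ) : Ω → Fin R × (Fin 4 × Fin n) → Tessarine :=
  (fun ω => onesKron R (Fin 4 × Fin n) *ᵥ aug (M.x (t + 2)) ω) - M.yvec (t + 1)

theorem residual_zero : M.residual μ 0 = M.vvec 1 := by
  rw [residual, Pibar1_eq, zero_add, Pibar_one, yvec_one, zvec_eq]
  ext1 ω
  simp

/-- The residual consists of the fluctuation of the dropout variables about their means, acting on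
the mismatch, and of the measurement noise that is let through. -/
theorem residual_succ (t : ℕ) : M.residual μ (t + 1) =
    M.weighted (t + 2) (fun a r => r - M.pvec μ (t + 2) a)
      (M.mismatch t) + M.weighted (t + 2) (fun _ r => r) (M.vvec (t + 2)) := by
  have hP : ∀ w, M.Pibar μ (t + 2) *ᵥ w = matU R n *ᵥ fun a =>
      ofReal (M.pvec μ (t + 2) a) * ((matU R n)ᴴ *ᵥ w) a := fun w => by
    rw [Pibar, ← Matrix.mulVec_mulVec, ← Matrix.mulVec_mulVec]
    congr 1; ext1 a
    rw [Matrix.mulVec_diagonal]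
  have hI : ∀ w, w = matU R n *ᵥ ((matU R n)ᴴ *ᵥ w) := fun w => by
    rw [Matrix.mulVec_mulVec, matU_mul_conjTranspose, Matrix.one_mulVec]
  rw [residual, M.yvec_add_two, Pibar1_eq, M.zvec_eq]
  ext1 ω
  simp only [Pi.add_apply, Pi.sub_apply, weighted, mismatch, ← Matrix.mulVec_mulVec,
    Matrix.sub_mulVec, Matrix.one_mulVec, hP]
  conv_lhs => enter [2, 1]; rw [hI (M.yvec (t + 1) ω)]
  simp only [← Matrix.mulVec_add, ← Matrix.mulVec_sub]
  congr 1; ext1 a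
  simp only [Pi.add_apply, Pi.sub_apply, Matrix.mulVec_add, Matrix.mulVec_sub, ofReal_sub,
    ofReal_one]
  ring

namespace Standing

theorem tMemLp_residual (hM : M.Standing μ) (t : ℕ) : TMemLp μ (M.residual μ t) :=
  ((hM.tMemLp_yvec _).sub ((hM.tMemLp_x _).aug.mulVec _)).sub ((hM.tMemLp_yvec _).mulVec _)

theorem pcorr_residual_self_zero (hM : M.Standing μ) :
    pcorr μ (M.residual μ 0) (M.residual μ 0) = M.Rvec μ 1 := by
  rw [residual_zero, hM.pcorr_vvec_self le_rfl]

variable [IsProbabilityMeasure μ]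

/-- Of all that depends on the past, the residual is correlated with the measurement noise only. -/
theorem pcorr_residual (hM : M.Standing μ) {κ : Type*} {W : Ω → κ → Tessarine} {t : ℕ}
    (hW : M.IsPast μ (t + 1) W) : pcorr μ (M.residual μ t) W =
      M.Pibar μ (t + 1) * pcorr μ (M.vvec (t + 1)) W := by
  have hx := (hM.tMemLp_x (t + 1)).aug
  rw [residual, pcorr_sub_left ((hM.tMemLp_yvec _).sub (hx.mulVec _))
    ((hM.tMemLp_yvec _).mulVec _) hW.memLp, pcorr_sub_left (hM.tMemLp_yvec _) (hx.mulVec _)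
    hW.memLp, pcorr_mulVec_left hx hW.memLp, pcorr_mulVec_left (hM.tMemLp_yvec _) hW.memLp,
    hM.pcorr_yvec_succ hW, Matrix.mul_add, Matrix.mul_assoc]
  abel

theorem pcorr_residual_x (hM : M.Standing μ) {t s : ℕ} (hs : s ≤ t + 1) :
    pcorr μ (M.residual μ t) (aug (M.x s)) = 0 := by
  rw [hM.pcorr_residual (hM.isPast_x _ s), pcorr_swap_eq_zero (hM.pcorr_x_vvec (by omega) hs),
    Matrix.mul_zero]

theorem pcorr_residual_yvec (hM : M.Standing μ) {t s : ℕ} (hs : s ≤ t) :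
    pcorr μ (M.residual μ t) (M.yvec s) = 0 := by
  rw [hM.pcorr_residual (hM.isPast_yvec (by omega)),
    pcorr_swap_eq_zero (hM.pcorr_yvec_vvec (by omega)), Matrix.mul_zero]

/-- The state noise and the residual are correlated at equal times, through the measurement noise.
-/
theorem pcorr_u_residual (hM : M.Standing μ) (t : ℕ) :
    pcorr μ (aug (M.u (t + 1))) (M.residual μ t) = M.Svec μ (t + 1) * M.Pibar μ (t + 1) := by
  rw [← pcorr_conjTranspose, hM.pcorr_residual (hM.isPast_u _ _), Matrix.conjTranspose_mul,
    pcorr_conjTranspose, Pibar_conjTranspose, pcorr_u_vvec]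

/-- The covariance of the residual: the fluctuation of the dropout variables about their means acts
on the mismatch, and the dropout variables themselves act on the measurement noise. -/
theorem pcorr_residual_self_succ (hM : M.Standing μ) (t : ℕ) :
    pcorr μ (M.residual μ (t + 1)) (M.residual μ (t + 1)) =
      matU R n * (M.covG μ (t + 2) ⊙ ((matU R n)ᴴ * pcorr μ (M.mismatch t) (M.mismatch t) *
        matU R n)) * (matU R n)ᴴ +
      matU R n * (M.GamG μ (t + 2) ⊙ ((matU R n)ᴴ * M.Rvec μ (t + 2) * matU R n)) *
        (matU R n)ᴴ := by
  have hx := (hM.tMemLp_x (t + 2)).aug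
  have hv := hM.isPast_vvec (t + 2) (s := t + 2) (by omega)
  have hXp : M.IsPast μ (t + 2) (M.mismatch t) :=
    ((hM.isPast_x _ _).mulVec _).sub (hM.isPast_yvec (by omega))
  have hXv : pcorr μ (M.mismatch t) (M.vvec (t + 2)) = 0 := by
    rw [mismatch, pcorr_sub_left (hx.mulVec _) (hM.tMemLp_yvec _) hv.memLp,
      pcorr_mulVec_left hx hv.memLp, hM.pcorr_x_vvec (by omega) le_rfl,
      hM.pcorr_yvec_vvec (by omega), Matrix.mul_zero, sub_zero]
  have hA := hM.tMemLp_weighted (t := t) (isWeight_sub_pvec (M := M) (μ := μ) (t + 2)) hXp.memLp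
  have hB := hM.tMemLp_weighted (t := t) isWeight_gam hv.memLp
  rw [residual_succ, pcorr_add_left hA hB (hA.add hB), pcorr_add_right hA hA hB,
    pcorr_add_right hB hA hB, hM.pcorr_weighted (isWeight_sub_pvec _) (isWeight_sub_pvec _) hXp hXp,
    hM.pcorr_weighted (isWeight_sub_pvec _) isWeight_gam hXp hv,
    hM.pcorr_weighted isWeight_gam (isWeight_sub_pvec _) hv hXp,
    hM.pcorr_weighted isWeight_gam isWeight_gam hv hv, hXv, pcorr_swap_eq_zero hXv,
    hM.pcorr_vvec_self (by omega)]
  simp only [hM.integral_gam_mul, hM.integral_gam_sub_mul, Matrix.mul_zero, Matrix.zero_mul,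
    Matrix.hadamard_zero, add_zero, zero_add]
  rfl

theorem pcorr_mismatch_self (hM : M.Standing μ) (t : ℕ) :
    (matU R n)ᴴ * pcorr μ (M.mismatch t) (M.mismatch t) * matU R n =
      M.Psi1 μ (t + 2) - M.Psi2 μ (t + 2) - (M.Psi2 μ (t + 2))ᴴ + M.Psi3 μ (t + 2) := by
  have hx := (hM.tMemLp_x (t + 2)).aug
  have hCx := hx.mulVec (onesKron R (Fin 4 × Fin n))
  have hy := hM.tMemLp_yvec (t + 1)
  have h21 : pcorr μ (M.yvec (t + 1)) (fun ω => onesKron R (Fin 4 × Fin n) *ᵥ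
      aug (M.x (t + 2)) ω) = (onesKron R (Fin 4 × Fin n) * (M.Phibar (t + 1) * M.Gxy μ (t + 1) +
        M.Svec μ (t + 1) * M.Pibar μ (t + 1)))ᴴ := by
    rw [← pcorr_conjTranspose, pcorr_mulVec_left hx hy, hM.pcorr_x_yvec_pred]
  conv_lhs => enter [1, 2]; rw [mismatch]
  rw [pcorr_sub_left hCx hy (hCx.sub hy), pcorr_sub_right hCx hCx hy,
    pcorr_sub_right hy hCx hy, pcorr_mulVec_left hx hCx, pcorr_mulVec_right hx hx,
    pcorr_mulVec_left hx hy, h21, hM.pcorr_x_yvec_pred, ← hM.Gx_eq, ← hM.Gy_eq,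
    onesKron_conjTranspose, Psi1, Psi2, Psi3]
  simp only [Matrix.mul_sub, Matrix.sub_mul, Matrix.conjTranspose_mul,
    Matrix.conjTranspose_conjTranspose, Matrix.mul_assoc]
  abel

end Standing

end Correlations

end DropoutModel

/-! ### Joint properness of states and measurements -/

namespace DropoutModel

open Tessarine

section Properness

variable {n R : ℕ} {Ω : Type*} [MeasurableSpace Ω] {μ : Measure Ω} {M : DropoutModel n R Ω}
  {k : ℕ}

theorem _root_.CrossProper.isCosetDiag {ι κ : Type*} {X : ℕ → Ω → ι → Tessarine}
    {Y : ℕ → Ω → κ → Tessarine} (h : CrossProper μ k X Y) (t s : ℕ) :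
    IsCosetDiag k Prod.fst Prod.fst (pcorr μ (aug (X t)) (aug (Y s))) := fun a b hab => by
  rw [pcorr_aug_apply, h t s _ hab]
  exact conj_zero _

/-- Joint `𝕋_k`-properness of augmented vectors with conjugation indices `f` and `g`. -/
def JointlyProper (μ : Measure Ω) (k : ℕ) {ι κ : Type*} (f : ι → Fin 4) (g : κ → Fin 4)
    (X : Ω → ι → Tessarine) (Y : Ω → κ → Tessarine) : Prop :=
  IsCosetDiag k f g (pcorr μ X Y)

theorem JointlyProper.symm {ι κ : Type*} {f : ι → Fin 4} {g : κ → Fin 4}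
    {X : Ω → ι → Tessarine} {Y : Ω → κ → Tessarine} (h : JointlyProper μ k f g X Y) :
    JointlyProper μ k g f Y X := by
  rw [JointlyProper, ← pcorr_conjTranspose]
  exact IsCosetDiag.conjTranspose h

theorem jointlyProper_of_eq_zero {ι κ : Type*} {f : ι → Fin 4} {g : κ → Fin 4}
    {X : Ω → ι → Tessarine} {Y : Ω → κ → Tessarine} (h : pcorr μ X Y = 0) :
    JointlyProper μ k f g X Y := by
  rw [JointlyProper, h]
  exact IsCosetDiag.zero

theorem jointlyProper_vvec {ι : Type*} {f : ι → Fin 4} {X : Ω → ι → Tessarine} {s : ℕ}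
    (h : ∀ i, JointlyProper μ k f Prod.fst X (aug (M.v i s))) :
    JointlyProper μ k f stackIdx X (M.vvec s) :=
  fun a b hab => h b.1 a b.2 hab

theorem jointlyProper_yvec_zero_left {κ : Type*} {g : κ → Fin 4} {W : Ω → κ → Tessarine} :
    JointlyProper μ k stackIdx g (M.yvec 0) W :=
  jointlyProper_of_eq_zero (by rw [yvec_zero, pcorr_zero_left])

namespace ProperConditions

theorem isCosetDiag_Phibar (hT : M.ProperConditions μ k) (t : ℕ) :
    IsCosetDiag k Prod.fst Prod.fst (M.Phibar t) := fun a b hab => by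
  change conj a.1 (M.F (conjMul a.1 b.1) t a.2 b.2) = 0
  rw [hT.blockDiag _ _ hab]
  exact conj_zero _

theorem u_u (hT : M.ProperConditions μ k) (t s : ℕ) :
    JointlyProper μ k Prod.fst Prod.fst (aug (M.u t)) (aug (M.u s)) :=
  hT.proper_u.isCosetDiag t s

theorem u_vvec (hT : M.ProperConditions μ k) (t : ℕ) {s : ℕ} (hs : 1 ≤ s) :
    JointlyProper μ k Prod.fst stackIdx (aug (M.u t)) (M.vvec s) := by
  obtain ⟨s, rfl⟩ := Nat.exists_eq_add_of_le' hs
  exact jointlyProper_vvec fun i => (hT.cross_uv i).isCosetDiag t s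

theorem vvec_vvec (hT : M.ProperConditions μ k) (hM : M.Standing μ) {t s : ℕ} (ht : 1 ≤ t)
    (hs : 1 ≤ s) : JointlyProper μ k stackIdx stackIdx (M.vvec t) (M.vvec s) := by
  refine jointlyProper_vvec fun i => (jointlyProper_vvec fun l => ?_).symm
  by_cases hil : i = l
  · subst hil
    obtain ⟨t, rfl⟩ := Nat.exists_eq_add_of_le' ht
    obtain ⟨s, rfl⟩ := Nat.exists_eq_add_of_le' hs
    exact (hT.proper_v i).isCosetDiag s t
  · exact jointlyProper_of_eq_zero (hM.uncorr_v i l s t hil hs ht)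

theorem x_succ (hT : M.ProperConditions μ k) (hM : M.Standing μ) (hk : k = 1 ∨ k = 2)
    {κ : Type*} {g : κ → Fin 4} {W : Ω → κ → Tessarine} (hW : TMemLp μ W) {t : ℕ}
    (hx : JointlyProper μ k Prod.fst g (aug (M.x t)) W)
    (hu : JointlyProper μ k Prod.fst g (aug (M.u t)) W) :
    JointlyProper μ k Prod.fst g (aug (M.x (t + 1))) W := by
  rw [JointlyProper, hM.pcorr_x_succ hW]
  exact ((hT.isCosetDiag_Phibar t).mul hk hx).add hu

theorem x_u (hT : M.ProperConditions μ k) (hM : M.Standing μ) (hk : k = 1 ∨ k = 2) (t s : ℕ) :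
    JointlyProper μ k Prod.fst Prod.fst (aug (M.x t)) (aug (M.u s)) := by
  induction t with
  | zero => exact jointlyProper_of_eq_zero (hM.uncorr_x₀u s)
  | succ t ih => exact hT.x_succ hM hk (hM.tMemLp_u s).aug ih (hT.u_u t s)

theorem x_vvec (hT : M.ProperConditions μ k) (hM : M.Standing μ) (hk : k = 1 ∨ k = 2) (t : ℕ)
    {s : ℕ} (hs : 1 ≤ s) : JointlyProper μ k Prod.fst stackIdx (aug (M.x t)) (M.vvec s) := by
  induction t with
  | zero => exact jointlyProper_of_eq_zero (hM.pcorr_x_vvec hs (by omega))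
  | succ t ih => exact hT.x_succ hM hk (hM.tMemLp_vvec hs) ih (hT.u_vvec t hs)

theorem x_x (hT : M.ProperConditions μ k) (hM : M.Standing μ) (hk : k = 1 ∨ k = 2) (t s : ℕ) :
    JointlyProper μ k Prod.fst Prod.fst (aug (M.x t)) (aug (M.x s)) := by
  have h0 : JointlyProper μ k Prod.fst Prod.fst (aug (M.x s)) (aug (M.x 0)) := by
    induction s with
    | zero => exact hT.proper_x₀.isCosetDiag 0 0
    | succ s ih =>
      exact hT.x_succ hM hk (hM.tMemLp_x 0).aug ih (hT.x_u hM hk 0 s).symm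
  induction t with
  | zero => exact h0.symm
  | succ t ih => exact hT.x_succ hM hk (hM.tMemLp_x s).aug ih (hT.x_u hM hk s t).symm

theorem isProperWeight_pvec (hT : M.ProperConditions μ k) (t : ℕ) (f : ℝ → ℝ) :
    IsProperWeight k fun a => ofReal (f (M.pvec μ t a)) := by
  by_cases ht : 2 ≤ t
  · refine ⟨fun hk i ν j => ?_, fun hk i j => ?_⟩
    · simp only [pvec, hT.prob_one hk i t j ν ht]
    · have h := hT.prob_two hk i t j ht
      simp only [pvec, h.1, h.2, and_self]
  · have h1 : ∀ a, M.pvec μ t a = 1 := fun a => if_pos (by omega)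
    simp only [h1]
    exact ⟨fun _ _ _ _ => rfl, fun _ _ _ => ⟨rfl, rfl⟩⟩

theorem isCosetDiag_Pibar (hT : M.ProperConditions μ k) (hk : k = 1 ∨ k = 2) (t : ℕ) :
    IsCosetDiag k stackIdx stackIdx (M.Pibar μ t) :=
  (hT.isProperWeight_pvec t id).isCosetDiag hk

theorem isCosetDiag_Pibar1 (hT : M.ProperConditions μ k) (hk : k = 1 ∨ k = 2) (t : ℕ) :
    IsCosetDiag k stackIdx stackIdx (M.Pibar1 μ t) :=
  (hT.isProperWeight_pvec t fun r => 1 - r).isCosetDiag hk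

/-- The covariance of the dropout variables is diagonal, so that the Hadamard product is a diagonal
weighting. -/
theorem isCosetDiag_covG (hT : M.ProperConditions μ k) (hk : k = 1 ∨ k = 2) (t : ℕ)
    {G : Matrix (Fin R × (Fin 4 × Fin n)) (Fin R × (Fin 4 × Fin n)) Tessarine}
    (hG : IsCosetDiag k stackIdx stackIdx G) : IsCosetDiag k stackIdx stackIdx
      (matU R n * (M.covG μ t ⊙ ((matU R n)ᴴ * G * matU R n)) * (matU R n)ᴴ) := by
  have h : M.covG μ t ⊙ ((matU R n)ᴴ * G * matU R n) = Matrix.diagonal fun a =>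
      ofReal (M.pvec μ t a * (1 - M.pvec μ t a)) * ((matU R n)ᴴ * G * matU R n) a a := by
    ext1 a b
    rw [Matrix.hadamard_apply, covG, Matrix.of_apply]
    by_cases hab : a = b
    · rw [if_pos hab, hab, Matrix.diagonal_apply_eq]
    · rw [if_neg hab, Matrix.diagonal_apply_ne _ hab, ofReal_zero, zero_mul]
  rw [h]
  exact ((hT.isProperWeight_pvec t fun r => r * (1 - r)).mul hG.isProperWeight).isCosetDiag hk

/-- The second moment matrix of the dropout variables is the rank one matrix of their means, which
acts as multiplication by `Π̄^γ` on both sides, plus their covariance. -/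
theorem isCosetDiag_GamG (hT : M.ProperConditions μ k) (hk : k = 1 ∨ k = 2) (t : ℕ)
    {G : Matrix (Fin R × (Fin 4 × Fin n)) (Fin R × (Fin 4 × Fin n)) Tessarine}
    (hG : IsCosetDiag k stackIdx stackIdx G) : IsCosetDiag k stackIdx stackIdx
      (matU R n * (M.GamG μ t ⊙ ((matU R n)ᴴ * G * matU R n)) * (matU R n)ᴴ) := by
  have h : M.GamG μ t ⊙ ((matU R n)ᴴ * G * matU R n) =
      Matrix.diagonal (fun a => ofReal (M.pvec μ t a)) * ((matU R n)ᴴ * G * matU R n) *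
        Matrix.diagonal (fun a => ofReal (M.pvec μ t a)) +
      M.covG μ t ⊙ ((matU R n)ᴴ * G * matU R n) := by
    ext1 a b
    rw [Matrix.add_apply, Matrix.mul_diagonal, Matrix.diagonal_mul, Matrix.hadamard_apply,
      Matrix.hadamard_apply, GamG, covG, Matrix.of_apply, Matrix.of_apply]
    by_cases hab : a = b
    · rw [if_pos hab, if_pos hab, hab, mul_sub, mul_one, ofReal_sub, ofReal_mul]; ring
    · rw [if_neg hab, if_neg hab, ofReal_zero, ofReal_mul]; ring
  have h2 : matU R n * (Matrix.diagonal (fun a => ofReal (M.pvec μ t a)) *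
      ((matU R n)ᴴ * G * matU R n) * Matrix.diagonal (fun a => ofReal (M.pvec μ t a))) *
        (matU R n)ᴴ = M.Pibar μ t * G * M.Pibar μ t := by
    simp only [Pibar, Matrix.mul_assoc]
  rw [h, Matrix.mul_add, Matrix.add_mul, h2]
  exact (((hT.isCosetDiag_Pibar hk t).mul hk hG).mul hk (hT.isCosetDiag_Pibar hk t)).add
    (hT.isCosetDiag_covG hk t hG)

variable [IsProbabilityMeasure μ]

theorem yvec_succ (hT : M.ProperConditions μ k) (hM : M.Standing μ) (hk : k = 1 ∨ k = 2)
    {κ : Type*} {g : κ → Fin 4} {W : Ω → κ → Tessarine} {t : ℕ} (hW : M.IsPast μ (t + 1) W)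
    (hx : JointlyProper μ k Prod.fst g (aug (M.x (t + 1))) W)
    (hv : JointlyProper μ k stackIdx g (M.vvec (t + 1)) W)
    (hy : JointlyProper μ k stackIdx g (M.yvec t) W) :
    JointlyProper μ k stackIdx g (M.yvec (t + 1)) W := by
  rw [JointlyProper, hM.pcorr_yvec_succ hW]
  exact ((hT.isCosetDiag_Pibar hk _).mul hk (((isCosetDiag_onesKron hk).mul hk hx).add hv)).add
    ((hT.isCosetDiag_Pibar1 hk _).mul hk hy)

theorem yvec_vvec (hT : M.ProperConditions μ k) (hM : M.Standing μ) (hk : k = 1 ∨ k = 2)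
    (t : ℕ) {s : ℕ} (hs : 1 ≤ s) :
    JointlyProper μ k stackIdx stackIdx (M.yvec t) (M.vvec s) := by
  induction t with
  | zero => exact jointlyProper_yvec_zero_left
  | succ t ih =>
    exact hT.yvec_succ hM hk (hM.isPast_vvec _ hs) (hT.x_vvec hM hk _ hs)
      (hT.vvec_vvec hM (by omega) hs) ih

theorem yvec_x (hT : M.ProperConditions μ k) (hM : M.Standing μ) (hk : k = 1 ∨ k = 2)
    (t s : ℕ) : JointlyProper μ k stackIdx Prod.fst (M.yvec t) (aug (M.x s)) := by
  induction t with
  | zero => exact jointlyProper_yvec_zero_left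
  | succ t ih =>
    exact hT.yvec_succ hM hk (hM.isPast_x _ s) (hT.x_x hM hk _ s)
      (hT.x_vvec hM hk s (by omega)).symm ih

/-- The residual of a proper model is proper. The diagonal weighting of the covariance by the
dropout variances respects properness because both the variances and the second moments of the real
components have the symmetry required in `IsProperWeight`. -/
theorem residual_residual (hT : M.ProperConditions μ k) (hM : M.Standing μ)
    (hk : k = 1 ∨ k = 2) (t : ℕ)
    (hy : JointlyProper μ k stackIdx stackIdx (M.yvec t) (M.yvec t)) :
    JointlyProper μ k stackIdx stackIdx (M.residual μ t) (M.residual μ t) := by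
  have hR : ∀ t, IsCosetDiag k stackIdx stackIdx (M.Rvec μ (t + 1)) := fun t => by
    rw [← hM.pcorr_vvec_self (by omega)]
    exact hT.vvec_vvec hM (by omega) (by omega)
  cases t with
  | zero =>
    rw [JointlyProper, hM.pcorr_residual_self_zero]
    exact hR 0
  | succ t =>
    rw [JointlyProper, hM.pcorr_residual_self_succ]
    refine (hT.isCosetDiag_covG hk _ ?_).add (hT.isCosetDiag_GamG hk _ (hR _))
    have hx := (hM.tMemLp_x (t + 2)).aug
    have hCx := hx.mulVec (onesKron R (Fin 4 × Fin n))
    have hyL := hM.tMemLp_yvec (t + 1)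
    have hC := isCosetDiag_onesKron (R := R) (n := n) hk
    have hC' := isCosetDiag_onesKron_transpose (R := R) (n := n) hk
    rw [mismatch, pcorr_sub_left hCx hyL (hCx.sub hyL), pcorr_sub_right hCx hCx hyL,
      pcorr_sub_right hyL hCx hyL, pcorr_mulVec_left hx hCx, pcorr_mulVec_right hx hx,
      pcorr_mulVec_left hx hyL, pcorr_mulVec_right hyL hx, onesKron_conjTranspose]
    have hxy := hT.yvec_x hM hk (t + 1) (t + 2)
    exact ((hC.mul hk ((hT.x_x hM hk _ _).mul hk hC')).sub (hC.mul hk hxy.symm)).sub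
      ((IsCosetDiag.mul hk hxy hC').sub hy)

theorem yvec_yvec_of_le (hT : M.ProperConditions μ k) (hM : M.Standing μ) (hk : k = 1 ∨ k = 2)
    (t s : ℕ) (hst : s ≤ t) : JointlyProper μ k stackIdx stackIdx (M.yvec t) (M.yvec s) := by
  induction t generalizing s with
  | zero => exact jointlyProper_yvec_zero_left
  | succ t ih =>
    have hlt : ∀ s ≤ t, JointlyProper μ k stackIdx stackIdx (M.yvec (t + 1)) (M.yvec s) :=
      fun s hs => hT.yvec_succ hM hk (hM.isPast_yvec (by omega)) (hT.yvec_x hM hk s _).symm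
        (hT.yvec_vvec hM hk s (by omega)).symm (ih s hs)
    rcases Nat.lt_or_eq_of_le hst with h | rfl
    · exact hlt s (by omega)
    · have hx := (hM.tMemLp_x (t + 1)).aug
      have hyt := hM.tMemLp_yvec t
      have hy1 := hM.tMemLp_yvec (t + 1)
      have hr := hM.tMemLp_residual (M := M) t
      have hPx := hx.mulVec (M.Pibar μ (t + 1) * onesKron R (Fin 4 × Fin n))
      have hPy := hyt.mulVec (M.Pibar1 μ (t + 1))
      have hdec : M.yvec (t + 1) = M.residual μ t +
          (fun ω => (M.Pibar μ (t + 1) * onesKron R (Fin 4 × Fin n)) *ᵥ aug (M.x (t + 1)) ω) +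
          fun ω => M.Pibar1 μ (t + 1) *ᵥ M.yvec t ω := by
        rw [residual]; abel
      have h1 : pcorr μ (M.residual μ t) (M.yvec (t + 1)) =
          pcorr μ (M.residual μ t) (M.residual μ t) := by
        conv_lhs => rw [hdec]
        rw [pcorr_add_right hr (hr.add hPx) hPy, pcorr_add_right hr hr hPx,
          pcorr_mulVec_right hr hx, pcorr_mulVec_right hr hyt, hM.pcorr_residual_x le_rfl,
          hM.pcorr_residual_yvec le_rfl, Matrix.zero_mul, Matrix.zero_mul, add_zero, add_zero]
      have h2 : pcorr μ (M.yvec (t + 1)) (M.yvec (t + 1)) =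
          pcorr μ (M.residual μ t) (M.residual μ t) +
          M.Pibar μ (t + 1) * onesKron R (Fin 4 × Fin n) *
            pcorr μ (aug (M.x (t + 1))) (M.yvec (t + 1)) +
          M.Pibar1 μ (t + 1) * pcorr μ (M.yvec t) (M.yvec (t + 1)) := by
        conv_lhs => enter [2]; rw [hdec]
        rw [pcorr_add_left (hr.add hPx) hPy hy1, pcorr_add_left hr hPx hy1,
          pcorr_mulVec_left hx hy1, pcorr_mulVec_left hyt hy1, h1]
      rw [JointlyProper, h2]
      refine (IsCosetDiag.add (hT.residual_residual hM hk t (ih t le_rfl)) ?_).add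
        ((hT.isCosetDiag_Pibar1 hk _).mul hk (hlt t le_rfl).symm)
      exact ((hT.isCosetDiag_Pibar hk _).mul hk (isCosetDiag_onesKron hk)).mul hk
        (hT.yvec_x hM hk _ _).symm

theorem yvec_yvec (hT : M.ProperConditions μ k) (hM : M.Standing μ) (hk : k = 1 ∨ k = 2)
    (t s : ℕ) : JointlyProper μ k stackIdx stackIdx (M.yvec t) (M.yvec s) := by
  rcases le_total s t with h | h
  · exact hT.yvec_yvec_of_le hM hk t s h
  · exact (hT.yvec_yvec_of_le hM hk s t h).symm

end ProperConditions

end Properness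

end DropoutModel

/-! ### The reduced model -/

namespace DropoutModel

open Tessarine

section Reduced

variable {n R : ℕ} {Ω : Type*} {M : DropoutModel n R Ω} {k : ℕ}

theorem submatrix_one_mulVec {α ι : Type*} [Fintype ι] [DecidableEq ι] (e : α → ι)
    (w : ι → Tessarine) : (1 : Matrix ι ι Tessarine).submatrix e id *ᵥ w = w ∘ e := by
  ext1 a
  simp [Matrix.mulVec, dotProduct, Matrix.one_apply]

theorem red_eq {Ω : Type*} {n : ℕ} (k : ℕ) (X : Ω → Fin n → Tessarine) :
    red k X = fun ω => selK k n *ᵥ aug X ω := by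
  ext1 ω
  rw [selK_eq, submatrix_one_mulVec]
  rfl

theorem xk_eq (t : ℕ) : M.xk k t = fun ω => selK k n *ᵥ aug (M.x t) ω := red_eq k _

theorem yk_eq (t : ℕ) : M.yk k t = fun ω => selR R k n *ᵥ M.yvec t ω := by
  ext1 ω
  rw [selR, submatrix_one_mulVec]
  rfl

theorem yk_zero : M.yk k 0 = 0 := by
  rw [yk_eq, yvec_zero]
  ext1 ω
  exact Matrix.mulVec_zero _

theorem selK_conjTranspose (k n : ℕ) : (selK k n)ᴴ = (selK k n)ᵀ := by
  rw [selK_eq, submatrix_one_conjTranspose]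

theorem selR_conjTranspose (R k n : ℕ) : (selR R k n)ᴴ = (selR R k n)ᵀ := by
  rw [selR, submatrix_one_conjTranspose]

theorem selR_mul_onesKron (R k n : ℕ) : selR R k n * onesKron R (Fin 4 × Fin n) =
    onesKron R (Fin k × Fin n) * selK k n := by
  rw [selR, submatrix_one_mul, selK_eq]
  ext1 a b
  rw [Matrix.mul_apply, Finset.sum_eq_single a.2 (fun c _ hc => by
    simp [onesKron, Ne.symm hc]) (by simp)]
  simp [onesKron, embR, Matrix.one_apply]

theorem matUk_eq (R k n : ℕ) : matUk R k n = selR R k n * matU R n := by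
  rw [selR, submatrix_one_mul]
  ext1 a b
  simp only [matUk, matU, matTk, matT, embR, embK, Matrix.kroneckerMap_apply,
    Matrix.submatrix_apply, Matrix.smul_apply, id]

theorem blk_lt (hk : k = 1 ∨ k = 2) (a : Fin k) : (blk a).val < k := by
  rw [blk_val hk]
  exact a.isLt

theorem exists_embK (hk : k = 1 ∨ k = 2) (x : Fin 4 × Fin n) (hx : x.1.val < k) :
    ∃ b, embK k n b = x := by
  obtain ⟨a, ha⟩ := exists_blk hk x.1 hx
  exact ⟨(a, x.2), Prod.ext ha rfl⟩

theorem exists_embR (hk : k = 1 ∨ k = 2) (x : Fin R × (Fin 4 × Fin n))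
    (hx : (stackIdx x).val < k) : ∃ b, embR R k n b = x := by
  obtain ⟨b, hb⟩ := exists_embK hk x.2 hx
  exact ⟨(x.1, b), Prod.ext rfl hb⟩

end Reduced

section ReducedMoments

variable {n R : ℕ} {Ω : Type*} [MeasurableSpace Ω] {μ : Measure Ω} {M : DropoutModel n R Ω}
  {k : ℕ}

theorem selK_mul_Svec_mul (t : ℕ) :
    selK k n * M.Svec μ t * (selR R k n)ᵀ = M.Sk μ k t := by
  rw [selK_eq, submatrix_one_mul, selR, mul_submatrix_one_transpose]
  rfl

theorem selR_mul_Rvec_mul (t : ℕ) :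
    selR R k n * M.Rvec μ t * (selR R k n)ᵀ = M.Rk μ k t := by
  rw [selR, submatrix_one_mul, mul_submatrix_one_transpose]
  rfl

theorem ProperConditions.selK_mul_Phibar (hT : M.ProperConditions μ k) (hk : k = 1 ∨ k = 2)
    (t : ℕ) : selK k n * M.Phibar t = M.Phik k t * selK k n := by
  rw [selK_eq, submatrix_one_mul, (hT.isCosetDiag_Phibar t).submatrix_eq hk
    (embK_injective hk n) (fun a => blk_lt hk a.1) (exists_embK hk)]
  rfl

/-- `Π_k(t)` is the part of `Π̄^γ(t)` that acts on the first `k` blocks. -/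
theorem ProperConditions.Pik_eq (hT : M.ProperConditions μ k) (hk : k = 1 ∨ k = 2) (t : ℕ) :
    M.Pik μ k t = (M.Pibar μ t).submatrix (embR R k n) (embR R k n) := by
  ext1 a b
  obtain ⟨i, a, j⟩ := a
  obtain ⟨i', b, j'⟩ := b
  have hw := hT.isProperWeight_pvec t id
  rw [Matrix.submatrix_apply, Pibar, matU_mul_diagonal_mul_apply]
  simp only [Pik, diagBlocks, Piki, Matrix.of_apply, embR, embK]
  by_cases hi : i = i'
  · by_cases hj : j = j'
    · simp only [hi, hj, if_true, and_self]
      rcases hk with rfl | rfl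
      · have h1 := fun ν => hw.1 rfl i' ν j'
        simp only [id] at h1
        have ha : blk a = 0 := by revert a; decide
        have hb : blk b = 0 := by revert b; decide
        simp only [h1, ha, hb, if_true]
        ext <;> simp [Fin.sum_univ_four, conjMul, conjSign, ofReal, pvec]
        ring
      · have h2 := hw.2 rfl i' j'
        simp only [id] at h2
        simp only [Fin.sum_univ_four, ← h2.1, ← h2.2]
        have h01 : ∀ c : Fin 2, c = 0 ∧ blk c = 0 ∨ c = 1 ∧ blk c = 1 := by decide
        rcases h01 a with ⟨rfl, ha⟩ | ⟨rfl, ha⟩ <;> rcases h01 b with ⟨rfl, hb⟩ | ⟨rfl, hb⟩ <;>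
          (simp only [ha, hb]; ext <;> simp [conjMul, conjSign, ofReal, pvec]; ring)
    · simp [hj, ofReal_zero]
  · simp [hi]

theorem ProperConditions.selR_mul_Pibar (hT : M.ProperConditions μ k) (hk : k = 1 ∨ k = 2)
    (t : ℕ) : selR R k n * M.Pibar μ t = M.Pik μ k t * selR R k n := by
  rw [hT.Pik_eq hk, selR, submatrix_one_mul]
  exact (hT.isCosetDiag_Pibar hk t).submatrix_eq hk (embR_injective hk R n)
    (fun a => blk_lt hk a.2.1) (exists_embR hk)

theorem ProperConditions.Pik_conjTranspose (hT : M.ProperConditions μ k) (hk : k = 1 ∨ k = 2)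
    (t : ℕ) : (M.Pik μ k t)ᴴ = M.Pik μ k t := by
  rw [hT.Pik_eq hk, Matrix.conjTranspose_submatrix, Pibar_conjTranspose]

theorem ProperConditions.Pibar_mul_selR (hT : M.ProperConditions μ k) (hk : k = 1 ∨ k = 2)
    (t : ℕ) : M.Pibar μ t * (selR R k n)ᵀ = (selR R k n)ᵀ * M.Pik μ k t := by
  have h := congrArg Matrix.conjTranspose (hT.selR_mul_Pibar hk t)
  rwa [Matrix.conjTranspose_mul, Matrix.conjTranspose_mul, selR_conjTranspose,
    Pibar_conjTranspose, hT.Pik_conjTranspose hk] at h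

theorem ProperConditions.Pik_one (hT : M.ProperConditions μ k) (hk : k = 1 ∨ k = 2) :
    M.Pik μ k 1 = 1 := by
  rw [hT.Pik_eq hk, Pibar_one]
  exact Matrix.submatrix_one _ (embR_injective hk R n)

variable (M μ k) in
/-- The part of the residual that belongs to `y_k(t + 1)`. -/
noncomputable def residualK (t : ℕ) : Ω → Fin R × (Fin k × Fin n) → Tessarine :=
  fun ω => selR R k n *ᵥ M.residual μ t ω

theorem residualK_eq (t : ℕ) :
    M.residualK μ k t = fun ω => selR R k n *ᵥ M.residual μ t ω := rfl

theorem ProperConditions.xk_succ (hT : M.ProperConditions μ k) (hk : k = 1 ∨ k = 2) (t : ℕ) :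
    M.xk k (t + 1) = (fun ω => M.Phik k t *ᵥ M.xk k t ω) + red k (M.u t) := by
  rw [xk_eq, xk_eq, red_eq, aug_x_succ]
  ext1 ω
  simp only [Pi.add_apply, Matrix.mulVec_add, Matrix.mulVec_mulVec, hT.selK_mul_Phibar hk]

/-- Under the properness conditions the first `k` blocks form a measurement model by themselves. -/
theorem ProperConditions.yk_succ (hT : M.ProperConditions μ k) (hk : k = 1 ∨ k = 2) (t : ℕ) :
    M.yk k (t + 1) = (fun ω => (M.Pik μ k (t + 1) * onesKron R (Fin k × Fin n)) *ᵥ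
      M.xk k (t + 1) ω) + (fun ω => (1 - M.Pik μ k (t + 1)) *ᵥ M.yk k t ω) +
        M.residualK μ k t := by
  have h1 : M.Pik μ k (t + 1) * onesKron R (Fin k × Fin n) * selK k n =
      selR R k n * (M.Pibar μ (t + 1) * onesKron R (Fin 4 × Fin n)) := by
    rw [Matrix.mul_assoc, ← selR_mul_onesKron, ← Matrix.mul_assoc, ← hT.selR_mul_Pibar hk,
      Matrix.mul_assoc]
  have h2 : (1 - M.Pik μ k (t + 1)) * selR R k n = selR R k n * M.Pibar1 μ (t + 1) := by
    rw [Pibar1_eq, Matrix.sub_mul, Matrix.mul_sub, hT.selR_mul_Pibar hk, Matrix.one_mul,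
      Matrix.mul_one]
  ext1 ω
  simp only [Pi.add_apply, yk_eq, xk_eq, residualK, residual, Pi.sub_apply,
    Matrix.mulVec_mulVec, Matrix.mulVec_sub, h1, h2]
  abel

namespace Standing

theorem tMemLp_xk (hM : M.Standing μ) (k t : ℕ) : TMemLp μ (M.xk k t) := by
  rw [xk_eq]; exact (hM.tMemLp_x t).aug.mulVec _

theorem tMemLp_yk (hM : M.Standing μ) (k t : ℕ) : TMemLp μ (M.yk k t) := by
  rw [yk_eq]; exact (hM.tMemLp_yvec t).mulVec _

theorem tMemLp_uk (hM : M.Standing μ) (k t : ℕ) : TMemLp μ (red k (M.u t)) := by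
  rw [red_eq]; exact (hM.tMemLp_u t).aug.mulVec _

theorem tMemLp_residualK (hM : M.Standing μ) (k t : ℕ) : TMemLp μ (M.residualK μ k t) :=
  (hM.tMemLp_residual t).mulVec _

theorem pcorr_uk_xk (hM : M.Standing μ) {t s : ℕ} (hs : s ≤ t) :
    pcorr μ (red k (M.u t)) (M.xk k s) = 0 := by
  have hx := (hM.tMemLp_x s).aug
  have hu := (hM.tMemLp_u t).aug
  rw [xk_eq, red_eq, pcorr_mulVec_left hu (hx.mulVec _), pcorr_mulVec_right hu hx,
    pcorr_swap_eq_zero (hM.pcorr_x_u hs), Matrix.zero_mul, Matrix.mul_zero]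

theorem ThetaOf_eq (hT : M.ProperConditions μ k) (hk : k = 1 ∨ k = 2) (t : ℕ)
    (P : Matrix (Fin k × Fin n) (Fin k × Fin n) Tessarine) (hP : t = 0 → P = M.D1 μ k) :
    M.ThetaOf μ k P (t + 1) =
      P * (onesKron R (Fin k × Fin n))ᵀ * M.Pik μ k (t + 1) := by
  cases t with
  | zero =>
    rw [hP rfl, zero_add, hT.Pik_one hk, Matrix.mul_one]
    ext1 a b
    simp [ThetaOf, rowBlocks, Matrix.mul_apply, onesKron]
  | succ t => rfl

theorem D1_eq (hM : M.Standing μ) : M.D1 μ k = pcorr μ (M.xk k 1) (M.xk k 1) := by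
  have hx := (hM.tMemLp_x 1).aug
  rw [D1, hM.Gx_eq, xk_eq, pcorr_mulVec_left hx (hx.mulVec _), pcorr_mulVec_right hx hx,
    selK_conjTranspose, Matrix.mul_assoc]

variable [IsProbabilityMeasure μ]

theorem pcorr_residualK_xk (hM : M.Standing μ) {t s : ℕ} (hs : s ≤ t + 1) :
    pcorr μ (M.residualK μ k t) (M.xk k s) = 0 := by
  have hx := (hM.tMemLp_x s).aug
  rw [xk_eq, residualK_eq, pcorr_mulVec_left (hM.tMemLp_residual t) (hx.mulVec _),
    pcorr_mulVec_right (hM.tMemLp_residual t) hx, hM.pcorr_residual_x hs, Matrix.zero_mul,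
    Matrix.mul_zero]

theorem pcorr_residualK_yk (hM : M.Standing μ) {t s : ℕ} (hs : s ≤ t) :
    pcorr μ (M.residualK μ k t) (M.yk k s) = 0 := by
  have hy := hM.tMemLp_yvec s
  rw [yk_eq, residualK_eq, pcorr_mulVec_left (hM.tMemLp_residual t) (hy.mulVec _),
    pcorr_mulVec_right (hM.tMemLp_residual t) hy, hM.pcorr_residual_yvec hs, Matrix.zero_mul,
    Matrix.mul_zero]

theorem pcorr_uk_yk (hM : M.Standing μ) {t s : ℕ} (hs : s < t) :
    pcorr μ (red k (M.u t)) (M.yk k s) = 0 := by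
  have hy := hM.tMemLp_yvec s
  have hu := (hM.tMemLp_u t).aug
  rw [yk_eq, red_eq, pcorr_mulVec_left hu (hy.mulVec _), pcorr_mulVec_right hu hy,
    pcorr_swap_eq_zero (hM.pcorr_yvec_u hs), Matrix.zero_mul, Matrix.mul_zero]

theorem pcorr_uk_residualK (hM : M.Standing μ) (hT : M.ProperConditions μ k)
    (hk : k = 1 ∨ k = 2) (t : ℕ) : pcorr μ (red k (M.u (t + 1))) (M.residualK μ k t) =
      M.Sk μ k (t + 1) * M.Pik μ k (t + 1) := by
  have hr := hM.tMemLp_residual (M := M) t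
  have hu := (hM.tMemLp_u (t + 1)).aug
  rw [residualK_eq, red_eq, pcorr_mulVec_left hu (hr.mulVec _), pcorr_mulVec_right hu hr,
    hM.pcorr_u_residual, ← selK_mul_Svec_mul, selR_conjTranspose, Matrix.mul_assoc (M.Svec μ _),
    hT.Pibar_mul_selR hk]
  simp only [Matrix.mul_assoc]

/-- `Ω_k(t + 1)` is the covariance of `Π_k C_k e + residual`, for an error `e` with covariance `P`
that is orthogonal to the residual. -/
theorem OmegaOf_eq (hM : M.Standing μ) (hT : M.ProperConditions μ k) (hk : k = 1 ∨ k = 2) (t : ℕ)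
    (P : Matrix (Fin k × Fin n) (Fin k × Fin n) Tessarine) (hP : t = 0 → P = M.D1 μ k) :
    M.OmegaOf μ k P (t + 1) = M.Pik μ k (t + 1) * onesKron R (Fin k × Fin n) * P *
      (onesKron R (Fin k × Fin n))ᵀ * M.Pik μ k (t + 1) +
        pcorr μ (M.residualK μ k t) (M.residualK μ k t) := by
  have hr := hM.tMemLp_residual (M := M) t
  rw [residualK_eq, pcorr_mulVec_left hr (hr.mulVec _), pcorr_mulVec_right hr hr,
    selR_conjTranspose, ← Matrix.mul_assoc]
  cases t with
  | zero =>
    rw [hP rfl, hM.pcorr_residual_self_zero, selR_mul_Rvec_mul, zero_add, hT.Pik_one hk,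
      Matrix.one_mul, Matrix.mul_one]
    rfl
  | succ t =>
    rw [hM.pcorr_residual_self_succ, hM.pcorr_mismatch_self, add_comm (_ * _)]
    simp only [OmegaOf, matUk_eq, Matrix.mul_add, Matrix.add_mul, Matrix.conjTranspose_mul,
      selR_conjTranspose, Matrix.mul_assoc]

end Standing

end ReducedMoments

/-! ### The filter -/

section Filter

variable {n R : ℕ} {Ω : Type*} [MeasurableSpace Ω] {μ : Measure Ω}
  {M : DropoutModel n R Ω} {k : ℕ}

variable (M μ k) in
/-- The error `x_k(t+1) - x̂_k(t+1|t)` of the predictor. -/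
noncomputable def predErr (t : ℕ) : Ω → Fin k × Fin n → Tessarine :=
  M.xk k (t + 1) - M.xpred μ k (t + 1)

variable (M μ k) in
/-- The error `x_k(t+1) - x̂_k(t+1|t+1)` of the filter. -/
noncomputable def filtErr (t : ℕ) : Ω → Fin k × Fin n → Tessarine :=
  M.xk k (t + 1) - M.xfilt μ k (t + 1)

variable (M μ k) in
/-- The predictor `x̂_k(t+1|t)` is the projection of the state on the measurements up to time `t`,
with the error covariance that the algorithm gives. -/
structure IsOptimalPred (t : ℕ) : Prop where
  linear : IsLinearIn (M.yk k) t (M.xpred μ k (t + 1))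
  orth : ∀ s ∈ Finset.Icc 1 t, pcorr μ (M.predErr μ k t) (M.yk k s) = 0
  cov : M.Ppred μ k (t + 1) = pcorr μ (M.predErr μ k t) (M.predErr μ k t)

/-- The formula for `ε_k(t)`, `t ≥ 2`, holds for `t = 1` too, as `x̂_k(1|0) = 0` and `y_k(0) = 0`.
-/
theorem innov_eq (t : ℕ) : M.innov μ k (t + 1) = M.yk k (t + 1) -
    (fun ω => (M.Pik μ k (t + 1) * onesKron R (Fin k × Fin n)) *ᵥ M.xpred μ k (t + 1) ω) -
      fun ω => (1 - M.Pik μ k (t + 1)) *ᵥ M.yk k t ω := by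
  cases t with
  | zero =>
    ext1 ω
    simp [innov, innovOf, xpred, yk_zero]
  | succ t => rfl

theorem innov_eq_predErr (hT : M.ProperConditions μ k) (hk : k = 1 ∨ k = 2) (t : ℕ) :
    M.innov μ k (t + 1) = (fun ω => (M.Pik μ k (t + 1) * onesKron R (Fin k × Fin n)) *ᵥ
      M.predErr μ k t ω) + M.residualK μ k t := by
  rw [innov_eq, hT.yk_succ hk]
  ext1 ω
  simp only [Pi.add_apply, Pi.sub_apply, predErr, Matrix.mulVec_sub]
  abel

theorem xfilt_succ (t : ℕ) : M.xfilt μ k (t + 1) =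
    M.xpred μ k (t + 1) + fun ω => M.L μ k (t + 1) *ᵥ M.innov μ k (t + 1) ω := rfl

theorem xpred_succ (t : ℕ) : M.xpred μ k (t + 2) =
    (fun ω => M.Phik k (t + 1) *ᵥ M.xfilt μ k (t + 1) ω) +
      fun ω => M.H μ k (t + 1) *ᵥ M.innov μ k (t + 1) ω := rfl

theorem filtErr_eq (t : ℕ) : M.filtErr μ k t =
    M.predErr μ k t - fun ω => M.L μ k (t + 1) *ᵥ M.innov μ k (t + 1) ω := by
  rw [filtErr, predErr, xfilt_succ]; abel

theorem predErr_succ (hT : M.ProperConditions μ k) (hk : k = 1 ∨ k = 2) (t : ℕ) :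
    M.predErr μ k (t + 1) = (fun ω => M.Phik k (t + 1) *ᵥ M.filtErr μ k t ω) +
      (red k (M.u (t + 1)) - fun ω => M.H μ k (t + 1) *ᵥ M.innov μ k (t + 1) ω) := by
  rw [predErr, hT.xk_succ hk, xpred_succ]
  ext1 ω
  simp only [Pi.add_apply, Pi.sub_apply, filtErr, Matrix.mulVec_sub]
  abel

namespace IsOptimalPred

variable {t : ℕ}

theorem tMemLp_predErr (h : M.IsOptimalPred μ k t) (hM : M.Standing μ) :
    TMemLp μ (M.predErr μ k t) :=
  (hM.tMemLp_xk k _).sub (h.linear.tMemLp (hM.tMemLp_yk k))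

theorem linear_yk_sub_innov (h : M.IsOptimalPred μ k t) :
    IsLinearIn (M.yk k) t (M.yk k (t + 1) - M.innov μ k (t + 1)) := by
  have h0 : IsLinearIn (M.yk k) t (M.yk k t) := by
    cases t with
    | zero => rw [yk_zero]; exact IsLinearIn.zero
    | succ t => exact IsLinearIn.datum (by simp)
  have h1 := (h.linear.mulVec (M.Pik μ k (t + 1) * onesKron R (Fin k × Fin n))).add
    (h0.mulVec (1 - M.Pik μ k (t + 1)))
  rw [innov_eq, sub_sub, sub_sub_cancel]
  exact h1

theorem tMemLp_innov (h : M.IsOptimalPred μ k t) (hM : M.Standing μ) :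
    TMemLp μ (M.innov μ k (t + 1)) := by
  have := (hM.tMemLp_yk k (t + 1)).sub (h.linear_yk_sub_innov.tMemLp (hM.tMemLp_yk k))
  rwa [sub_sub_cancel] at this

theorem linear_innov (h : M.IsOptimalPred μ k t) :
    IsLinearIn (M.yk k) (t + 1) (M.innov μ k (t + 1)) := by
  have := (IsLinearIn.datum (Y := M.yk k) (t := t + 1) (s := t + 1) (by simp)).sub
    (h.linear_yk_sub_innov.of_le (Nat.le_succ t))
  rwa [sub_sub_cancel] at this

theorem linear_xfilt (h : M.IsOptimalPred μ k t) :
    IsLinearIn (M.yk k) (t + 1) (M.xfilt μ k (t + 1)) := by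
  rw [xfilt_succ]
  exact (h.linear.of_le (Nat.le_succ t)).add (h.linear_innov.mulVec _)

theorem tMemLp_filtErr (h : M.IsOptimalPred μ k t) (hM : M.Standing μ) :
    TMemLp μ (M.filtErr μ k t) :=
  (hM.tMemLp_xk k _).sub (h.linear_xfilt.tMemLp (hM.tMemLp_yk k))

/-- Orthogonality to the earlier measurements and the innovation implies orthogonality to the
present measurement. -/
theorem orth_succ (h : M.IsOptimalPred μ k t) (hM : M.Standing μ) {ι : Type*}
    {E : Ω → ι → Tessarine} (hE : TMemLp μ E)
    (h0 : ∀ s ∈ Finset.Icc 1 t, pcorr μ E (M.yk k s) = 0)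
    (h1 : pcorr μ E (M.innov μ k (t + 1)) = 0) :
    ∀ s ∈ Finset.Icc 1 (t + 1), pcorr μ E (M.yk k s) = 0 := by
  intro s hs
  rw [Finset.mem_Icc] at hs
  rcases Nat.lt_or_eq_of_le hs.2 with hlt | rfl
  · exact h0 s (Finset.mem_Icc.2 ⟨hs.1, by omega⟩)
  · have hl := h.linear_yk_sub_innov
    have := hl.pcorr_eq_zero (hM.tMemLp_yk k) hE h0
    rwa [pcorr_sub_right hE (hM.tMemLp_yk k _) (h.tMemLp_innov hM), h1, sub_zero] at this

variable [IsProbabilityMeasure μ]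

theorem innov_orth (h : M.IsOptimalPred μ k t) (hM : M.Standing μ)
    (hT : M.ProperConditions μ k) (hk : k = 1 ∨ k = 2) :
    ∀ s ∈ Finset.Icc 1 t, pcorr μ (M.innov μ k (t + 1)) (M.yk k s) = 0 := by
  intro s hs
  have he := h.tMemLp_predErr hM
  rw [innov_eq_predErr hT hk, pcorr_add_left (he.mulVec _) (hM.tMemLp_residualK k t)
    (hM.tMemLp_yk k s), pcorr_mulVec_left he (hM.tMemLp_yk k s), h.orth s hs, Matrix.mul_zero,
    zero_add, hM.pcorr_residualK_yk (Finset.mem_Icc.1 hs).2]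

theorem pcorr_residualK_xpred (h : M.IsOptimalPred μ k t) (hM : M.Standing μ) :
    pcorr μ (M.residualK μ k t) (M.xpred μ k (t + 1)) = 0 :=
  h.linear.pcorr_eq_zero (hM.tMemLp_yk k) (hM.tMemLp_residualK k t)
    fun _ hs => hM.pcorr_residualK_yk (Finset.mem_Icc.1 hs).2

theorem pcorr_residualK_predErr (h : M.IsOptimalPred μ k t) (hM : M.Standing μ) :
    pcorr μ (M.residualK μ k t) (M.predErr μ k t) = 0 := by
  rw [predErr, pcorr_sub_right (hM.tMemLp_residualK k t) (hM.tMemLp_xk k _)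
    (h.linear.tMemLp (hM.tMemLp_yk k)), hM.pcorr_residualK_xk le_rfl,
    h.pcorr_residualK_xpred hM, sub_zero]

theorem pcorr_u_predErr (h : M.IsOptimalPred μ k t) (hM : M.Standing μ) :
    pcorr μ (red k (M.u (t + 1))) (M.predErr μ k t) = 0 := by
  rw [predErr, pcorr_sub_right (hM.tMemLp_uk k _) (hM.tMemLp_xk k _)
    (h.linear.tMemLp (hM.tMemLp_yk k)), hM.pcorr_uk_xk le_rfl,
    h.linear.pcorr_eq_zero (hM.tMemLp_yk k) (hM.tMemLp_uk k _)
      fun _ hs => hM.pcorr_uk_yk (by have := (Finset.mem_Icc.1 hs).2; omega), sub_zero]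

theorem pcorr_u_innov (h : M.IsOptimalPred μ k t) (hM : M.Standing μ)
    (hT : M.ProperConditions μ k) (hk : k = 1 ∨ k = 2) :
    pcorr μ (red k (M.u (t + 1))) (M.innov μ k (t + 1)) =
      M.Sk μ k (t + 1) * M.Pik μ k (t + 1) := by
  have he := h.tMemLp_predErr hM
  have hu := hM.tMemLp_uk k (t + 1)
  rw [innov_eq_predErr hT hk, pcorr_add_right hu (he.mulVec _) (hM.tMemLp_residualK k t),
    pcorr_mulVec_right hu he, h.pcorr_u_predErr hM, Matrix.zero_mul, zero_add,
    hM.pcorr_uk_residualK hT hk]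

theorem pcorr_predErr_innov (h : M.IsOptimalPred μ k t) (hM : M.Standing μ)
    (hT : M.ProperConditions μ k) (hk : k = 1 ∨ k = 2) :
    pcorr μ (M.predErr μ k t) (M.innov μ k (t + 1)) = M.Theta μ k (t + 1) := by
  have he := h.tMemLp_predErr hM
  rw [innov_eq_predErr hT hk, pcorr_add_right he (he.mulVec _) (hM.tMemLp_residualK k t),
    pcorr_mulVec_right he he, pcorr_swap_eq_zero (h.pcorr_residualK_predErr hM), add_zero, ← h.cov,
    Theta, Standing.ThetaOf_eq hT hk t _ (by rintro rfl; rfl), Matrix.conjTranspose_mul,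
    hT.Pik_conjTranspose hk, onesKron_conjTranspose, Matrix.mul_assoc]

theorem Omega_eq (h : M.IsOptimalPred μ k t) (hM : M.Standing μ)
    (hT : M.ProperConditions μ k) (hk : k = 1 ∨ k = 2) :
    M.Omega μ k (t + 1) = pcorr μ (M.innov μ k (t + 1)) (M.innov μ k (t + 1)) := by
  have he := h.tMemLp_predErr hM
  have hi := h.tMemLp_innov hM
  have hw := hM.tMemLp_residualK (M := M) k t
  have h1 : pcorr μ (M.innov μ k (t + 1)) (M.innov μ k (t + 1)) =
      M.Pik μ k (t + 1) * onesKron R (Fin k × Fin n) *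
        pcorr μ (M.predErr μ k t) (M.innov μ k (t + 1)) +
      pcorr μ (M.residualK μ k t) (M.innov μ k (t + 1)) := by
    conv_lhs => enter [2]; rw [innov_eq_predErr hT hk]
    rw [pcorr_add_left (he.mulVec _) hw hi, pcorr_mulVec_left he hi]
  have h2 : pcorr μ (M.residualK μ k t) (M.innov μ k (t + 1)) =
      pcorr μ (M.residualK μ k t) (M.residualK μ k t) := by
    rw [innov_eq_predErr hT hk, pcorr_add_right hw (he.mulVec _) hw, pcorr_mulVec_right hw he,
      h.pcorr_residualK_predErr hM, Matrix.zero_mul, zero_add]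
  rw [h1, h2, h.pcorr_predErr_innov hM hT hk, Theta,
    Standing.ThetaOf_eq hT hk t _ (by rintro rfl; rfl), Omega,
    hM.OmegaOf_eq hT hk t _ (by rintro rfl; rfl)]
  simp only [Matrix.mul_assoc]

theorem Theta_eq (h : M.IsOptimalPred μ k t) (hM : M.Standing μ)
    (hT : M.ProperConditions μ k) (hk : k = 1 ∨ k = 2) :
    M.Theta μ k (t + 1) = pcorr μ (M.xk k (t + 1)) (M.innov μ k (t + 1)) := by
  have hp := h.linear.tMemLp (hM.tMemLp_yk k)
  have hi := h.tMemLp_innov hM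
  have h1 := h.linear.pcorr_eq_zero (hM.tMemLp_yk k) hi (h.innov_orth hM hT hk)
  rw [← h.pcorr_predErr_innov hM hT hk, predErr, pcorr_sub_left (hM.tMemLp_xk k _) hp hi,
    pcorr_swap_eq_zero h1, sub_zero]

theorem Omega_conjTranspose (h : M.IsOptimalPred μ k t) (hM : M.Standing μ)
    (hT : M.ProperConditions μ k) (hk : k = 1 ∨ k = 2) :
    (M.Omega μ k (t + 1))ᴴ = M.Omega μ k (t + 1) := by
  rw [h.Omega_eq hM hT hk, pcorr_conjTranspose]

theorem pcorr_filtErr_innov (h : M.IsOptimalPred μ k t) (hM : M.Standing μ)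
    (hT : M.ProperConditions μ k) (hk : k = 1 ∨ k = 2)
    (hΩ : IsUnit (M.Omega μ k (t + 1)).det) :
    pcorr μ (M.filtErr μ k t) (M.innov μ k (t + 1)) = 0 := by
  have he := h.tMemLp_predErr hM
  have hi := h.tMemLp_innov hM
  rw [filtErr_eq, pcorr_sub_left he (hi.mulVec _) hi, pcorr_mulVec_left hi hi,
    ← h.Omega_eq hM hT hk, h.pcorr_predErr_innov hM hT hk, L, Matrix.mul_assoc,
    Matrix.nonsing_inv_mul _ hΩ, Matrix.mul_one, sub_self]

theorem filtErr_orth (h : M.IsOptimalPred μ k t) (hM : M.Standing μ)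
    (hT : M.ProperConditions μ k) (hk : k = 1 ∨ k = 2)
    (hΩ : IsUnit (M.Omega μ k (t + 1)).det) :
    ∀ s ∈ Finset.Icc 1 (t + 1), pcorr μ (M.filtErr μ k t) (M.yk k s) = 0 := by
  have he := h.tMemLp_predErr hM
  have hi := h.tMemLp_innov hM
  refine h.orth_succ hM (h.tMemLp_filtErr hM) (fun s hs => ?_)
    (h.pcorr_filtErr_innov hM hT hk hΩ)
  rw [filtErr_eq, pcorr_sub_left he (hi.mulVec _) (hM.tMemLp_yk k s),
    pcorr_mulVec_left hi (hM.tMemLp_yk k s), h.orth s hs, h.innov_orth hM hT hk s hs,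
    Matrix.mul_zero, sub_zero]

theorem Pfilt_eq (h : M.IsOptimalPred μ k t) (hM : M.Standing μ)
    (hT : M.ProperConditions μ k) (hk : k = 1 ∨ k = 2)
    (hΩ : IsUnit (M.Omega μ k (t + 1)).det) :
    M.Pfilt μ k (t + 1) = pcorr μ (M.filtErr μ k t) (M.filtErr μ k t) := by
  have he := h.tMemLp_predErr hM
  have hi := h.tMemLp_innov hM
  have hf := h.tMemLp_filtErr hM
  have h1 : pcorr μ (M.filtErr μ k t) (M.filtErr μ k t) =
      pcorr μ (M.filtErr μ k t) (M.predErr μ k t) := by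
    conv_lhs => enter [3]; rw [filtErr_eq]
    rw [pcorr_sub_right hf he (hi.mulVec _), pcorr_mulVec_right hf hi,
      h.pcorr_filtErr_innov hM hT hk hΩ, Matrix.zero_mul, sub_zero]
  rw [h1, filtErr_eq, pcorr_sub_left he (hi.mulVec _) he, pcorr_mulVec_left hi he,
    ← pcorr_conjTranspose (M.predErr μ k t) (M.innov μ k (t + 1)),
    h.pcorr_predErr_innov hM hT hk, ← h.cov, L]
  rfl

/-- One step of the Kalman recursion. The new prediction error is the filtering error, propagated by
`Φ_k`, plus the error in estimating the state noise from the innovation. -/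
theorem succ (h : M.IsOptimalPred μ k t) (hM : M.Standing μ)
    (hT : M.ProperConditions μ k) (hk : k = 1 ∨ k = 2)
    (hΩ : IsUnit (M.Omega μ k (t + 1)).det) : M.IsOptimalPred μ k (t + 1) := by
  have he := h.tMemLp_predErr hM
  have hi := h.tMemLp_innov hM
  have hf := h.tMemLp_filtErr hM
  have hu := hM.tMemLp_uk k (t + 1)
  have hfi := h.pcorr_filtErr_innov hM hT hk hΩ
  have hD := hu.sub (hi.mulVec (M.H μ k (t + 1)))
  have hHΩ : M.H μ k (t + 1) * M.Omega μ k (t + 1) = M.Sk μ k (t + 1) * M.Pik μ k (t + 1) := by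
    rw [H, HOf, ← Omega, Matrix.mul_assoc, Matrix.nonsing_inv_mul _ hΩ, Matrix.mul_one]
  have hui := h.pcorr_u_innov hM hT hk
  -- the noise estimate makes its error orthogonal to the innovation
  have hDi : pcorr μ (red k (M.u (t + 1)) - fun ω => M.H μ k (t + 1) *ᵥ M.innov μ k (t + 1) ω)
      (M.innov μ k (t + 1)) = 0 := by
    rw [pcorr_sub_left hu (hi.mulVec _) hi, hui, pcorr_mulVec_left hi hi, ← h.Omega_eq hM hT hk,
      hHΩ, sub_self]
  refine ⟨?_, ?_, ?_⟩
  · rw [xpred_succ]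
    exact (h.linear_xfilt.mulVec _).add (h.linear_innov.mulVec _)
  · rw [predErr_succ hT hk]
    refine h.orth_succ hM ((hf.mulVec _).add hD) (fun s hs => ?_) ?_
    · have hy := hM.tMemLp_yk (M := M) k s
      have hs' := Finset.mem_Icc.1 hs
      rw [pcorr_add_left (hf.mulVec _) hD hy, pcorr_sub_left hu (hi.mulVec _) hy,
        pcorr_mulVec_left hf hy, pcorr_mulVec_left hi hy,
        h.filtErr_orth hM hT hk hΩ s (Finset.mem_Icc.2 ⟨hs'.1, by omega⟩),
        h.innov_orth hM hT hk s hs, hM.pcorr_uk_yk (by omega), Matrix.mul_zero,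
        Matrix.mul_zero, sub_zero, add_zero]
    · rw [pcorr_add_left (hf.mulVec _) hD hi, pcorr_mulVec_left hf hi, hfi, hDi,
        Matrix.mul_zero, add_zero]
  · have hfu : pcorr μ (M.filtErr μ k t) (red k (M.u (t + 1))) =
        -(M.Theta μ k (t + 1) * (M.H μ k (t + 1))ᴴ) := by
      rw [filtErr_eq, pcorr_sub_left he (hi.mulVec _) hu, pcorr_mulVec_left hi hu,
        pcorr_swap_eq_zero (h.pcorr_u_predErr hM), ← pcorr_conjTranspose _ (M.innov μ k (t + 1)),
        hui, ← hHΩ, Matrix.conjTranspose_mul, h.Omega_conjTranspose hM hT hk, L, zero_sub,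
        ← Matrix.mul_assoc, Matrix.mul_assoc (M.Theta μ k (t + 1)),
        Matrix.nonsing_inv_mul _ hΩ, Matrix.mul_one]
    have hfD : pcorr μ (M.filtErr μ k t)
        (red k (M.u (t + 1)) - fun ω => M.H μ k (t + 1) *ᵥ M.innov μ k (t + 1) ω) =
        -(M.Theta μ k (t + 1) * (M.H μ k (t + 1))ᴴ) := by
      rw [pcorr_sub_right hf hu (hi.mulVec _), pcorr_mulVec_right hf hi, hfi, Matrix.zero_mul,
        sub_zero, hfu]
    have hDf := congrArg Matrix.conjTranspose hfD
    rw [pcorr_conjTranspose] at hDf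
    have hDD : pcorr μ
        (red k (M.u (t + 1)) - fun ω => M.H μ k (t + 1) *ᵥ M.innov μ k (t + 1) ω)
        (red k (M.u (t + 1)) - fun ω => M.H μ k (t + 1) *ᵥ M.innov μ k (t + 1) ω) =
        M.Qk μ k (t + 1) -
          M.H μ k (t + 1) * M.Omega μ k (t + 1) * (M.H μ k (t + 1))ᴴ := by
      rw [pcorr_sub_right hD hu (hi.mulVec _), pcorr_mulVec_right hD hi, hDi, Matrix.zero_mul,
        sub_zero, pcorr_sub_left hu (hi.mulVec _) hu, pcorr_mulVec_left hi hu,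
        ← pcorr_conjTranspose _ (M.innov μ k (t + 1)), hui, ← hHΩ, Matrix.conjTranspose_mul,
        h.Omega_conjTranspose hM hT hk, ← Matrix.mul_assoc]
      rfl
    have hΦ := hf.mulVec (M.Phik k (t + 1))
    rw [predErr_succ hT hk, pcorr_add_left hΦ hD (hΦ.add hD), pcorr_add_right hΦ hΦ hD,
      pcorr_add_right hD hΦ hD, pcorr_mulVec_left hf hΦ, pcorr_mulVec_right hf hf,
      pcorr_mulVec_left hf hD, pcorr_mulVec_right hD hf, hDD,
      hDf, hfD, ← h.Pfilt_eq hM hT hk hΩ]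
    change M.Phik k (t + 1) * M.Pfilt μ k (t + 1) * (M.Phik k (t + 1))ᴴ
      - M.Phik k (t + 1) * M.Theta μ k (t + 1) * (M.H μ k (t + 1))ᴴ
      - M.H μ k (t + 1) * (M.Theta μ k (t + 1))ᴴ * (M.Phik k (t + 1))ᴴ
      - M.H μ k (t + 1) * M.Omega μ k (t + 1) * (M.H μ k (t + 1))ᴴ + M.Qk μ k (t + 1) = _
    simp only [Matrix.conjTranspose_neg, Matrix.conjTranspose_mul,
      Matrix.conjTranspose_conjTranspose, Matrix.mul_neg, Matrix.neg_mul, Matrix.mul_assoc]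
    abel

end IsOptimalPred

theorem isOptimalPred [IsProbabilityMeasure μ] (hM : M.Standing μ) (hT : M.ProperConditions μ k)
    (hk : k = 1 ∨ k = 2) (hΩ : ∀ t, 1 ≤ t → IsUnit (M.Omega μ k t).det) (t : ℕ) :
    M.IsOptimalPred μ k t := by
  induction t with
  | zero =>
    refine ⟨IsLinearIn.zero, fun s hs => absurd (Finset.mem_Icc.1 hs) (by omega), ?_⟩
    have h : M.predErr μ k 0 = M.xk k 1 := sub_zero _
    rw [h]
    exact hM.D1_eq
  | succ t ih => exact ih.succ hM hT hk (hΩ _ (by omega))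

end Filter

end DropoutModel

/-! ### The estimator of the state and the unused conjugate blocks -/

namespace DropoutModel

open Tessarine

section FirstBlock

variable {n R : ℕ} {Ω : Type*} {M : DropoutModel n R Ω} {k : ℕ}

theorem selFirst_eq (hk : 0 < k) : selFirst k n =
    (1 : Matrix (Fin k × Fin n) (Fin k × Fin n) Tessarine).submatrix
      (fun j => (⟨0, hk⟩, j)) id := by
  ext1 j a
  simp [selFirst, Matrix.one_apply, Prod.ext_iff, Fin.ext_iff, eq_comm]

theorem selFirst_conjTranspose (hk : 0 < k) : (selFirst k n)ᴴ = (selFirst k n)ᵀ := by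
  rw [selFirst_eq hk, submatrix_one_conjTranspose]

theorem selFirst_mulVec_xk (hk : 0 < k) (t : ℕ) :
    (fun ω => selFirst k n *ᵥ M.xk k t ω) = M.x t := by
  ext1 ω
  rw [selFirst_eq hk, submatrix_one_mulVec]
  rfl

theorem isLinearIn_yvec_of_yk {ι : Type*} {t : ℕ} {Z : Ω → ι → Tessarine}
    (h : IsLinearIn (M.yk k) t Z) : IsLinearIn M.yvec t Z := by
  obtain ⟨A, hA⟩ := h
  refine ⟨fun s => A s * selR R k n, fun ω => ?_⟩
  rw [hA]
  simp only [yk_eq, Matrix.mulVec_mulVec]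

variable [MeasurableSpace Ω] {μ : Measure Ω}

theorem sub_xT_eq (hk : 0 < k) (t : ℕ) : M.x t - M.xT μ k t =
    fun ω => selFirst k n *ᵥ (M.xk k t - M.xfilt μ k t) ω := by
  conv_lhs => rw [← selFirst_mulVec_xk hk t]
  ext1 ω
  exact (Matrix.mulVec_sub _ _ _).symm

theorem xfilt_isOptimal [IsProbabilityMeasure μ] (hM : M.Standing μ)
    (hT : M.ProperConditions μ k) (hk : k = 1 ∨ k = 2)
    (hΩ : ∀ t, 1 ≤ t → IsUnit (M.Omega μ k t).det) (t : ℕ) :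
    IsLinearIn (M.yk k) t (M.xfilt μ k t) ∧
      (∀ s ∈ Finset.Icc 1 t, pcorr μ (M.xk k t - M.xfilt μ k t) (M.yk k s) = 0) ∧
      M.Pfilt μ k t = pcorr μ (M.xk k t - M.xfilt μ k t) (M.xk k t - M.xfilt μ k t) := by
  cases t with
  | zero =>
    refine ⟨IsLinearIn.zero, fun s hs => absurd (Finset.mem_Icc.1 hs) (by omega), ?_⟩
    have h : M.xk k 0 - M.xfilt μ k 0 = M.xk k 0 := sub_zero _
    rw [h]
    rfl
  | succ t =>
    have h := isOptimalPred hM hT hk hΩ t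
    exact ⟨h.linear_xfilt, h.filtErr_orth hM hT hk (hΩ _ (by omega)),
      h.Pfilt_eq hM hT hk (hΩ _ (by omega))⟩

/-- By properness, the conjugate blocks that the reduced measurements leave out are orthogonal to
the state and to the reduced measurements, so that they do not improve the estimator. -/
theorem ProperConditions.pcorr_yvec_eq_zero [IsProbabilityMeasure μ]
    (hT : M.ProperConditions μ k) (hM : M.Standing μ) (hk : k = 1 ∨ k = 2) {t s : ℕ}
    {Z : Ω → Fin n → Tessarine} (hZ : IsLinearIn (M.yk k) t Z)
    (h0 : pcorr μ (M.x t - Z) (M.yk k s) = 0) : pcorr μ (M.x t - Z) (M.yvec s) = 0 := by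
  ext1 j y
  by_cases hy : (stackIdx y).val < k
  · obtain ⟨b, rfl⟩ := exists_embR hk y hy
    exact congrFun (congrFun h0 j) b
  · have hx : pcorr μ (M.x t) (M.yvec s) j y = 0 := by
      refine (hT.yvec_x hM hk s t).symm (0, j) y ?_
      rw [conjMul_zero_left]
      exact not_lt.1 hy
    have hZ0 : pcorr μ Z (M.yvec s) j y = 0 := by
      refine hZ.pcorr_apply_eq_zero (hM.tMemLp_yk k) (hM.tMemLp_yvec s) y (fun r _ b => ?_) j
      refine hT.yvec_yvec hM hk r s (embR R k n b) y (not_lt.1 fun h => hy ?_)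
      have hb : (conjMul 0 (stackIdx (embR R k n b))).val < k := by
        rw [conjMul_zero_left]; exact blk_lt hk b.2.1
      simpa only [conjMul_zero_left] using conjMul_lt_trans hk hb h
    rw [pcorr_sub_left (hM.tMemLp_x t) (hZ.tMemLp (hM.tMemLp_yk k)) (hM.tMemLp_yvec s),
      Matrix.sub_apply, hx, hZ0, sub_zero]
    rfl

end FirstBlock

end DropoutModel

theorem theorem1 {Ω : Type*} [MeasurableSpace Ω] (μ : Measure Ω) [IsProbabilityMeasure μ]
    (n R k : ℕ) (hk : k = 1 ∨ k = 2) (M : DropoutModel n R Ω)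
    (hM : M.Standing μ) (hT : M.ProperConditions μ k)
    (hΩ : ∀ t, 1 ≤ t → IsUnit (M.Omega μ k t).det) :
    -- the output of the algorithm is the LLMS filter of the state, both from the reduced and
    -- from the complete augmented measurements, and its error pseudo covariance matrix
    (∀ t, IsLLMS μ (M.x t) (M.yk k) t (M.xT μ k t) ∧
      IsLLMS μ (M.x t) M.yvec t (M.xT μ k t) ∧
      M.PT μ k t = pcorr μ (M.x t - M.xT μ k t) (M.x t - M.xT μ k t)) ∧
    -- filter and predictor of the reduced state, with their error pseudo covariance matrices
    (∀ t, IsLLMS μ (M.xk k t) (M.yk k) t (M.xfilt μ k t) ∧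
      M.Pfilt μ k t = pcorr μ (M.xk k t - M.xfilt μ k t) (M.xk k t - M.xfilt μ k t)) ∧
    (∀ t, IsLLMS μ (M.xk k (t + 1)) (M.yk k) t (M.xpred μ k (t + 1)) ∧
      M.Ppred μ k (t + 1) =
        pcorr μ (M.xk k (t + 1) - M.xpred μ k (t + 1)) (M.xk k (t + 1) - M.xpred μ k (t + 1))) ∧
    -- the innovations, `Θ_k` and `Ω_k`
    (∀ t, IsLLMS μ (M.yk k (t + 1)) (M.yk k) t (M.yk k (t + 1) - M.innov μ k (t + 1)) ∧
      M.Theta μ k (t + 1) = pcorr μ (M.xk k (t + 1)) (M.innov μ k (t + 1)) ∧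
      M.Omega μ k (t + 1) = pcorr μ (M.innov μ k (t + 1)) (M.innov μ k (t + 1))) ∧
    -- the recursions for the second-order moments
    (∀ t, M.Gx μ t = pcorr μ (aug (M.x t)) (aug (M.x t)) ∧
      M.Gxy μ (t + 1) = pcorr μ (aug (M.x (t + 1))) (M.yvec (t + 1)) ∧
      M.Gy μ (t + 1) = pcorr μ (M.yvec (t + 1)) (M.yvec (t + 1))) := by
  have hk0 : 0 < k := by omega
  have hy := hM.tMemLp_yk (M := M) k
  have hf := M.xfilt_isOptimal (μ := μ) hM hT hk hΩ
  have hp := M.isOptimalPred (μ := μ) hM hT hk hΩ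
  refine ⟨fun t => ?_, fun t => ?_, fun t => ?_, fun t => ?_, fun t => ?_⟩
  · obtain ⟨hl, ho, hP⟩ := hf t
    have hE := (hM.tMemLp_xk k t).sub (hl.tMemLp hy)
    have hl' : IsLinearIn (M.yk k) t (M.xT μ k t) := hl.mulVec _
    have ho' : ∀ s ∈ Finset.Icc 1 t, pcorr μ (M.x t - M.xT μ k t) (M.yk k s) = 0 := fun s hs => by
      rw [DropoutModel.sub_xT_eq hk0, pcorr_mulVec_left hE (hy s), ho s hs,
        Matrix.mul_zero]
    refine ⟨isLLMS_of_orthogonal (hM.tMemLp_x t) hy hl' ho',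
      isLLMS_of_orthogonal (hM.tMemLp_x t) hM.tMemLp_yvec
        (DropoutModel.isLinearIn_yvec_of_yk hl')
        fun s hs => hT.pcorr_yvec_eq_zero hM hk hl' (ho' s hs), ?_⟩
    rw [DropoutModel.sub_xT_eq hk0, pcorr_mulVec_left hE (hE.mulVec _),
      pcorr_mulVec_right hE hE, ← hP, DropoutModel.selFirst_conjTranspose hk0,
      ← Matrix.mul_assoc]
    rfl
  · obtain ⟨hl, ho, hP⟩ := hf t
    exact ⟨isLLMS_of_orthogonal (hM.tMemLp_xk k t) hy hl ho, hP⟩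
  · have h := hp t
    exact ⟨isLLMS_of_orthogonal (hM.tMemLp_xk k _) hy h.linear h.orth, h.cov⟩
  · have h := hp t
    refine ⟨isLLMS_of_orthogonal (hy _) hy h.linear_yk_sub_innov ?_,
      h.Theta_eq hM hT hk, h.Omega_eq hM hT hk⟩
    rw [sub_sub_cancel]
    exact h.innov_orth hM hT hk
  · exact ⟨hM.Gx_eq t, hM.Gxy_eq t, hM.Gy_eq t⟩
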